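/- **Theorem 2 (Complexity of the Sketched Answer Set Problem).** The decision version of propositional SkASP is in NP. Here an instance of propositional (variable-free) SkASP consists of: - a finite set $P$ of rules $a \leftarrow b_1,\dots,b_n$ and integrity constraints $\leftarrow b_1,\dots,b_n$, where $a$ is a ground atom $p(t_1,\dots,t_m)$ ($m \ge 0$) and each $b_i$ is an atom, a negated atom $\mathit{not}\ c$, a comparison of ground arithmetic terms, or an aggregate $t=\#\mathit{agg}\{\bar t_1:\bar l_1;\dots;\bar t_k:\bar l_k\}$ with $\mathit{agg}\in\{\max,\min,\mathrm{count},\mathrm{sum}\}$, whose conditions $\bar l_j$ are lists of atoms, negated atoms and comparisons. Predicates of atoms, the choice between an atom and its negation, comparison predicates ($=,\neq,<,>,\ge,\le,\top$), arithmetic operators ($+,-,\times,\div,\mathrm{dist}$) and aggregate functions may be *sketched*, i.e. left open as sketched variables, and a sketched variable may occur several times. There are no choice rules; - the finite set $S$ of sketched variables, each with a finite domain of values of its kind (predicates of the arity required, resp. elements of $\{\emptyset,\mathit{not}\}$ or of the lists above), and an integer preference $f(s\mapsto d)$ for each $s\in S$ and each $d$ in the domain of $s$; - finite sets $E^+$ and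 $E^-$ of positive and negative examples, each example being a finite set of ground atoms. The sketch has to be *stratified*: let $p$ depend directly on $q$ if $q$ occurs in the body of a rule whose head is $p$ or is a sketched atom that can become an atom of $p$, or if $p$ is a sketched predicate with $q$ in its domain; the dependency is negative if $q$ occurs there below $\mathit{not}$, below a sketched negation that can become $\mathit{not}$, or inside an aggregate. No cycle of dependencies may contain a negative one. A substitution $\theta$, giving each $s\in S$ a value in its domain, is *satisfying* if $P\theta\cup e$ has an answer set for every $e\in E^+$ and for no $e\in E^-$. It is preferred over $\theta'$ if $f(s\mapsto\theta(s))\ge f(s\mapsto\theta'(s))$ for all $s\in S$, with at least one strict inequality. The decision problem asks whether there is a satisfying $\theta$ over which no satisfying substitution is preferred. (Such a $\theta$ exists iff some substitution is satisfying.) With instances written as words over a finite alphabet, numbers in binary, the set of words that represent a (well-formed, stratified) instance with answer "yes" is in NP. -/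

import Mathlib

/-! ### The class NP

A language is in NP if membership is witnessed by polynomially long certificates that a
deterministic multi-stack Turing machine checks in polynomial time. The verifier reads the word
`x` followed by the certificate `w`, written with marked symbols, so that the two can be told
apart. (In `Turing.FinTM2` only finitely many symbols can ever occur on a stack, since the internal
memory, the set of labels and the input alphabet are finite.) -/

/-- `L` is in NP: there are a polynomial-time verifier `V` and a polynomial bound `p` on the length
of certificates such that `x ∈ L` iff `V` accepts `x` with some certificate of length at most
`p(|x|)`. -/
def InNP {Γ : Type} (L : Language Γ) : Prop :=
  ∃ (V : List Γ × List Bool → Bool) (p : Polynomial ℕ),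
    Nonempty (Turing.TM2ComputableInPolyTime
      (Computability.encodingProd (Computability.encodingList Γ)
        (Computability.encodingList Bool)).encode
      Computability.encodeBool V) ∧
    ∀ x : List Γ, x ∈ L ↔ ∃ w : List Bool, w.length ≤ p.eval x.length ∧ V (x, w) = true

namespace SkASP

/-! ### Syntax of variable-free sketched answer set programs -/

/-- Names of predicates, constants and sketched variables are words. -/
abbrev Name := List Bool

/-- Constants: integers and symbolic constants. -/
inductive Const where
  | int (z : ℤ)
  | sym (c : Name)

/-- A predicate `p/n`. Propositional atoms are the case `n = 0`. -/
structure Pred where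
  name : Name
  arity : ℕ

/-- Arithmetic operators: `+`, `-`, `×`, `÷` and `dist`. -/
inductive ArithOp where
  | add | sub | mul | div | dist

/-- Comparison predicates: `=`, `≠`, `<`, `>`, `≥`, `≤` and the always true `⊤`. -/
inductive CmpOp where
  | eq | ne | lt | gt | ge | le | top

/-- Aggregate functions. -/
inductive AggOp where
  | max | min | count | sum

/-- A position of the program that may be sketched: it holds either a known object or a sketched
variable, to be replaced by an object. One sketched variable may occur at several positions. -/
inductive Sk (α : Type) where
  | known (a : α)
  | sketched (s : Name)

/-- Variable-free terms. -/
inductive Term where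
  | const (c : Const)
  | op (o : Sk ArithOp) (l r : Term)

/-- Atoms `p(t₁,…,tₙ)` and sketched atoms `?q(t₁,…,tₙ)`. -/
structure Atom where
  pred : Sk Pred
  args : List Term

/-- Literals. The sign of an atom is `true` for the atom itself, `false` for `not` and a sketched
variable for `?not`. -/
inductive Lit where
  | atom (sign : Sk Bool) (a : Atom)
  | cmp (o : Sk CmpOp) (l r : Term)

/-- An element `t₁,…,tₙ : l₁,…,lₖ` of an aggregate. -/
structure AggElem where
  tuple : List Term
  cond : List Lit

/-- Members of a rule body: literals and aggregates `t = #agg{e₁;…;eₘ}`. -/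
inductive BodyElem where
  | lit (l : Lit)
  | agg (t : Term) (o : Sk AggOp) (elems : List AggElem)

/-- Rules. A rule without a head is an integrity constraint. -/
structure Rule where
  head : Option Atom
  body : List BodyElem

/-- Ground atoms over constants. -/
structure GAtom where
  pred : Pred
  args : List Const

/-- The declaration of a sketched variable: its domain, and for every value of the domain the
preference for choosing it. -/
structure Decl (α : Type) where
  name : Name
  dom : List (α × ℤ)

/-- `v` belongs to the domain of `d`. -/
def Decl.Mem {α : Type} (d : Decl α) (v : α) : Prop := ∃ z, (v, z) ∈ d.dom

/-- An instance: the sketched program, its sketched variables with domains and preferences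
(predicates, negations, inequalities, arithmetic operators and aggregate functions), and the
positive and negative examples. -/
structure Instance where
  rules : List Rule
  preds : List (Decl Pred)
  signs : List (Decl Bool)
  cmps : List (Decl CmpOp)
  ariths : List (Decl ArithOp)
  aggs : List (Decl AggOp)
  pos : List (List GAtom)
  neg : List (List GAtom)

/-! ### Well-formedness -/

/-- Every sketched variable is declared. -/
def Sk.Declared {α : Type} (ds : List (Decl α)) : Sk α → Prop
  | .known _ => True
  | .sketched s => ∃ d ∈ ds, d.name = s

/-- The objects that may end up at a position. -/
def Sk.CanBe {α : Type} (ds : List (Decl α)) : Sk α → α → Prop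
  | .known a, v => v = a
  | .sketched s, v => ∃ d ∈ ds, d.name = s ∧ d.Mem v

def Term.WF (I : Instance) : Term → Prop
  | .const _ => True
  | .op o l r => o.Declared I.ariths ∧ l.WF I ∧ r.WF I

/-- All predicates that an atom can refer to have as many arguments as it is given. -/
def Atom.WF (I : Instance) (a : Atom) : Prop :=
  a.pred.Declared I.preds ∧ (∀ p, a.pred.CanBe I.preds p → p.arity = a.args.length) ∧
    ∀ t ∈ a.args, t.WF I

def Lit.WF (I : Instance) : Lit → Prop
  | .atom s a => s.Declared I.signs ∧ a.WF I
  | .cmp o l r => o.Declared I.cmps ∧ l.WF I ∧ r.WF I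

def AggElem.WF (I : Instance) (e : AggElem) : Prop :=
  (∀ t ∈ e.tuple, t.WF I) ∧ ∀ l ∈ e.cond, l.WF I

def BodyElem.WF (I : Instance) : BodyElem → Prop
  | .lit l => l.WF I
  | .agg t o es => t.WF I ∧ o.Declared I.aggs ∧ ∀ e ∈ es, e.WF I

def Rule.WF (I : Instance) (r : Rule) : Prop :=
  (∀ a, r.head = some a → a.WF I) ∧ ∀ b ∈ r.body, b.WF I

/-- No sketched variable is declared twice, and no value is listed twice in a domain. -/
def DeclsWF {α : Type} (ds : List (Decl α)) : Prop :=
  (ds.map Decl.name).Nodup ∧ ∀ d ∈ ds, (d.dom.map Prod.fst).Nodup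

structure Instance.WF (I : Instance) : Prop where
  rules : ∀ r ∈ I.rules, r.WF I
  preds : DeclsWF I.preds
  arity : ∀ d ∈ I.preds, ∀ p q, d.Mem p → d.Mem q → p.arity = q.arity
  signs : DeclsWF I.signs
  cmps : DeclsWF I.cmps
  ariths : DeclsWF I.ariths
  aggs : DeclsWF I.aggs
  examples : ∀ e ∈ I.pos ++ I.neg, ∀ a ∈ e, a.pred.arity = a.args.length

/-! ### Stratification

Dependencies are between predicates and sketched predicates. A head `?q` can become any predicate
of the domain of `?q`, so that all of these depend on the body. An occurrence is negative if it is
below `not`, below a `?not` that can become `not`, or inside an aggregate. -/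

/-- `p` is the head of `r`, or can become the head of `r`. -/
def Rule.InHead (I : Instance) (r : Rule) (p : Sk Pred) : Prop :=
  ∃ a, r.head = some a ∧ (p = a.pred ∨ ∃ p', p = .known p' ∧ a.pred.CanBe I.preds p')

/-- `p` is the predicate of a literal. -/
def Lit.Mentions : Lit → Sk Pred → Prop
  | .atom _ a, p => p = a.pred
  | .cmp _ _ _, _ => False

def BodyElem.Mentions : BodyElem → Sk Pred → Prop
  | .lit l, p => l.Mentions p
  | .agg _ _ es, p => ∃ e ∈ es, ∃ l ∈ e.cond, l.Mentions p

/-- `p` occurs negatively. -/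
def BodyElem.MentionsNeg (I : Instance) : BodyElem → Sk Pred → Prop
  | .lit (.atom s a), p => p = a.pred ∧ s.CanBe I.signs false
  | .lit (.cmp _ _ _), _ => False
  | .agg _ _ es, p => ∃ e ∈ es, ∃ l ∈ e.cond, l.Mentions p

/-- Direct dependency, positive or negative. -/
def Instance.Dep (I : Instance) (p q : Sk Pred) : Prop :=
  (∃ r ∈ I.rules, r.InHead I p ∧ ∃ b ∈ r.body, b.Mentions q) ∨
    ∃ s q', p = .sketched s ∧ q = .known q' ∧ p.CanBe I.preds q'

/-- Direct negative dependency. -/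
def Instance.NegDep (I : Instance) (p q : Sk Pred) : Prop :=
  ∃ r ∈ I.rules, r.InHead I p ∧ ∃ b ∈ r.body, b.MentionsNeg I q

/-- No cycle of dependencies contains a negative one. -/
def Instance.Stratified (I : Instance) : Prop :=
  ∀ p q, I.NegDep p q → ¬ Relation.ReflTransGen I.Dep q p

/-! ### Substitutions -/

/-- A substitution gives a value to every sketched variable; only the values of the declared ones
matter. -/
structure Subst where
  pred : Name → Pred
  sign : Name → Bool
  cmp : Name → CmpOp
  arith : Name → ArithOp
  agg : Name → AggOp

/-- All declared variables take values in their domains. -/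
def InDom {α : Type} (ds : List (Decl α)) (f : Name → α) : Prop :=
  ∀ d ∈ ds, d.Mem (f d.name)

structure Subst.Valid (I : Instance) (θ : Subst) : Prop where
  pred : InDom I.preds θ.pred
  sign : InDom I.signs θ.sign
  cmp : InDom I.cmps θ.cmp
  arith : InDom I.ariths θ.arith
  agg : InDom I.aggs θ.agg

/-- The object at a position after the substitution. -/
def Sk.subst {α : Type} (f : Name → α) : Sk α → α
  | .known a => a
  | .sketched s => f s

/-- For every declared variable the choice of `f` is at least as preferred as that of `g`. -/
def PrefGE {α : Type} (ds : List (Decl α)) (f g : Name → α) : Prop :=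
  ∀ d ∈ ds, ∀ y z, (f d.name, y) ∈ d.dom → (g d.name, z) ∈ d.dom → z ≤ y

/-- For some declared variable the choice of `f` is strictly more preferred than that of `g`. -/
def PrefGT {α : Type} (ds : List (Decl α)) (f g : Name → α) : Prop :=
  ∃ d ∈ ds, ∃ y z, (f d.name, y) ∈ d.dom ∧ (g d.name, z) ∈ d.dom ∧ z < y

/-- `θ` is preferred over `η`. -/
def Instance.Preferred (I : Instance) (θ η : Subst) : Prop :=
  (PrefGE I.preds θ.pred η.pred ∧ PrefGE I.signs θ.sign η.sign ∧ PrefGE I.cmps θ.cmp η.cmp ∧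
    PrefGE I.ariths θ.arith η.arith ∧ PrefGE I.aggs θ.agg η.agg) ∧
  (PrefGT I.preds θ.pred η.pred ∨ PrefGT I.signs θ.sign η.sign ∨ PrefGT I.cmps θ.cmp η.cmp ∨
    PrefGT I.ariths θ.arith η.arith ∨ PrefGT I.aggs θ.agg η.agg)

/-! ### Evaluation and answer sets -/

/-- Integer arithmetic; division truncates and division by zero is undefined. -/
def ArithOp.eval : ArithOp → ℤ → ℤ → Option ℤ
  | .add, a, b => some (a + b)
  | .sub, a, b => some (a - b)
  | .mul, a, b => some (a * b)
  | .div, a, b => if b = 0 then none else some (a.tdiv b)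
  | .dist, a, b => some |a - b|

/-- The value of a term, if defined; arithmetic on symbolic constants is undefined. -/
def Term.eval (θ : Subst) : Term → Option Const
  | .const c => some c
  | .op o l r =>
    match l.eval θ, r.eval θ with
    | some (.int a), some (.int b) => ((o.subst θ.arith).eval a b).map .int
    | _, _ => none

/-- The order of constants: integers by value, then symbolic constants lexicographically. -/
def Const.Lt : Const → Const → Prop
  | .int a, .int b => a < b
  | .int _, .sym _ => True
  | .sym _, .int _ => False
  | .sym a, .sym b => a < b

def CmpOp.Holds : CmpOp → Const → Const → Prop
  | .eq, x, y => x = y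
  | .ne, x, y => x ≠ y
  | .lt, x, y => x.Lt y
  | .gt, x, y => y.Lt x
  | .ge, x, y => ¬ x.Lt y
  | .le, x, y => ¬ y.Lt x
  | .top, _, _ => True

/-- The ground atom that an atom stands for, if its arguments are defined. -/
def Atom.eval (θ : Subst) (a : Atom) : Option GAtom :=
  (a.args.mapM (Term.eval θ)).map (GAtom.mk (a.pred.subst θ.pred))

/-- Truth of a literal in the reduct: positive atoms are evaluated in `Y`, negative ones in `X`.
A literal with an undefined term is never true. Truth in an interpretation `X` is the case
`Y = X`. -/
def Lit.Holds (θ : Subst) (X Y : Set GAtom) : Lit → Prop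
  | .atom s a =>
    ∃ g, a.eval θ = some g ∧ if s.subst θ.sign = true then g ∈ Y else g ∉ X
  | .cmp o l r =>
    ∃ x y, l.eval θ = some x ∧ r.eval θ = some y ∧ (o.subst θ.cmp).Holds x y

/-- The set of tuples that an aggregate ranges over; it is finite. -/
def aggTuples (θ : Subst) (X : Set GAtom) (es : List AggElem) : Set (List Const) :=
  {t | ∃ e ∈ es, e.tuple.mapM (Term.eval θ) = some t ∧ ∀ l ∈ e.cond, l.Holds θ X X}

/-- The integer that a tuple contributes to a sum: its first component. -/
def weight : List Const → ℤ
  | .int z :: _ => z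
  | _ => 0

/-- The value of the aggregate function on the (finite) set `T` of tuples is `c`. Maxima, minima
and sums are those of the first components; the empty set has no maximum and no minimum among the
constants. -/
def AggOp.Holds (T : Set (List Const)) (c : Const) : AggOp → Prop
  | .count => c = .int T.ncard
  | .sum => c = .int (∑ᶠ t ∈ T, weight t)
  | .max => (∃ t, c :: t ∈ T) ∧ ∀ b t, b :: t ∈ T → ¬ c.Lt b
  | .min => (∃ t, c :: t ∈ T) ∧ ∀ b t, b :: t ∈ T → ¬ b.Lt c

/-- Truth of a body element in the reduct. Aggregates are evaluated in `X`, as negative literals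
are. -/
def BodyElem.Holds (θ : Subst) (X Y : Set GAtom) : BodyElem → Prop
  | .lit l => l.Holds θ X Y
  | .agg t o es => ∃ c, t.eval θ = some c ∧ (o.subst θ.agg).Holds (aggTuples θ X es) c

/-- `Y` is a model of the reduct with respect to `X` of the rules with a head, and of the facts
`e`. -/
def Instance.ReductModel (I : Instance) (θ : Subst) (e : List GAtom) (X Y : Set GAtom) : Prop :=
  (∀ g ∈ e, g ∈ Y) ∧
    ∀ r ∈ I.rules, ∀ a g, r.head = some a → a.eval θ = some g →
      (∀ b ∈ r.body, b.Holds θ X Y) → g ∈ Y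

/-- `X` is an answer set (stable model) of `Pθ ∪ e`: the least model of its reduct, violating no
integrity constraint. -/
def Instance.AnswerSet (I : Instance) (θ : Subst) (e : List GAtom) (X : Set GAtom) : Prop :=
  I.ReductModel θ e X X ∧ (∀ Y, I.ReductModel θ e X Y → X ⊆ Y) ∧
    ∀ r ∈ I.rules, r.head = none → ¬ ∀ b ∈ r.body, b.Holds θ X X

/-! ### The decision problem -/

/-- `θ` maps the sketched variables to their domains, `Pθ ∪ e` has an answer set for all positive
examples `e` and for no negative example `e`. -/
def Instance.Satisfying (I : Instance) (θ : Subst) : Prop :=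
  θ.Valid I ∧ (∀ e ∈ I.pos, ∃ X, I.AnswerSet θ e X) ∧ ∀ e ∈ I.neg, ¬ ∃ X, I.AnswerSet θ e X

/-- A solution: a satisfying substitution such that no satisfying one is preferred over it. -/
def Instance.Solution (I : Instance) (θ : Subst) : Prop :=
  I.Satisfying θ ∧ ∀ η, I.Satisfying η → ¬ I.Preferred η θ

/-! ### Instances as words

Names and binary numbers are words of bits closed by a comma, lists are sequences of entries
opened by `bra` and closed by `ket`, and constructors are told apart by leading bits. -/

open Computability (Γ')

def encWord (w : List Bool) : List Γ' := w.map Γ'.bit ++ [Γ'.comma]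

def encNat (n : ℕ) : List Γ' := encWord (Computability.encodeNat n)

def encInt (z : ℤ) : List Γ' := encWord (decide (z < 0) :: Computability.encodeNat z.natAbs)

def encList {α : Type} (f : α → List Γ') (l : List α) : List Γ' :=
  l.flatMap (fun x => Γ'.bra :: f x) ++ [Γ'.ket]

def encBool (b : Bool) : List Γ' := [.bit b]

def encArith : ArithOp → List Γ'
  | .add => encNat 0
  | .sub => encNat 1
  | .mul => encNat 2
  | .div => encNat 3
  | .dist => encNat 4

def encCmp : CmpOp → List Γ'
  | .eq => encNat 0
  | .ne => encNat 1
  | .lt => encNat 2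
  | .gt => encNat 3
  | .ge => encNat 4
  | .le => encNat 5
  | .top => encNat 6

def encAgg : AggOp → List Γ'
  | .max => encNat 0
  | .min => encNat 1
  | .count => encNat 2
  | .sum => encNat 3

def encSk {α : Type} (f : α → List Γ') : Sk α → List Γ'
  | .known a => .bit false :: f a
  | .sketched s => .bit true :: encWord s

def encConst : Const → List Γ'
  | .int z => .bit false :: encInt z
  | .sym c => .bit true :: encWord c

def encPred (p : Pred) : List Γ' := encWord p.name ++ encNat p.arity

def encTerm : Term → List Γ'
  | .const c => .bit false :: encConst c
  | .op o l r => .bit true :: (encSk encArith o ++ (encTerm l ++ encTerm r))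

def encAtom (a : Atom) : List Γ' := encSk encPred a.pred ++ encList encTerm a.args

def encLit : Lit → List Γ'
  | .atom s a => .bit false :: (encSk encBool s ++ encAtom a)
  | .cmp o l r => .bit true :: (encSk encCmp o ++ (encTerm l ++ encTerm r))

def encAggElem (e : AggElem) : List Γ' := encList encTerm e.tuple ++ encList encLit e.cond

def encBodyElem : BodyElem → List Γ'
  | .lit l => .bit false :: encLit l
  | .agg t o es => .bit true :: (encTerm t ++ (encSk encAgg o ++ encList encAggElem es))

def encHead : Option Atom → List Γ'
  | none => [.bit false]
  | some a => .bit true :: encAtom a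

def encRule (r : Rule) : List Γ' := encHead r.head ++ encList encBodyElem r.body

def encGAtom (g : GAtom) : List Γ' := encPred g.pred ++ encList encConst g.args

def encEntry {α : Type} (f : α → List Γ') (x : α × ℤ) : List Γ' := f x.1 ++ encInt x.2

def encDecl {α : Type} (f : α → List Γ') (d : Decl α) : List Γ' :=
  encWord d.name ++ encList (encEntry f) d.dom

/-- The word that represents an instance. -/
def encode (I : Instance) : List Γ' :=
  encList encRule I.rules ++ (encList (encDecl encPred) I.preds ++
    (encList (encDecl encBool) I.signs ++ (encList (encDecl encCmp) I.cmps ++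
      (encList (encDecl encArith) I.ariths ++ (encList (encDecl encAgg) I.aggs ++
        (encList (encList encGAtom) I.pos ++ encList (encList encGAtom) I.neg))))))

/-- The decision version of propositional SkASP: the words that represent a well-formed stratified
instance that has a solution. -/
def decisionProblem : Language Γ' :=
  {w | ∃ I : Instance, I.WF ∧ I.Stratified ∧ (∃ θ, I.Solution θ) ∧ w = encode I}

/-! ### The representation is unambiguous -/

/-- An object can be read off from the beginning of a word. -/
def Readable {α : Type} (f : α → List Γ') : Prop :=
  ∀ a b u v, f a ++ u = f b ++ v → a = b ∧ u = v

theorem readable_word : Readable encWord := by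
  intro a
  induction a with
  | nil => intro b u v h; cases b <;> simp_all [encWord]
  | cons x a ih =>
    intro b u v h
    cases b with
    | nil => simp [encWord] at h
    | cons y b =>
      simp only [encWord, List.map_cons, List.cons_append, List.cons.injEq, Γ'.bit.injEq] at h
      obtain ⟨h1, h2⟩ := ih b u v h.2
      exact ⟨by rw [h.1, h1], h2⟩

theorem readable_nat : Readable encNat := by
  intro a b u v h
  obtain ⟨h1, h2⟩ := readable_word _ _ _ _ h
  exact ⟨by simpa using congrArg Computability.decodeNat h1, h2⟩

theorem readable_int : Readable encInt := by
  intro a b u v h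
  obtain ⟨h1, h2⟩ := readable_word _ _ _ _ h
  simp only [List.cons.injEq, decide_eq_decide] at h1
  have h3 : a.natAbs = b.natAbs := by simpa using congrArg Computability.decodeNat h1.2
  exact ⟨by have := h1.1; omega, h2⟩

theorem readable_list {α : Type} {f : α → List Γ'} (hf : Readable f) : Readable (encList f) := by
  intro a
  induction a with
  | nil => intro b u v h; cases b <;> simp_all [encList]
  | cons x a ih =>
    intro b u v h
    cases b with
    | nil => simp [encList] at h
    | cons y b =>
      simp only [encList, List.flatMap_cons, List.cons_append, List.append_assoc,
        List.cons.injEq, true_and] at h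
      obtain ⟨h1, h2⟩ := hf _ _ _ _ h
      obtain ⟨h3, h4⟩ := ih b u v (by simpa [encList] using h2)
      exact ⟨by rw [h1, h3], h4⟩

theorem readable_bool : Readable encBool := by
  intro a b u v h
  simpa [encBool] using h

theorem readable_arith : Readable encArith := by
  intro a b u v h
  cases a <;> cases b <;> simpa using readable_nat _ _ _ _ h

theorem readable_cmp : Readable encCmp := by
  intro a b u v h
  cases a <;> cases b <;> simpa using readable_nat _ _ _ _ h

theorem readable_agg : Readable encAgg := by
  intro a b u v h
  cases a <;> cases b <;> simpa using readable_nat _ _ _ _ h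

theorem readable_sk {α : Type} {f : α → List Γ'} (hf : Readable f) : Readable (encSk f) := by
  intro a b u v h
  cases a <;> cases b <;> simp [encSk] at h
  · simpa using hf _ _ _ _ h
  · simpa using readable_word _ _ _ _ h

theorem readable_const : Readable encConst := by
  intro a b u v h
  cases a <;> cases b <;> simp [encConst] at h
  · simpa using readable_int _ _ _ _ h
  · simpa using readable_word _ _ _ _ h

theorem readable_pred : Readable encPred := by
  rintro ⟨a, m⟩ ⟨b, n⟩ u v h
  simp only [encPred, List.append_assoc] at h
  replace h := readable_word _ _ _ _ h
  obtain ⟨rfl, h⟩ := h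
  replace h := readable_nat _ _ _ _ h
  obtain ⟨rfl, h⟩ := h
  exact ⟨rfl, h⟩

theorem readable_term : Readable encTerm := by
  intro a
  induction a with
  | const c =>
    intro b u v h
    cases b <;> simp [encTerm] at h
    simpa using readable_const _ _ _ _ h
  | op o l r ihl ihr =>
    intro b u v h
    cases b <;> simp [encTerm] at h
    replace h := readable_sk readable_arith _ _ _ _ h
    obtain ⟨rfl, h⟩ := h
    replace h := ihl _ _ _ h
    obtain ⟨rfl, h⟩ := h
    replace h := ihr _ _ _ h
    obtain ⟨rfl, h⟩ := h
    exact ⟨rfl, h⟩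

theorem readable_atom : Readable encAtom := by
  rintro ⟨p, s⟩ ⟨q, t⟩ u v h
  simp only [encAtom, List.append_assoc] at h
  replace h := readable_sk readable_pred _ _ _ _ h
  obtain ⟨rfl, h⟩ := h
  replace h := readable_list readable_term _ _ _ _ h
  obtain ⟨rfl, h⟩ := h
  exact ⟨rfl, h⟩

theorem readable_lit : Readable encLit := by
  intro a b u v h
  cases a <;> cases b <;> simp [encLit] at h
  · replace h := readable_sk readable_bool _ _ _ _ h
    obtain ⟨rfl, h⟩ := h
    replace h := readable_atom _ _ _ _ h
    obtain ⟨rfl, h⟩ := h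
    exact ⟨rfl, h⟩
  · replace h := readable_sk readable_cmp _ _ _ _ h
    obtain ⟨rfl, h⟩ := h
    replace h := readable_term _ _ _ _ h
    obtain ⟨rfl, h⟩ := h
    replace h := readable_term _ _ _ _ h
    obtain ⟨rfl, h⟩ := h
    exact ⟨rfl, h⟩

theorem readable_aggElem : Readable encAggElem := by
  rintro ⟨p, s⟩ ⟨q, t⟩ u v h
  simp only [encAggElem, List.append_assoc] at h
  replace h := readable_list readable_term _ _ _ _ h
  obtain ⟨rfl, h⟩ := h
  replace h := readable_list readable_lit _ _ _ _ h
  obtain ⟨rfl, h⟩ := h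
  exact ⟨rfl, h⟩

theorem readable_bodyElem : Readable encBodyElem := by
  intro a b u v h
  cases a <;> cases b <;> simp [encBodyElem] at h
  · simpa using readable_lit _ _ _ _ h
  · replace h := readable_term _ _ _ _ h
    obtain ⟨rfl, h⟩ := h
    replace h := readable_sk readable_agg _ _ _ _ h
    obtain ⟨rfl, h⟩ := h
    replace h := readable_list readable_aggElem _ _ _ _ h
    obtain ⟨rfl, h⟩ := h
    exact ⟨rfl, h⟩

theorem readable_head : Readable encHead := by
  intro a b u v h
  cases a <;> cases b <;> simp [encHead] at h
  · exact ⟨rfl, h⟩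
  · simpa using readable_atom _ _ _ _ h

theorem readable_rule : Readable encRule := by
  rintro ⟨p, s⟩ ⟨q, t⟩ u v h
  simp only [encRule, List.append_assoc] at h
  replace h := readable_head _ _ _ _ h
  obtain ⟨rfl, h⟩ := h
  replace h := readable_list readable_bodyElem _ _ _ _ h
  obtain ⟨rfl, h⟩ := h
  exact ⟨rfl, h⟩

theorem readable_gAtom : Readable encGAtom := by
  rintro ⟨p, s⟩ ⟨q, t⟩ u v h
  simp only [encGAtom, List.append_assoc] at h
  replace h := readable_pred _ _ _ _ h
  obtain ⟨rfl, h⟩ := h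
  replace h := readable_list readable_const _ _ _ _ h
  obtain ⟨rfl, h⟩ := h
  exact ⟨rfl, h⟩

theorem readable_entry {α : Type} {f : α → List Γ'} (hf : Readable f) :
    Readable (encEntry f) := by
  rintro ⟨p, s⟩ ⟨q, t⟩ u v h
  simp only [encEntry, List.append_assoc] at h
  replace h := hf _ _ _ _ h
  obtain ⟨rfl, h⟩ := h
  replace h := readable_int _ _ _ _ h
  obtain ⟨rfl, h⟩ := h
  exact ⟨rfl, h⟩

theorem readable_decl {α : Type} {f : α → List Γ'} (hf : Readable f) : Readable (encDecl f) := by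
  rintro ⟨p, s⟩ ⟨q, t⟩ u v h
  simp only [encDecl, List.append_assoc] at h
  replace h := readable_word _ _ _ _ h
  obtain ⟨rfl, h⟩ := h
  replace h := readable_list (readable_entry hf) _ _ _ _ h
  obtain ⟨rfl, h⟩ := h
  exact ⟨rfl, h⟩

/-- Different instances are represented by different words. -/
theorem encode_injective : Function.Injective encode := by
  rintro ⟨a1, a2, a3, a4, a5, a6, a7, a8⟩ ⟨b1, b2, b3, b4, b5, b6, b7, b8⟩ h
  simp only [encode] at h
  replace h := readable_list readable_rule _ _ _ _ h
  obtain ⟨rfl, h⟩ := h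
  replace h := readable_list (readable_decl readable_pred) _ _ _ _ h
  obtain ⟨rfl, h⟩ := h
  replace h := readable_list (readable_decl readable_bool) _ _ _ _ h
  obtain ⟨rfl, h⟩ := h
  replace h := readable_list (readable_decl readable_cmp) _ _ _ _ h
  obtain ⟨rfl, h⟩ := h
  replace h := readable_list (readable_decl readable_arith) _ _ _ _ h
  obtain ⟨rfl, h⟩ := h
  replace h := readable_list (readable_decl readable_agg) _ _ _ _ h
  obtain ⟨rfl, h⟩ := h
  replace h := readable_list (readable_list readable_gAtom) _ _ _ _ h
  obtain ⟨rfl, h⟩ := h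
  obtain ⟨rfl, -⟩ := readable_list (readable_list readable_gAtom) _ _ [] []
    (by simpa using h)
  rfl

end SkASP

/-! ### Structured programs over stacks -/

namespace StackProg

open Turing Function

/-! On its face the problem asks for a substitution that is optimal among all satisfying ones, and
for the absence of answer sets. Two observations bring it down to NP.

Optimality costs nothing. A preferred substitution has a strictly larger sum of preferences
(`Instance.Preferred.total_lt`), and these sums are bounded (`total_le`). So a satisfying
substitution with the greatest sum is a solution, and it only matters whether a satisfying one
exists (`Instance.exists_solution_iff`).

The absence of an answer set has a short witness. Stratification gives a ranking of the predicates
that does not increase along dependencies and decreases along negative ones. The atoms of each rank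
are then determined as a least fixed point over those of lower rank, so that the rules with a head
have exactly one stable model for each valid substitution and each example
(`Instance.Ranked.existsUnique_stable`, from `Local.exists` and `Local.unique`). An answer set
exists iff this model satisfies the integrity constraints. For a negative example it suffices to
exhibit the model and see that it violates one.

A certificate therefore consists of the instance, the values of its sketched variables, the ranks,
and the stable models as lists in which every atom is derived from later ones. Ranks spare a search
for cycles, and the order of a list proves that it is least. `exists_cert` bounds the size: values
occur in the instance, ranks do not exceed the number of nodes, and models are duplicate-free lists
of facts and heads of rules. `Check.mem` is soundness.

It remains to show that the check runs in polynomial time on a machine. All data are binary trees in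
prefix notation on a stack. `PT` collects the functions on trees that structured stack programs
compute in polynomial time; it is closed under composition, branching, folds, and loops whose
intermediate trees stay small. `Code` and `PolyTime` transfer this to other types, so that
`polyPred_check` follows the structure of the definitions. `Prog.Exec.steps` and `PolyTime.tm2`
translate programs to Turing machines. -/

/-- Structured programs over a family of stacks. `loop k f last` pops a symbol `h` from stack `k`,
runs `f h`, and repeats unless `last h` holds. -/
inductive Prog {K : Type} (Γ : K → Type) : Type
  | skip
  | push (k : K) (x : Γ k)
  | seq (p q : Prog Γ)
  | loop (k : K) (f : Option (Γ k) → Prog Γ) (last : Option (Γ k) → Bool)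

namespace Prog

variable {K : Type} {Γ : K → Type}

/-- The control points of a program. -/
inductive Lab : Prog Γ → Type
  | skip : Lab skip
  | push (k x) : Lab (push k x)
  | fst {p} (q) : Lab p → Lab (seq p q)
  | snd (p) {q} : Lab q → Lab (seq p q)
  | head (k f last) : Lab (loop k f last)
  | body {k f} (last h) : Lab (f h) → Lab (loop k f last)

/-- A loop contains one copy of its body for each symbol that can be popped, so finite alphabets are
needed. -/
instance finite_lab [∀ k, Finite (Γ k)] (p : Prog Γ) : Finite (Lab p) := by
  induction p with
  | skip => exact .of_surjective (fun _ : Unit => Lab.skip) fun | .skip => ⟨(), rfl⟩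
  | push k x => exact .of_surjective (fun _ : Unit => Lab.push k x) fun | .push _ _ => ⟨(), rfl⟩
  | seq p q _ _ =>
    exact .of_surjective (Sum.elim (Lab.fst q) (Lab.snd p))
      fun | .fst _ l => ⟨.inl l, rfl⟩ | .snd _ l => ⟨.inr l, rfl⟩
  | loop k f last _ =>
    exact .of_surjective (fun x : Option (Σ h, Lab (f h)) =>
      x.elim (Lab.head k f last) fun y => Lab.body last y.1 y.2)
      fun | .head _ _ _ => ⟨none, rfl⟩ | .body _ h l => ⟨some ⟨h, l⟩, rfl⟩

/-- Where a program starts. -/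
def entry : ∀ p : Prog Γ, Lab p
  | skip => .skip
  | push _ _ => .push _ _
  | seq p _ => .fst _ (entry p)
  | loop _ _ _ => .head _ _ _

variable [DecidableEq K]

/-- The machine code of a program inside a machine with labels `Λ`, leaving to `exit`. The memory
holds the symbols popped last. -/
def code {Λ : Type} : ∀ (p : Prog Γ) (_emb : Lab p → Λ) (_exit : Λ),
    Lab p → TM2.Stmt Γ Λ (∀ k, Option (Γ k))
  | skip, _, exit, _ => .goto fun _ => exit
  | push k x, _, exit, _ => .push k (fun _ => x) (.goto fun _ => exit)
  | seq p q, emb, _, .fst _ l => code p (fun l => emb (.fst q l)) (emb (.snd _ (entry q))) l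
  | seq p q, emb, exit, .snd _ l => code q (fun l => emb (.snd p l)) exit l
  | loop k f last, emb, _, .head _ _ _ =>
    .pop k (fun v h => update v k h) (.goto fun v => emb (.body last (v k) (entry (f (v k)))))
  | loop k f last, emb, exit, .body _ h l =>
    code (f h) (fun l => emb (.body last h l)) (if last h then exit else emb (.head k f last)) l

/-- `Exec p S S' n`: started on the stacks `S`, the program `p` ends after `n` steps with the
stacks `S'`. -/
inductive Exec : Prog Γ → (∀ k, List (Γ k)) → (∀ k, List (Γ k)) → ℕ → Prop
  | skip (S) : Exec skip S S 1
  | push (k x S) : Exec (push k x) S (update S k (x :: S k)) 1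
  | seq {p q S S' S'' m n} : Exec p S S' m → Exec q S' S'' n → Exec (seq p q) S S'' (m + n)
  | last {k f last S S' n} : last (S k).head? = true →
      Exec (f (S k).head?) (update S k (S k).tail) S' n → Exec (loop k f last) S S' (n + 1)
  | cont {k f last S S' S'' m n} : last (S k).head? = false →
      Exec (f (S k).head?) (update S k (S k).tail) S' m → Exec (loop k f last) S' S'' n →
      Exec (loop k f last) S S'' (m + n + 1)

/-- `n` steps lead from `c` to `c'`. -/
def Steps {Λ σ : Type} (M : Λ → TM2.Stmt Γ Λ σ) (n : ℕ) (c c' : TM2.Cfg Γ Λ σ) : Prop :=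
  (flip bind (TM2.step M))^[n] (some c) = some c'

theorem Steps.trans {Λ σ : Type} {M : Λ → TM2.Stmt Γ Λ σ} {m n : ℕ} {a b c : TM2.Cfg Γ Λ σ}
    (h₁ : Steps M m a b) (h₂ : Steps M n b c) : Steps M (m + n) a c := by
  unfold Steps at *
  rw [add_comm, iterate_add_apply, h₁, h₂]

/-- The program may sit anywhere inside a larger machine, since the induction treats subprograms
whose exits are control points of the surrounding program. The final memory is left open: a pop
overwrites the entry that the following jump reads, and afterwards the popped symbol is remembered
by the control point. -/
theorem Exec.steps {p : Prog Γ} {S S' : ∀ k, List (Γ k)} {n : ℕ} (h : Exec p S S' n) :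
    ∀ {Λ : Type} (M : Λ → TM2.Stmt Γ Λ (∀ k, Option (Γ k))) (emb : Lab p → Λ) (exit : Λ)
      (_ : ∀ l, M (emb l) = code p emb exit l) (v : ∀ k, Option (Γ k)),
      ∃ v', Steps M n ⟨some (emb (entry p)), v, S⟩ ⟨some exit, v', S'⟩ := by
  induction h with
  | skip S =>
    intro Λ M emb exit hM v
    exact ⟨v, by simp [Steps, flip, TM2.step, hM, code, entry]⟩
  | push k x S =>
    intro Λ M emb exit hM v
    exact ⟨v, by simp [Steps, flip, TM2.step, hM, code, entry]⟩
  | @seq p q S S' S'' m n _ _ ih₁ ih₂ =>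
    intro Λ M emb exit hM v
    obtain ⟨v', h₁⟩ := ih₁ M (fun l => emb (.fst q l)) (emb (.snd p (entry q)))
      (fun l => by rw [hM, code]) v
    obtain ⟨v'', h₂⟩ := ih₂ M (fun l => emb (.snd p l)) exit (fun l => by rw [hM, code]) v'
    exact ⟨v'', h₁.trans h₂⟩
  | @last k f last S S' n hs _ ih =>
    intro Λ M emb exit hM v
    obtain ⟨v', h₁⟩ := ih M (fun l => emb (.body last (S k).head? l)) exit
      (fun l => by rw [hM, code, hs, if_pos rfl]) (update v k (S k).head?)
    refine ⟨v', ?_⟩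
    -- Popping and jumping into the body are one machine step, which is put in front.
    rw [add_comm]
    refine Steps.trans ?_ h₁
    simp [Steps, flip, entry, TM2.step, hM, code]
    rw [update_self]
  | @cont k f last S S' S'' m n hs _ _ ih₁ ih₂ =>
    intro Λ M emb exit hM v
    obtain ⟨v', h₁⟩ := ih₁ M (fun l => emb (.body last (S k).head? l)) (emb (.head k f last))
      (fun l => by rw [hM, code, hs]; rfl) (update v k (S k).head?)
    obtain ⟨v'', h₂⟩ := ih₂ M emb exit hM v'
    refine ⟨v'', ?_⟩
    rw [add_comm]
    refine Steps.trans ?_ (h₁.trans h₂)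
    simp [Steps, flip, entry, TM2.step, hM, code]
    rw [update_self]

end Prog

end StackProg

/-! ### Binary trees on stacks -/

namespace StackProg

open Function

/-- Binary trees. -/
inductive BinTree
  | leaf
  | node (l r : BinTree)
  deriving DecidableEq

/-- Work symbols: the nodes of trees in prefix order, and a marker. -/
inductive Sym
  | leaf | node | mark
  deriving DecidableEq

instance : Fintype Sym := ⟨{.leaf, .node, .mark}, fun x => by cases x <;> simp⟩

/-- The stacks: input, output and four work stacks. -/
inductive Stack
  | inp | out | m | a | b | c
  deriving DecidableEq

instance : Fintype Stack := ⟨{.inp, .out, .m, .a, .b, .c}, fun x => by cases x <;> simp⟩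

/-- The alphabets of the stacks. -/
abbrev Alph (A : Type) : Stack → Type
  | .inp => A
  | .out => Bool
  | .m => Sym
  | .a => Sym
  | .b => Sym
  | .c => Sym

/-- Prefix notation of trees. -/
def BinTree.ser : BinTree → List Sym
  | .leaf => [.leaf]
  | .node l r => .node :: (l.ser ++ r.ser)

/-- The length of the prefix notation. -/
def BinTree.size : BinTree → ℕ
  | .leaf => 1
  | .node l r => l.size + r.size + 1

theorem BinTree.length_ser (t : BinTree) : t.ser.length = t.size := by
  induction t with
  | leaf => rfl
  | node l r hl hr => simp [ser, size, hl, hr]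

theorem BinTree.size_pos (t : BinTree) : 0 < t.size := by cases t <;> simp [size]

theorem BinTree.mark_notMem_ser (t : BinTree) : Sym.mark ∉ t.ser := by
  induction t with
  | leaf => simp [ser]
  | node l r hl hr => simp [ser, hl, hr]

variable {A : Type}

/-- A configuration of the stacks. -/
def st (i : List A) (o : List Bool) (m a b c : List Sym) : ∀ k, List (Alph A k)
  | .inp => i
  | .out => o
  | .m => m
  | .a => a
  | .b => b
  | .c => c

section update

variable (i : List A) (o : List Bool) (m a b c : List Sym)

theorem st_update_inp (x) : update (st i o m a b c) .inp x = st x o m a b c := by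
  funext k; cases k <;> simp [st, update]

theorem st_update_out (x) : update (st i o m a b c) .out x = st i x m a b c := by
  funext k; cases k <;> simp [st, update]

theorem st_update_m (x) : update (st i o m a b c) .m x = st i o x a b c := by
  funext k; cases k <;> simp [st, update]

theorem st_update_a (x) : update (st i o m a b c) .a x = st i o m x b c := by
  funext k; cases k <;> simp [st, update]

theorem st_update_b (x) : update (st i o m a b c) .b x = st i o m a x c := by
  funext k; cases k <;> simp [st, update]

theorem st_update_c (x) : update (st i o m a b c) .c x = st i o m a b x := by
  funext k; cases k <;> simp [st, update]

end update

/-! ### Time bounds for programs; moving, copying and exchanging trees -/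

namespace Prog

/-- `p` leads from the stacks `S` to the stacks `S'` in at most `n` steps. -/
def Runs (p : Prog (Alph A)) (S S' : ∀ k, List (Alph A k)) (n : ℕ) : Prop := ∃ k ≤ n, Exec p S S' k

variable {p q : Prog (Alph A)} {S S' S'' : ∀ k, List (Alph A k)} {n n' : ℕ}

theorem Runs.mono (h : Runs p S S' n) (hn : n ≤ n') : Runs p S S' n' :=
  let ⟨k, hk, h⟩ := h; ⟨k, hk.trans hn, h⟩

theorem Runs.skip : Runs (A := A) skip S S 1 := ⟨1, le_rfl, .skip S⟩

theorem Runs.seq (h : Runs p S S' n) (h' : Runs q S' S'' n') :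
    Runs (seq p q) S S'' (n + n') :=
  let ⟨_, hk, h⟩ := h; let ⟨_, hk', h'⟩ := h'; ⟨_, add_le_add hk hk', .seq h h'⟩

variable {i : List A} {o : List Bool} {m a b c : List Sym} {x : Sym}

theorem Runs.push_out {x} : Runs (A := A) (.push .out x) (st i o m a b c) (st i (x :: o) m a b c) 1 :=
  ⟨1, le_rfl, by have h := Exec.push .out x (st i o m a b c); rwa [st_update_out] at h⟩

theorem Runs.push_m : Runs (A := A) (.push .m x) (st i o m a b c) (st i o (x :: m) a b c) 1 :=
  ⟨1, le_rfl, by have h := Exec.push .m x (st i o m a b c); rwa [st_update_m] at h⟩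

theorem Runs.push_a : Runs (A := A) (.push .a x) (st i o m a b c) (st i o m (x :: a) b c) 1 :=
  ⟨1, le_rfl, by have h := Exec.push .a x (st i o m a b c); rwa [st_update_a] at h⟩

theorem Runs.push_b : Runs (A := A) (.push .b x) (st i o m a b c) (st i o m a (x :: b) c) 1 :=
  ⟨1, le_rfl, by have h := Exec.push .b x (st i o m a b c); rwa [st_update_b] at h⟩

theorem Runs.push_c : Runs (A := A) (.push .c x) (st i o m a b c) (st i o m a b (x :: c)) 1 :=
  ⟨1, le_rfl, by have h := Exec.push .c x (st i o m a b c); rwa [st_update_c] at h⟩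

theorem Runs.last {k : Stack} {f : Option (Alph A k) → Prog (Alph A)} {s} {h}
    (hh : (S k).head? = h) (hs : s h = true)
    (hf : Runs (f h) (update S k (S k).tail) S' n) : Runs (loop k f s) S S' (n + 1) := by
  subst hh
  let ⟨_, hk, e⟩ := hf
  exact ⟨_, Nat.succ_le_succ hk, .last hs e⟩

theorem Runs.cont {k : Stack} {f : Option (Alph A k) → Prog (Alph A)} {s} {h}
    (hh : (S k).head? = h) (hs : s h = false)
    (hf : Runs (f h) (update S k (S k).tail) S' n) (hl : Runs (loop k f s) S' S'' n') :
    Runs (loop k f s) S S'' (n + n' + 1) := by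
  subst hh
  let ⟨_, hk, e⟩ := hf
  let ⟨_, hk', e'⟩ := hl
  exact ⟨_, by omega, .cont hs e e'⟩

theorem Runs.last_m {f : Option Sym → Prog (Alph A)} {s} (hs : s (some x) = true)
    (hf : Runs (f (some x)) (st i o m a b c) S' n) :
    Runs (loop .m f s) (st i o (x :: m) a b c) S' (n + 1) :=
  Runs.last (h := some x) rfl hs (by rw [st_update_m]; exact hf)

theorem Runs.last_a {f : Option Sym → Prog (Alph A)} {s} (hs : s (some x) = true)
    (hf : Runs (f (some x)) (st i o m a b c) S' n) :
    Runs (loop .a f s) (st i o m (x :: a) b c) S' (n + 1) :=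
  Runs.last (h := some x) rfl hs (by rw [st_update_a]; exact hf)

theorem Runs.last_b {f : Option Sym → Prog (Alph A)} {s} (hs : s (some x) = true)
    (hf : Runs (f (some x)) (st i o m a b c) S' n) :
    Runs (loop .b f s) (st i o m a (x :: b) c) S' (n + 1) :=
  Runs.last (h := some x) rfl hs (by rw [st_update_b]; exact hf)

theorem Runs.last_c {f : Option Sym → Prog (Alph A)} {s} (hs : s (some x) = true)
    (hf : Runs (f (some x)) (st i o m a b c) S' n) :
    Runs (loop .c f s) (st i o m a b (x :: c)) S' (n + 1) :=
  Runs.last (h := some x) rfl hs (by rw [st_update_c]; exact hf)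

theorem Runs.cont_m {f : Option Sym → Prog (Alph A)} {s} (hs : s (some x) = false)
    (hf : Runs (f (some x)) (st i o m a b c) S' n) (hl : Runs (loop .m f s) S' S'' n') :
    Runs (loop .m f s) (st i o (x :: m) a b c) S'' (n + n' + 1) :=
  Runs.cont (h := some x) rfl hs (by rw [st_update_m]; exact hf) hl

theorem Runs.cont_a {f : Option Sym → Prog (Alph A)} {s} (hs : s (some x) = false)
    (hf : Runs (f (some x)) (st i o m a b c) S' n) (hl : Runs (loop .a f s) S' S'' n') :
    Runs (loop .a f s) (st i o m (x :: a) b c) S'' (n + n' + 1) :=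
  Runs.cont (h := some x) rfl hs (by rw [st_update_a]; exact hf) hl

theorem Runs.cont_b {f : Option Sym → Prog (Alph A)} {s} (hs : s (some x) = false)
    (hf : Runs (f (some x)) (st i o m a b c) S' n) (hl : Runs (loop .b f s) S' S'' n') :
    Runs (loop .b f s) (st i o m a (x :: b) c) S'' (n + n' + 1) :=
  Runs.cont (h := some x) rfl hs (by rw [st_update_b]; exact hf) hl

theorem Runs.cont_c {f : Option Sym → Prog (Alph A)} {s} (hs : s (some x) = false)
    (hf : Runs (f (some x)) (st i o m a b c) S' n) (hl : Runs (loop .c f s) S' S'' n') :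
    Runs (loop .c f s) (st i o m a b (x :: c)) S'' (n + n' + 1) :=
  Runs.cont (h := some x) rfl hs (by rw [st_update_c]; exact hf) hl

/-- Pops a symbol and branches. -/
def case (k : Stack) (f : Option (Alph A k) → Prog (Alph A)) : Prog (Alph A) :=
  loop k f fun _ => true

/-- Pushes onto the first or second auxiliary stack. -/
def pushAux (x : Bool) (s : Sym) : Prog (Alph A) := cond x (push .a s) (push .b s)

theorem Runs.pushAux (x : Bool) (s : Sym) : Runs (A := A) (pushAux x s) (st i o m a b c)
    (st i o m (cond x (s :: a) a) (cond x b (s :: b)) c) 1 := by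
  cases x
  · exact .push_b
  · exact .push_a

/-- Moves trees from the main stack to an auxiliary one; their number is kept on stack `c`. -/
def moveLoop (x : Bool) : Prog (Alph A) :=
  loop .c (fun h => match h with
    | some .leaf => case .m fun s => match s with
      | some .node => seq (pushAux x .node) (seq (push .c .leaf) (push .c .leaf))
      | _ => pushAux x .leaf
    | _ => skip) fun h => h ≠ some .leaf

/-- Stack `c` holds a leaf for each tree still to be moved: a leaf symbol uses up one of them, a
node symbol replaces it by two for the subtrees. The rest of the run is a hypothesis, which lets the
induction chain the subtrees. Each symbol costs at most five steps. -/
theorem Runs.moveLoop (x : Bool) (t : BinTree) : ∀ {m a b c S' n},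
    Runs (moveLoop x) (st i o m (cond x (t.ser.reverse ++ a) a) (cond x b (t.ser.reverse ++ b)) c)
      S' n →
    Runs (A := A) (Prog.moveLoop x) (st i o (t.ser ++ m) a b (.leaf :: c)) S' (n + 5 * t.size) := by
  induction t with
  | leaf =>
    intro m a b c S' n h
    refine Runs.mono (.cont_c (n' := n) rfl (.last_m rfl (.pushAux x .leaf)) ?_) ?_
    · cases x <;> exact h
    · simp [BinTree.size]; omega
  | node l r hl hr =>
    intro m a b c S' n h
    refine Runs.mono (.cont_c rfl (.last_m rfl ((Runs.pushAux x .node).seq (.seq .push_c .push_c)))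
      (n' := n + 5 * r.size + 5 * l.size) ?_) ?_
    · have := hl (m := r.ser ++ m) (a := cond x (.node :: a) a) (b := cond x b (.node :: b))
        (c := .leaf :: c) (S' := S') (n := n + 5 * r.size)
      simp only [List.append_eq, List.append_assoc]
      refine this (hr ?_)
      cases x
      · simpa [BinTree.ser] using h
      · simpa [BinTree.ser] using h
    · simp [BinTree.size]; omega

/-- Moves a tree from the main stack to an auxiliary one, above a marker. -/
def move (x : Bool) : Prog (Alph A) :=
  seq (pushAux x .mark) (seq (push .c .mark) (seq (push .c .leaf) (moveLoop x)))

theorem Runs.move (x : Bool) (t : BinTree) : Runs (A := A) (move x) (st i o (t.ser ++ m) a b c)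
    (st i o m (cond x (t.ser.reverse ++ .mark :: a) a) (cond x b (t.ser.reverse ++ .mark :: b)) c)
    (5 * t.size + 5) := by
  -- The last two steps pop the marker from stack `c` and leave the loop.
  refine Runs.mono ((Runs.pushAux x _).seq (.seq .push_c (.seq .push_c
    (.moveLoop x t (n := 2) ?_)))) (by omega)
  cases x <;> exact .last_c rfl .skip

/-- Moves the symbols above the marker on stack `a` to the main stack. -/
def backA : Prog (Alph A) :=
  loop .a (fun h => match h with
    | some .leaf => push .m .leaf
    | some .node => push .m .node
    | _ => skip) fun h => h = some .mark ∨ h = none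

theorem Runs.backA (l : List Sym) (hl : .mark ∉ l) : ∀ {m}, Runs (A := A) Prog.backA
    (st i o m (l ++ .mark :: a) b c) (st i o (l.reverse ++ m) a b c) (2 * l.length + 2) := by
  induction l with
  | nil => intro m; exact .last_a rfl .skip
  | cons s l ih =>
    intro m
    simp only [List.mem_cons, not_or] at hl
    have := ih hl.2 (m := s :: m)
    refine Runs.mono (.cont_a (S' := st i o (s :: m) (l ++ .mark :: a) b c) (n := 1)
      (n' := 2 * l.length + 2) ?_ ?_ ?_) ?_
    · cases s <;> simp_all
    · cases s
      · exact .push_m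
      · exact .push_m
      · simp at hl
    · rw [List.reverse_cons, List.append_assoc]; exact this
    · simp; omega

/-- Moves the symbols above the marker on stack `b` to the main stack. -/
def backB : Prog (Alph A) :=
  loop .b (fun h => match h with
    | some .leaf => push .m .leaf
    | some .node => push .m .node
    | _ => skip) fun h => h = some .mark ∨ h = none

theorem Runs.backB (l : List Sym) (hl : .mark ∉ l) : ∀ {m}, Runs (A := A) Prog.backB
    (st i o m a (l ++ .mark :: b) c) (st i o (l.reverse ++ m) a b c) (2 * l.length + 2) := by
  induction l with
  | nil => intro m; exact .last_b rfl .skip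
  | cons s l ih =>
    intro m
    simp only [List.mem_cons, not_or] at hl
    have := ih hl.2 (m := s :: m)
    refine Runs.mono (.cont_b (S' := st i o (s :: m) a (l ++ .mark :: b) c) (n := 1)
      (n' := 2 * l.length + 2) ?_ ?_ ?_) ?_
    · cases s <;> simp_all
    · cases s
      · exact .push_m
      · exact .push_m
      · simp at hl
    · rw [List.reverse_cons, List.append_assoc]; exact this
    · simp; omega

/-- Moves the symbols above the marker on stack `a` to the main stack and to stack `b`. -/
def backBoth : Prog (Alph A) :=
  loop .a (fun h => match h with
    | some .leaf => seq (push .m .leaf) (push .b .leaf)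
    | some .node => seq (push .m .node) (push .b .node)
    | _ => skip) fun h => h = some .mark ∨ h = none

theorem Runs.backBoth (l : List Sym) (hl : .mark ∉ l) : ∀ {m b}, Runs (A := A) Prog.backBoth
    (st i o m (l ++ .mark :: a) b c) (st i o (l.reverse ++ m) a (l.reverse ++ b) c)
    (3 * l.length + 2) := by
  induction l with
  | nil => intro m b; exact .last_a rfl .skip
  | cons s l ih =>
    intro m b
    simp only [List.mem_cons, not_or] at hl
    have := ih hl.2 (m := s :: m) (b := s :: b)
    refine Runs.mono (.cont_a (S' := st i o (s :: m) (l ++ .mark :: a) (s :: b) c) (n := 2)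
      (n' := 3 * l.length + 2) ?_ ?_ ?_) ?_
    · cases s <;> simp_all
    · cases s
      · exact .seq .push_m .push_b
      · exact .seq .push_m .push_b
      · simp at hl
    · rw [List.reverse_cons, List.append_assoc, List.append_assoc]; exact this
    · simp; omega

/-- Removes the symbols above the marker on stack `a`. -/
def clearA : Prog (Alph A) := loop .a (fun _ => skip) fun h => h = some .mark ∨ h = none

theorem Runs.clearA (l : List Sym) (hl : .mark ∉ l) : Runs (A := A) Prog.clearA
    (st i o m (l ++ .mark :: a) b c) (st i o m a b c) (2 * l.length + 2) := by
  induction l with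
  | nil => exact .last_a rfl .skip
  | cons s l ih =>
    simp only [List.mem_cons, not_or] at hl
    refine Runs.mono (.cont_a ?_ .skip (ih hl.2)) ?_
    · cases s <;> simp_all
    · simp; omega

/-- Moves the symbols above the marker on stack `b` to stack `a`. -/
def shift : Prog (Alph A) :=
  loop .b (fun h => match h with
    | some .leaf => push .a .leaf
    | some .node => push .a .node
    | _ => skip) fun h => h = some .mark ∨ h = none

theorem Runs.shift (l : List Sym) (hl : .mark ∉ l) : ∀ {a}, Runs (A := A) Prog.shift
    (st i o m a (l ++ .mark :: b) c) (st i o m (l.reverse ++ a) b c) (2 * l.length + 2) := by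
  induction l with
  | nil => intro a; exact .last_b rfl .skip
  | cons s l ih =>
    intro a
    simp only [List.mem_cons, not_or] at hl
    have := ih hl.2 (a := s :: a)
    refine Runs.mono (.cont_b (S' := st i o m (s :: a) (l ++ .mark :: b) c) (n := 1)
      (n' := 2 * l.length + 2) ?_ ?_ ?_) ?_
    · cases s <;> simp_all
    · cases s
      · exact .push_a
      · exact .push_a
      · simp at hl
    · rw [List.reverse_cons, List.append_assoc]; exact this
    · simp; omega

/-- Removes the topmost tree. -/
def drop : Prog (Alph A) := seq (move true) clearA

theorem Runs.drop (t : BinTree) : Runs (A := A) Prog.drop (st i o (t.ser ++ m) a b c)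
    (st i o m a b c) (7 * t.size + 7) :=
  ((Runs.move true t).seq (Runs.clearA _ (by simpa using t.mark_notMem_ser))).mono
    (by simp [t.length_ser]; omega)

/-- Doubles the topmost tree. -/
def dup : Prog (Alph A) :=
  seq (move true) (seq (push .b .mark) (seq backBoth (seq (push .a .mark) (seq shift backA))))

/-- Transfer between stacks reverses the order. After `backBoth` the second copy lies in prefix
order on stack `b` and would arrive reversed on the main stack; the detour over stack `a` corrects
this. -/
theorem Runs.dup (t : BinTree) : Runs (A := A) Prog.dup (st i o (t.ser ++ m) a b c)
    (st i o (t.ser ++ (t.ser ++ m)) a b c) (12 * t.size + 13) := by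
  have hl : Sym.mark ∉ t.ser.reverse := by simpa using t.mark_notMem_ser
  have h₁ := Runs.backBoth (A := A) (i := i) (o := o) (m := m) (a := a) (b := .mark :: b) (c := c)
    _ hl
  have h₂ := Runs.shift (A := A) (i := i) (o := o) (m := t.ser ++ m) (a := .mark :: a) (b := b)
    (c := c) _ t.mark_notMem_ser
  have h₃ := Runs.backA (A := A) (i := i) (o := o) (m := t.ser ++ m) (a := a) (b := b) (c := c)
    _ hl
  simp only [List.reverse_reverse, List.length_reverse, BinTree.length_ser] at h₁ h₂ h₃
  exact ((Runs.move true t).seq (Runs.push_b.seq (h₁.seq (Runs.push_a.seq (h₂.seq h₃))))).mono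
    (by omega)

/-- Exchanges the two topmost trees. -/
def swap : Prog (Alph A) := seq (move true) (seq (move false) (seq backA backB))

/-- With the trees on different auxiliary stacks, the former top tree can be brought back first. -/
theorem Runs.swap (t u : BinTree) : Runs (A := A) Prog.swap (st i o (t.ser ++ (u.ser ++ m)) a b c)
    (st i o (u.ser ++ (t.ser ++ m)) a b c) (7 * t.size + 7 * u.size + 14) := by
  have h₁ : Sym.mark ∉ t.ser.reverse := by simpa using t.mark_notMem_ser
  have h₂ : Sym.mark ∉ u.ser.reverse := by simpa using u.mark_notMem_ser
  have := (Runs.move (A := A) (i := i) (o := o) (m := u.ser ++ m) (a := a) (b := b) (c := c)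
    true t).seq ((Runs.move false u).seq ((Runs.backA _ h₁).seq (Runs.backB _ h₂)))
  simp only [List.reverse_reverse, List.length_reverse, BinTree.length_ser] at this
  exact this.mono (by omega)

end Prog

end StackProg

/-! ### Polynomial time functions on trees -/

namespace StackProg

open Function Prog

theorem polynomial_mono (q : Polynomial ℕ) {m n : ℕ} (h : m ≤ n) : q.eval m ≤ q.eval n := by
  simp only [Polynomial.eval_eq_sum_range]
  gcongr

/-- Functions computed by a program on the topmost tree of the main stack, in polynomial time. -/
def PT (f : BinTree → BinTree) : Prop :=
  ∃ q : Polynomial ℕ, (∀ t, (f t).size ≤ q.eval t.size) ∧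
    ∀ A : Type, ∃ p : Prog (Alph A), ∀ t i o m a b c,
      Runs p (st i o (t.ser ++ m) a b c) (st i o ((f t).ser ++ m) a b c) (q.eval t.size)

/-- Left subtree. -/
def BinTree.left : BinTree → BinTree
  | .leaf => .leaf
  | .node l _ => l

/-- Right subtree. -/
def BinTree.right : BinTree → BinTree
  | .leaf => .leaf
  | .node _ r => r

/-- Is the tree not a leaf? -/
def BinTree.isNode : BinTree → Bool
  | .leaf => false
  | .node _ _ => true

theorem BinTree.size_left_le (t : BinTree) : t.left.size ≤ t.size := by
  cases t <;> simp only [left, size] <;> omega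

theorem BinTree.size_right_le (t : BinTree) : t.right.size ≤ t.size := by
  cases t <;> simp only [right, size] <;> omega

namespace PT

variable {f g h : BinTree → BinTree}

theorem id' : PT fun t => t :=
  ⟨.X + 1, by simp, fun _ => ⟨.skip, fun _ _ _ _ _ _ _ => Runs.skip.mono (by simp)⟩⟩

theorem leaf : PT fun _ => .leaf := by
  refine ⟨7 * .X + 8, by simp [BinTree.size], fun _ => ⟨.seq drop (.push .m .leaf),
    fun t i o m a b c => ((Runs.drop t).seq .push_m).mono ?_⟩⟩
  simp

/-- This is what the size bound in `PT` is for: the second program runs on `g t`, whose size has to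
be polynomial in that of `t`. -/
theorem comp (hf : PT f) (hg : PT g) : PT fun t => f (g t) := by
  obtain ⟨q, hq, hf⟩ := hf
  obtain ⟨r, hr, hg⟩ := hg
  have H (t) : q.eval (g t).size ≤ (r + q.comp r).eval t.size := by
    have := polynomial_mono q (hr t)
    simp; omega
  refine ⟨r + q.comp r, fun t => (hq _).trans (H t), fun A => ?_⟩
  obtain ⟨p, hp⟩ := hf A
  obtain ⟨p', hp'⟩ := hg A
  refine ⟨.seq p' p, fun t i o m a b c => ((hp' t i o m a b c).seq (hp _ _ _ _ _ _ _)).mono ?_⟩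
  have := polynomial_mono q (hr t)
  simp; omega

theorem node (hf : PT f) (hg : PT g) : PT fun t => .node (f t) (g t) := by
  obtain ⟨q, hq, hf⟩ := hf
  obtain ⟨r, hr, hg⟩ := hg
  refine ⟨q + 8 * r + 19 * .X + 40, fun t => ?_, fun A => ?_⟩
  · have := hq t
    have := hr t
    simp [BinTree.size]; omega
  · obtain ⟨p, hp⟩ := hf A
    obtain ⟨p', hp'⟩ := hg A
    -- The right component is computed first, because in prefix notation the left one has to lie
    -- above it.
    refine ⟨.seq dup (.seq p' (.seq swap (.seq p (.push .m .node)))), fun t i o m a b c => ?_⟩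
    have := (Runs.dup t).seq ((hp' t i o (t.ser ++ m) a b c).seq
      ((Runs.swap (g t) t).seq ((hp t i o ((g t).ser ++ m) a b c).seq (.push_m (x := .node)))))
    rw [← List.append_assoc] at this
    refine this.mono ?_
    have := hr t
    simp; omega

theorem left (hf : PT f) : PT fun t => (f t).left := by
  suffices h : PT BinTree.left from h.comp hf
  refine ⟨14 * .X + 40, fun t => ?_, fun A => ⟨case .m fun s => match s with
    | some .node => .seq swap drop
    | _ => .push .m .leaf, fun t i o m a b c => ?_⟩⟩
  · have := t.size_left_le
    simp; omega
  · cases t with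
    | leaf => exact (Runs.last_m rfl .push_m).mono (by simp)
    | node l r =>
      simp only [BinTree.ser, List.cons_append, List.append_assoc]
      refine (Runs.last_m rfl ((Runs.swap l r).seq (Runs.drop r))).mono ?_
      simp [BinTree.size]; omega

theorem right (hf : PT f) : PT fun t => (f t).right := by
  suffices h : PT BinTree.right from h.comp hf
  refine ⟨14 * .X + 40, fun t => ?_, fun A => ⟨case .m fun s => match s with
    | some .node => drop
    | _ => .push .m .leaf, fun t i o m a b c => ?_⟩⟩
  · have := t.size_right_le
    simp; omega
  · cases t with
    | leaf => exact (Runs.last_m rfl .push_m).mono (by simp)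
    | node l r =>
      simp only [BinTree.ser, List.cons_append, List.append_assoc]
      refine (Runs.last_m rfl (Runs.drop l)).mono ?_
      simp [BinTree.size]; omega

/-- A symbol recording a condition. -/
def flag (b : Bool) : Sym := cond b .node .leaf

/-- A program can record on top of the main stack whether a condition holds. -/
theorem test (hf : PT f) : ∃ q : Polynomial ℕ, ∀ A : Type, ∃ p : Prog (Alph A),
    ∀ t i o m a b c, Runs p (st i o (t.ser ++ m) a b c)
      (st i o (flag (f t).isNode :: (t.ser ++ m)) a b c) (q.eval t.size) := by
  obtain ⟨q, hq, hf⟩ := hf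
  refine ⟨12 * .X + 40 + 8 * q, fun A => ?_⟩
  obtain ⟨p, hp⟩ := hf A
  refine ⟨.seq dup (.seq p (case .m fun s => match s with
    | some .node => .seq drop (.seq drop (.push .m .node))
    | _ => .push .m .leaf)), fun t i o m a b c => ?_⟩
  have h := (Runs.dup (A := A) (i := i) (o := o) (a := a) (b := b) (c := c) (m := m) t).seq
    (hp t i o (t.ser ++ m) a b c)
  have := hq t
  rcases hft : f t with _ | ⟨l, r⟩
  · rw [hft] at h
    refine ((Runs.dup t).seq ((hp t i o (t.ser ++ m) a b c).seq ?_)).mono (n := _ + (_ + (1 + 1))) ?_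
    · rw [hft]
      exact .last_m rfl .push_m
    · simp; omega
  · refine ((Runs.dup t).seq ((hp t i o (t.ser ++ m) a b c).seq ?_)).mono
      (n := _ + (_ + ((7 * l.size + 7 + (7 * r.size + 7 + 1)) + 1))) ?_
    · rw [hft]
      simp only [BinTree.ser, List.cons_append, List.append_assoc]
      exact .last_m rfl ((Runs.drop l).seq ((Runs.drop r).seq .push_m))
    · rw [hft] at this
      simp [BinTree.size] at this ⊢; omega

theorem cond (hh : PT h) (hf : PT f) (hg : PT g) :
    PT fun t => bif (h t).isNode then f t else g t := by
  obtain ⟨s, hh⟩ := hh.test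
  obtain ⟨q, hq, hf⟩ := hf
  obtain ⟨r, hr, hg⟩ := hg
  refine ⟨s + q + r + 1, fun t => ?_, fun A => ?_⟩
  · have := hq t
    have := hr t
    simp only [Polynomial.eval_add, Polynomial.eval_one]
    cases (h t).isNode <;> simp only [cond_true, cond_false] <;> omega
  · obtain ⟨p₁, h₁⟩ := hh A
    obtain ⟨p₂, h₂⟩ := hf A
    obtain ⟨p₃, h₃⟩ := hg A
    refine ⟨.seq p₁ (case .m fun s => match s with | some .node => p₂ | _ => p₃),
      fun t i o m a b c => ?_⟩
    have H := h₁ t i o m a b c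
    cases hb : (h t).isNode <;> rw [hb] at H <;> simp only [hb, cond_true, cond_false]
    · refine (Runs.seq H (.last_m (x := .leaf) rfl (h₃ t i o m a b c))).mono ?_
      simp; omega
    · refine (Runs.seq H (.last_m (x := .node) rfl (h₂ t i o m a b c))).mono ?_
      simp; omega

/-- `Loop f g S n t r`: iterating `g` while `f` gives a node leads from `t` to `r` in `n` rounds,
where no intermediate tree has a size above `S`. -/
inductive Loop (f g : BinTree → BinTree) (S : ℕ) : ℕ → BinTree → BinTree → Prop
  | done {t} : (f t).isNode = false → t.size ≤ S → Loop f g S 0 t t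
  | step {n t r} : (f t).isNode = true → t.size ≤ S → Loop f g S n (g t) r →
      Loop f g S (n + 1) t r

theorem Loop.size_le {S n t r} (h : Loop f g S n t r) : t.size ≤ S := by cases h <;> assumption

theorem Loop.size_le' {S n t r} (h : Loop f g S n t r) : r.size ≤ S := by
  induction h <;> assumption

/-- A polynomial number of rounds alone would not do, since each round may enlarge the tree by a
polynomial. `H` therefore bounds all intermediate trees as well, and with them the cost of each
round. -/
theorem loop (hf : PT f) (hg : PT g) (hh : PT h) {F : BinTree → BinTree} (q : Polynomial ℕ)
    (H : ∀ t, ∃ n ≤ q.eval t.size, Loop f g (q.eval t.size) n (h t) (F t)) : PT F := by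
  obtain ⟨s, hf⟩ := hf.test
  obtain ⟨r, -, hg⟩ := hg
  obtain ⟨u, -, hh⟩ := hh
  refine ⟨u + s.comp q + q * (s.comp q + r.comp q + 1) + q + 2, fun t => ?_, fun A => ?_⟩
  · obtain ⟨n, hn, hl⟩ := H t
    have := hl.size_le'
    simp; omega
  · obtain ⟨p₁, h₁⟩ := hf A
    obtain ⟨p₂, h₂⟩ := hg A
    obtain ⟨p₃, h₃⟩ := hh A
    refine ⟨.seq p₃ (.seq p₁ (.loop .m (fun s => match s with | some .node => .seq p₂ p₁ | _ => .skip)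
      fun s => s ≠ some .node)), fun t i o m a b c => ?_⟩
    -- Whenever the loop is entered, the flag for the current tree is already on top: each round
    -- ends with a new test.
    have key : ∀ S n t t', Loop f g S n t t' → Runs (.loop .m (fun s => match s with
        | some .node => .seq p₂ p₁ | _ => .skip) fun s => s ≠ some .node)
        (st i o (flag (f t).isNode :: (t.ser ++ m)) a b c) (st i o (t'.ser ++ m) a b c)
        (n * (s.eval S + r.eval S + 1) + 2) := by
      intro S n t t' hl
      induction hl with
      | done hb _ => rw [hb]; exact (Runs.last_m rfl .skip).mono (by omega)
      | @step n t t' hb hS hl ih =>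
        rw [hb]
        refine (Runs.cont_m rfl ((h₂ t i o m a b c).seq (h₁ (g t) i o m a b c)) ih).mono ?_
        have := polynomial_mono r hS
        have := polynomial_mono s hl.size_le
        rw [Nat.succ_mul]
        omega
    obtain ⟨n, hn, hl⟩ := H t
    refine ((h₃ t i o m a b c).seq ((h₁ _ i o m a b c).seq (key _ _ _ _ hl))).mono ?_
    have := polynomial_mono s hl.size_le
    have := Nat.mul_le_mul_right (s.eval (q.eval t.size) + r.eval (q.eval t.size) + 1) hn
    simp; omega

theorem of_eq (hf : PT f) (hfg : ∀ t, f t = g t) : PT g := (funext hfg : f = g) ▸ hf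

theorem size_le (hf : PT f) : ∃ q : Polynomial ℕ, ∀ t, (f t).size ≤ q.eval t.size :=
  let ⟨q, hq, _⟩ := hf; ⟨q, hq⟩

theorem const : ∀ t, PT fun _ => t
  | .leaf => leaf
  | .node l r => (const l).node (const r)

end PT

/-- Trees as truth values. -/
def BinTree.ofBool (b : Bool) : BinTree := bif b then .node .leaf .leaf else .leaf

@[simp] theorem BinTree.isNode_ofBool (b : Bool) : (ofBool b).isNode = b := by cases b <;> rfl

/-- The list of trees hanging off the right spine. -/
def BinTree.spine : BinTree → List BinTree
  | .leaf => []
  | .node l r => l :: r.spine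

/-- The tree with a given list of trees along its right spine. -/
def BinTree.ofList : List BinTree → BinTree
  | [] => .leaf
  | t :: l => .node t (ofList l)

@[simp] theorem BinTree.spine_ofList (l : List BinTree) : (ofList l).spine = l := by
  induction l <;> simp_all [ofList, spine]

@[simp] theorem BinTree.ofList_spine (t : BinTree) : ofList t.spine = t := by
  induction t <;> simp_all [ofList, spine]

theorem BinTree.length_spine_le (t : BinTree) : t.spine.length ≤ t.size := by
  induction t <;> simp_all [spine, size]; omega

/-- The loop runs on trees `node (node c r) l` of context, accumulator and remaining list, as long
as the list is a node. The size bound ranges over all prefixes of the list, since these yield the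
intermediate accumulators. -/
theorem PT.foldl {s c i l : BinTree → BinTree} (hs : PT s) (hc : PT c) (hi : PT i) (hl : PT l)
    (q : Polynomial ℕ)
    (hq : ∀ t l₁ l₂, (l t).spine = l₁ ++ l₂ →
      (l₁.foldl (fun r x => s (.node (.node (c t) r) x)) (i t)).size ≤ q.eval t.size) :
    PT fun t => (l t).spine.foldl (fun r x => s (.node (.node (c t) r) x)) (i t) := by
  obtain ⟨u, hu⟩ := hc.size_le
  obtain ⟨v, hv⟩ := hl.size_le
  have key : PT fun t => .node (.node (c t)
      ((l t).spine.foldl (fun r x => s (.node (.node (c t) r) x)) (i t))) .leaf := by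
    refine PT.loop (f := BinTree.right) (g := fun t => .node (.node t.left.left
      (s (.node (.node t.left.left t.left.right) t.right.left))) t.right.right)
      (h := fun t => .node (.node (c t) (i t)) (l t))
      id'.right ((id'.left.left.node (hs.comp ((id'.left.left.node id'.left.right).node
        id'.right.left))).node id'.right.right) ((hc.node hi).node hl) (q + u + v + 2) fun t => ?_
    have : ∀ l₂ l₁, (l t).spine = l₁ ++ l₂ → (BinTree.ofList l₂).size ≤ v.eval t.size →
        Loop BinTree.right (fun t => .node (.node t.left.left
      (s (.node (.node t.left.left t.left.right) t.right.left))) t.right.right)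
        ((q + u + v + 2).eval t.size) l₂.length (.node (.node (c t) (l₁.foldl
          (fun r x => s (.node (.node (c t) r) x)) (i t))) (.ofList l₂))
        (.node (.node (c t) ((l₁ ++ l₂).foldl (fun r x => s (.node (.node (c t) r) x)) (i t)))
          .leaf) := by
      intro l₂
      induction l₂ with
      | nil =>
        intro l₁ h₁ h₂
        rw [List.append_nil]
        refine .done rfl ?_
        have := hq t l₁ [] h₁
        have := hu t
        simp [BinTree.size, BinTree.ofList] at h₂ ⊢; omega
      | cons x l₂ ih =>
        intro l₁ h₁ h₂
        refine .step rfl ?_ ?_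
        · have := hq t l₁ (x :: l₂) h₁
          have := hu t
          simp [BinTree.size, BinTree.ofList] at h₂ ⊢; omega
        · have := ih (l₁ ++ [x]) (by simp [h₁])
            (by simp [BinTree.size, BinTree.ofList] at h₂ ⊢; omega)
          simpa [BinTree.left, BinTree.right, BinTree.ofList] using this
    refine ⟨_, ?_, by simpa using this _ [] rfl (by simpa using hv t)⟩
    have h₁ := hv t
    have h₂ := (l t).length_spine_le
    simp; omega
  exact key.left.right.of_eq fun t => rfl

end StackProg

/-! ### Equality of trees -/

namespace StackProg

open Function Prog

/-- A list of pairs of trees as a tree. -/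
def BinTree.ofPairs (l : List (BinTree × BinTree)) : BinTree := ofList (l.map fun p => .node p.1 p.2)

/-- One step of the comparison of the pairs in a list. -/
def BinTree.eqStep (t : BinTree) : BinTree :=
  bif t.right.left.left.isNode then
    bif t.right.left.right.isNode then
      .node t.left (.node (.node t.right.left.left.left t.right.left.right.left)
        (.node (.node t.right.left.left.right t.right.left.right.right) t.right.right))
    else .node (.node .leaf .leaf) .leaf
  else
    bif t.right.left.right.isNode then .node (.node .leaf .leaf) .leaf
    else .node t.left t.right.right

/-- Each successful comparison lowers the sum of the sizes of the first components by one: two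
leaves disappear, two nodes give way to the pairs of their subtrees. The latter does not change the
size of the list. A mismatch empties the list and so ends the loop; the `5` covers the tree that
records it. -/
theorem BinTree.loop_eqStep : ∀ (k : ℕ) (l : List (BinTree × BinTree)) (S : ℕ),
    (l.map fun p => p.1.size).sum ≤ k → (BinTree.ofPairs l).size + 5 ≤ S →
    ∃ n ≤ k, PT.Loop BinTree.right BinTree.eqStep S n (.node .leaf (.ofPairs l))
      (.node (.ofBool !l.all fun p => decide (p.1 = p.2)) .leaf)
  | k, [], S, _, hS => ⟨0, by omega, by
      exact .done rfl (by simp [ofPairs, ofList, size] at hS ⊢; omega)⟩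
  | 0, (a, b) :: l, S, h, _ => by
      have := a.size_pos
      simp at h; omega
  | k + 1, (a, b) :: l, S, h, hS => by
    have key : ∀ {s r}, BinTree.eqStep (.node .leaf (.ofPairs ((a, b) :: l))) = s →
        (∃ n ≤ k, PT.Loop BinTree.right BinTree.eqStep S n s r) → ∃ n ≤ k + 1, PT.Loop BinTree.right
          BinTree.eqStep S n (.node .leaf (.ofPairs ((a, b) :: l))) r := by
      rintro s r rfl ⟨n, hn, hl⟩
      exact ⟨n + 1, by omega, .step rfl (by simp [size]; omega) hl⟩
    rcases a with _ | ⟨a, a'⟩ <;> rcases b with _ | ⟨b, b'⟩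
    · exact key (s := .node .leaf (.ofPairs l)) rfl (loop_eqStep k l S
        (by simp [size] at h; omega) (by simp [ofPairs, ofList, size] at hS ⊢; omega))
    · exact key (s := .node (.node .leaf .leaf) .leaf) rfl
        ⟨0, by omega, .done rfl (by simp [size]; omega)⟩
    · exact key (s := .node (.node .leaf .leaf) .leaf) rfl
        ⟨0, by omega, .done rfl (by simp [size]; omega)⟩
    · refine key (s := .node .leaf (.ofPairs ((a, b) :: (a', b') :: l))) rfl ?_
      have := loop_eqStep k ((a, b) :: (a', b') :: l) S (by simp [size] at h ⊢; omega)
        (by simp [ofPairs, ofList, size] at hS ⊢; omega)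
      simpa [← Bool.and_assoc] using this

theorem PT.eq {f g : BinTree → BinTree} (hf : PT f) (hg : PT g) :
    PT fun t => .ofBool (decide (f t = g t)) := by
  obtain ⟨q, hq⟩ := hf.size_le
  obtain ⟨r, hr⟩ := hg.size_le
  have hs : PT BinTree.eqStep := id'.right.left.left.cond
    (id'.right.left.right.cond (id'.left.node ((id'.right.left.left.left.node
      id'.right.left.right.left).node ((id'.right.left.left.right.node
      id'.right.left.right.right).node id'.right.right))) (const _))
    (id'.right.left.right.cond (const _) (id'.left.node id'.right.right))
  -- The loop records whether a mismatch was found, so its verdict has to be negated at the end.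
  have key : PT fun t => .node (.ofBool !decide (f t = g t)) .leaf := by
    refine PT.loop (h := fun t => .node .leaf (.node (.node (f t) (g t)) .leaf)) id'.right hs
      (leaf.node ((hf.node hg).node leaf)) (q + r + 20) fun t => ?_
    have h₁ := hq t
    have h₂ := hr t
    obtain ⟨n, hn, h⟩ := BinTree.loop_eqStep (f t).size [(f t, g t)] ((q + r + 20).eval t.size)
      (by simp) (by simp [BinTree.ofPairs, BinTree.ofList, BinTree.size]; omega)
    exact ⟨n, by simp; omega, by simpa [BinTree.ofPairs, BinTree.ofList] using h⟩
  refine (key.left.cond leaf (const (.node .leaf .leaf))).of_eq fun t => ?_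
  by_cases h : f t = g t <;> simp [h, BinTree.left, BinTree.ofBool, BinTree.isNode]

/-- An increase per step that does not depend on the accumulator adds up to a polynomial over the
list, whereas a constant factor per step would not. -/
theorem PT.foldl_of_add {s c i l : BinTree → BinTree} (hs : PT s) (hc : PT c) (hi : PT i) (hl : PT l)
    (q : Polynomial ℕ) (hq : ∀ t r, ∀ x ∈ (l t).spine,
      (s (.node (.node (c t) r) x)).size ≤ r.size + q.eval t.size) :
    PT fun t => (l t).spine.foldl (fun r x => s (.node (.node (c t) r) x)) (i t) := by
  obtain ⟨u, hu⟩ := hi.size_le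
  obtain ⟨v, hv⟩ := hl.size_le
  refine PT.foldl hs hc hi hl (u + v * q) fun t l₁ l₂ h => ?_
  have key : ∀ (l₁ : List BinTree) (r : BinTree), (∀ x ∈ l₁, x ∈ (l t).spine) →
      (l₁.foldl (fun r x => s (.node (.node (c t) r) x)) r).size ≤
        r.size + l₁.length * q.eval t.size := by
    intro l₁
    induction l₁ with
    | nil => simp
    | cons x l₁ ih =>
      intro r h
      have h₁ := ih (s (.node (.node (c t) r) x)) fun y hy => h y (by simp [hy])
      have h₂ := hq t r x (h x (by simp))
      simp only [List.foldl_cons, List.length_cons, Nat.succ_mul]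
      omega
  have h₁ := key l₁ (i t) fun x hx => by simp [h, hx]
  have h₂ : l₁.length ≤ v.eval t.size := by
    have := congrArg List.length h
    have := (l t).length_spine_le
    have := hv t
    simp at *; omega
  have h₃ := Nat.mul_le_mul_right (q.eval t.size) h₂
  have := hu t
  simp; omega

/-! ### Types encoded by trees -/

/-- Types with an encoding by trees. Every tree is read as an element, and the encodings of this
element can be computed in polynomial time. -/
class Code (α : Type) where
  enc : α → BinTree
  dec : BinTree → α
  dec_enc : ∀ a, dec (enc a) = a
  pt : PT fun t => enc (dec t)

attribute [simp] Code.dec_enc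

open Code

/-- Functions that can be computed in polynomial time on the encodings. -/
@[fun_prop]
def PolyTime {α β : Type} [Code α] [Code β] (f : α → β) : Prop := PT fun t => enc (f (dec t))

/-- The size of an encoding. -/
def sz {α : Type} [Code α] (a : α) : ℕ := (enc a).size

theorem sz_pos {α : Type} [Code α] (a : α) : 0 < sz a := BinTree.size_pos _

theorem enc_injective {α : Type} [Code α] : Injective (enc : α → BinTree) :=
  HasLeftInverse.injective ⟨dec, dec_enc⟩

variable {α β γ δ : Type} [Code α] [Code β] [Code γ] [Code δ]

/-- The code of a retract. -/
@[reducible]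
def Code.ofRetract {α : Type} (f : α → β) (g : β → α) (h : ∀ a, g (f a) = a)
    (hp : PolyTime fun b => f (g b)) : Code α where
  enc a := enc (f a)
  dec t := g (dec t)
  dec_enc := by simp [h]
  pt := hp

namespace PolyTime

@[fun_prop]
theorem id' : PolyTime fun a : α => a := Code.pt

@[fun_prop]
theorem const (b : β) : PolyTime fun _ : α => b := PT.const _

@[fun_prop]
theorem comp {f : β → γ} {g : α → β} (hf : PolyTime f) (hg : PolyTime g) :
    PolyTime fun a => f (g a) :=
  (PT.comp hf hg).of_eq fun t => by simp

theorem of_eq {f g : α → β} (hf : PolyTime f) (h : ∀ a, f a = g a) : PolyTime g :=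
  (funext h : f = g) ▸ hf

theorem size_le {f : α → β} (hf : PolyTime f) : ∃ q : Polynomial ℕ, ∀ a, sz (f a) ≤ q.eval (sz a) :=
  let ⟨q, hq⟩ := PT.size_le hf
  ⟨q, fun a => by simpa [sz] using hq (enc a)⟩

end PolyTime

theorem Code.polyTime_to {α : Type} (f : α → β) (g : β → α) (h : ∀ a, g (f a) = a)
    (hp : PolyTime fun b => f (g b)) : @PolyTime _ _ (ofRetract f g h hp) _ f := hp

theorem Code.polyTime_of {α : Type} (f : α → β) (g : β → α) (h : ∀ a, g (f a) = a)
    (hp : PolyTime fun b => f (g b)) : @PolyTime _ _ _ (ofRetract f g h hp) g := hp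

instance : Code BinTree := ⟨fun t => t, fun t => t, fun _ => rfl, PT.id'⟩

/-- The code of truth values by trees of equal size. -/
instance : Code Bool where
  enc b := bif b then .node (.node .leaf .leaf) .leaf else .node .leaf (.node .leaf .leaf)
  dec t := t.left.isNode
  dec_enc b := by cases b <;> rfl
  pt := PT.id'.left.cond (PT.const _) (PT.const _)

theorem PT.encBool {f : BinTree → BinTree} {b : BinTree → Bool} (hf : PT f)
    (h : ∀ t, (f t).isNode = b t) : PT fun t => enc (b t) :=
  (hf.cond (const (enc true)) (const (enc false))).of_eq fun t => by
    rw [h]; cases b t <;> rfl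

instance : Code (α × β) where
  enc p := .node (enc p.1) (enc p.2)
  dec t := (dec t.left, dec t.right)
  dec_enc := by simp [BinTree.left, BinTree.right]
  pt := (Code.pt.comp PT.id'.left).node (Code.pt.comp PT.id'.right)

instance : Code (Option α) where
  enc o := o.elim .leaf fun a => .node .leaf (enc a)
  dec t := bif t.isNode then some (dec t.right) else none
  dec_enc a := by cases a <;> simp [BinTree.isNode, BinTree.right]
  pt := (PT.id'.cond (PT.leaf.node (Code.pt.comp PT.id'.right)) PT.leaf).of_eq fun t => by
    cases t.isNode <;> rfl

instance : Code (α ⊕ β) where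
  enc := Sum.elim (fun a => .node .leaf (enc a)) fun b => .node (.node .leaf .leaf) (enc b)
  dec t := bif t.left.isNode then .inr (dec t.right) else .inl (dec t.right)
  dec_enc a := by cases a <;> simp [BinTree.isNode, BinTree.right, BinTree.left]
  pt := (PT.id'.left.cond ((PT.const _).node (Code.pt.comp PT.id'.right))
    (PT.leaf.node (Code.pt.comp PT.id'.right))).of_eq fun t => by
    cases t.left.isNode <;> rfl

theorem BinTree.foldl_node (f : BinTree → BinTree) (l : List BinTree) (r : BinTree) :
    l.foldl (fun r x => .node (f x) r) r = .ofList ((l.map f).reverse ++ r.spine) := by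
  induction l generalizing r with
  | nil => simp
  | cons x l ih => simp [ih, spine]

theorem BinTree.size_le_of_mem_spine {t x : BinTree} (h : x ∈ t.spine) : x.size ≤ t.size := by
  induction t with
  | leaf => simp [spine] at h
  | node l r _ ih =>
    simp only [spine, List.mem_cons] at h
    rcases h with rfl | h
    · simp only [size]; omega
    · have := ih h
      simp only [size]; omega

/-- Folding by prepending reverses the list; a second fold restores the order. -/
theorem PT.map {f : BinTree → BinTree} (hf : PT f) : PT fun t => .ofList (t.spine.map f) := by
  obtain ⟨q, hq⟩ := hf.size_le
  have h₁ : PT fun t => .ofList (t.spine.map f).reverse := by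
    refine (PT.foldl_of_add (s := fun t => .node (f t.right) t.left.right) (c := fun _ => .leaf)
      (i := fun _ => .leaf) (l := fun t => t) ((hf.comp id'.right).node id'.left.right)
      leaf leaf id' (q + 1) fun t r x hx => ?_).of_eq fun t => ?_
    · have := (hq x).trans (polynomial_mono q (BinTree.size_le_of_mem_spine hx))
      simp [BinTree.size, BinTree.left, BinTree.right]; omega
    · simp [BinTree.left, BinTree.right, BinTree.foldl_node, BinTree.spine]
  -- Any polynomial from `q + 1` on would serve as the bound for this second pass.
  refine (PT.foldl_of_add (s := fun t => .node t.right t.left.right) (c := fun _ => .leaf)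
    (i := fun _ => .leaf) (l := fun t => .ofList (t.spine.map f).reverse) (id'.right.node
    id'.left.right) leaf leaf h₁ (q.comp .X * .X + 2 * .X + q + 5) fun t r x hx => ?_).of_eq fun t => ?_
  · have : ∃ y ∈ t.spine, f y = x := by simpa using hx
    obtain ⟨y, hy, rfl⟩ := this
    have := (hq y).trans (polynomial_mono q (BinTree.size_le_of_mem_spine hy))
    simp [BinTree.size, BinTree.left, BinTree.right]; omega
  · have := BinTree.foldl_node (fun x => x) (t.spine.map f).reverse .leaf
    simpa [BinTree.left, BinTree.right, BinTree.spine, comp_def] using this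

instance : Code (List α) where
  enc l := .ofList (l.map enc)
  dec t := t.spine.map dec
  dec_enc l := by simp [comp_def]
  pt := (PT.map Code.pt).of_eq fun t => by rw [List.map_map]; rfl

theorem enc_list (l : List α) : enc l = .ofList (l.map enc) := rfl

theorem sz_prod (a : α) (b : β) : sz (a, b) = sz a + sz b + 1 := rfl

theorem sz_nil : sz ([] : List α) = 1 := rfl

theorem sz_cons (a : α) (l : List α) : sz (a :: l) = sz a + sz l + 1 := rfl

theorem sz_none : sz (none : Option α) = 1 := rfl

theorem sz_some (a : α) : sz (some a) = sz a + 2 := by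
  simp [sz, enc, BinTree.size]; omega

theorem sz_inl (a : α) : sz (.inl a : α ⊕ β) = sz a + 2 := by
  simp [sz, enc, BinTree.size]; omega

theorem sz_inr (b : β) : sz (.inr b : α ⊕ β) = sz b + 4 := by
  simp [sz, enc, BinTree.size]; omega

theorem sz_bool (b : Bool) : sz b = 5 := by cases b <;> rfl

theorem sz_append (l l' : List α) : sz (l ++ l') + 1 = sz l + sz l' := by
  induction l with
  | nil => simp [sz_nil]; omega
  | cons a l ih => simp only [List.cons_append, sz_cons]; omega

theorem sz_le_of_mem {a : α} {l : List α} (h : a ∈ l) : sz a < sz l := by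
  induction l with
  | nil => simp at h
  | cons b l ih =>
    rw [sz_cons]
    rcases List.mem_cons.1 h with rfl | h
    · omega
    · have := ih h; omega

theorem length_lt_sz (l : List α) : l.length < sz l := by
  induction l with
  | nil => simp [sz_nil]
  | cons a l ih => rw [sz_cons, List.length_cons]; omega

theorem sz_le_of_forall {l : List α} {n : ℕ} (h : ∀ a ∈ l, sz a ≤ n) :
    sz l ≤ l.length * (n + 1) + 1 := by
  induction l with
  | nil => simp [sz_nil]
  | cons a l ih =>
    have h₁ := h a (by simp)
    have h₂ := ih fun b hb => h b (by simp [hb])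
    rw [sz_cons, List.length_cons, Nat.succ_mul]; omega

/-! ### Closure properties for pairs, options, sums and lists -/

namespace PolyTime

@[fun_prop]
theorem fst : PolyTime fun p : α × β => p.1 :=
  (Code.pt.comp PT.id'.left).of_eq fun _ => rfl

@[fun_prop]
theorem snd : PolyTime fun p : α × β => p.2 :=
  (Code.pt.comp PT.id'.right).of_eq fun _ => rfl

@[fun_prop]
theorem prodMk {f : α → β} {g : α → γ} (hf : PolyTime f) (hg : PolyTime g) :
    PolyTime fun a => (f a, g a) := PT.node hf hg

@[fun_prop]
theorem cond {b : α → Bool} {f g : α → β} (hb : PolyTime b) (hf : PolyTime f) (hg : PolyTime g) :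
    PolyTime fun a => bif b a then f a else g a :=
  (PT.cond (PT.left hb) hf hg).of_eq fun t => by
    beta_reduce
    cases b (dec t) <;> rfl

@[fun_prop]
theorem of_some {f : α → β} (hf : PolyTime f) : PolyTime fun a => some (f a) :=
  PT.leaf.node hf

@[fun_prop]
theorem inl {f : α → β} (hf : PolyTime f) : PolyTime fun a => (Sum.inl (f a) : β ⊕ γ) :=
  PT.leaf.node hf

@[fun_prop]
theorem inr {f : α → γ} (hf : PolyTime f) : PolyTime fun a => (Sum.inr (f a) : β ⊕ γ) :=
  (PT.const _).node hf

@[fun_prop]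
theorem cons {f : α → β} {g : α → List β} (hf : PolyTime f) (hg : PolyTime g) :
    PolyTime fun a => f a :: g a := PT.node hf hg

@[fun_prop]
theorem node {f g : α → BinTree} (hf : PolyTime f) (hg : PolyTime g) :
    PolyTime fun a => BinTree.node (f a) (g a) := PT.node hf hg

@[fun_prop]
theorem isSome {o : α → Option β} (ho : PolyTime o) : PolyTime fun a => (o a).isSome :=
  PT.encBool ho fun t => by beta_reduce; cases o (dec t) <;> rfl

@[fun_prop]
theorem option_elim {o : α → Option β} {f : α → γ} {g : α → β → γ} (ho : PolyTime o)
    (hf : PolyTime f) (hg : PolyTime fun p : α × β => g p.1 p.2) :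
    PolyTime fun a => (o a).elim (f a) (g a) := by
  refine (PT.cond ho (PT.comp hg (PT.id'.node (PT.right ho))) hf).of_eq fun t => ?_
  cases h : o (dec t)
  · simp [h]; rfl
  · simp [h, enc, dec, BinTree.isNode, BinTree.right, BinTree.left]

@[fun_prop]
theorem sum_elim {o : α → β ⊕ γ} {f : α → β → δ} {g : α → γ → δ} (ho : PolyTime o)
    (hf : PolyTime fun p : α × β => f p.1 p.2) (hg : PolyTime fun p : α × γ => g p.1 p.2) :
    PolyTime fun a => (o a).elim (f a) (g a) := by
  refine (PT.cond (PT.left ho) (PT.comp hg (PT.id'.node (PT.right ho)))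
    (PT.comp hf (PT.id'.node (PT.right ho)))).of_eq fun t => ?_
  cases h : o (dec t) <;> simp [h, enc, dec, BinTree.isNode, BinTree.right, BinTree.left]

/-- Case distinction on a list. -/
def _root_.List.elim' {α β : Type} (l : List α) (b : β) (f : α → List α → β) : β :=
  match l with
  | [] => b
  | a :: l => f a l

@[fun_prop]
theorem list_elim {o : α → List β} {f : α → γ} {g : α → β → List β → γ} (ho : PolyTime o)
    (hf : PolyTime f) (hg : PolyTime fun p : α × β × List β => g p.1 p.2.1 p.2.2) :
    PolyTime fun a => (o a).elim' (f a) (g a) := by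
  refine (PT.cond ho (PT.comp hg (PT.id'.node ho)) hf).of_eq fun t => ?_
  cases h : o (dec t)
  · simp [h]; rfl
  · simp [h, enc, dec, BinTree.isNode, BinTree.right, BinTree.left, List.elim', BinTree.ofList, comp_def]

/-- A tree need not be the canonical code of the context that it is read as, so the context is
encoded anew before the fold; `u` bounds the size of that code. -/
theorem foldl {f : γ → β → α → β} {i : γ → β} {l : γ → List α}
    (hf : PolyTime fun p : (γ × β) × α => f p.1.1 p.1.2 p.2) (hi : PolyTime i) (hl : PolyTime l)
    (q : Polynomial ℕ)
    (hq : ∀ c l₁ l₂, l c = l₁ ++ l₂ → sz (l₁.foldl (f c) (i c)) ≤ q.eval (sz c)) :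
    PolyTime fun c => (l c).foldl (f c) (i c) := by
  obtain ⟨u, hu⟩ := PT.size_le (Code.pt (α := γ))
  have key (c : γ) (l : List α) (b : β) : (l.map (enc (α := α))).foldl (fun r x =>
      enc ((fun p : (γ × β) × α => f p.1.1 p.1.2 p.2) (dec (BinTree.node (.node (enc c) r) x)))) (enc b) =
      enc (l.foldl (f c) b) := by
    induction l generalizing b with
    | nil => rfl
    | cons x l ih =>
      simp only [List.map_cons, List.foldl_cons]
      rw [← ih]
      congr 1
      simp [dec, BinTree.left, BinTree.right]
  refine (PT.foldl hf (Code.pt (α := γ)) hi hl (q.comp u) fun t l₁ l₂ h => ?_).of_eq fun t => ?_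
  · rw [enc_list, BinTree.spine_ofList, List.map_eq_append_iff] at h
    obtain ⟨l₁, l₂, h, rfl, rfl⟩ := h
    rw [key, Polynomial.eval_comp]
    exact (hq _ _ _ h).trans (polynomial_mono q (hu t))
  · rw [enc_list, BinTree.spine_ofList, key]

theorem foldl_of_add {f : γ → β → α → β} {i : γ → β} {l : γ → List α}
    (hf : PolyTime fun p : (γ × β) × α => f p.1.1 p.1.2 p.2) (hi : PolyTime i) (hl : PolyTime l)
    (q : Polynomial ℕ) (hq : ∀ c b, ∀ x ∈ l c, sz (f c b x) ≤ sz b + q.eval (sz c)) :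
    PolyTime fun c => (l c).foldl (f c) (i c) := by
  obtain ⟨u, hu⟩ := hi.size_le
  obtain ⟨v, hv⟩ := hl.size_le
  refine foldl hf hi hl (u + v * q) fun c l₁ l₂ h => ?_
  have key : ∀ (l₁ : List α) (b : β), (∀ x ∈ l₁, x ∈ l c) →
      sz (l₁.foldl (f c) b) ≤ sz b + l₁.length * q.eval (sz c) := by
    intro l₁
    induction l₁ with
    | nil => simp
    | cons x l₁ ih =>
      intro r h
      have h₁ := ih (f c r x) fun y hy => h y (by simp [hy])
      have h₂ := hq c r x (h x (by simp))
      simp only [List.foldl_cons, List.length_cons, Nat.succ_mul]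
      omega
  have h₁ := key l₁ (i c) fun x hx => by simp [h, hx]
  have h₂ : l₁.length ≤ v.eval (sz c) := by
    have := congrArg List.length h
    have := length_lt_sz (l c)
    have := hv c
    simp at *; omega
  have h₃ := Nat.mul_le_mul_right (q.eval (sz c)) h₂
  have := hu c
  simp; omega

@[fun_prop]
theorem reverse {l : α → List β} (hl : PolyTime l) : PolyTime fun a => (l a).reverse := by
  obtain ⟨q, hq⟩ := hl.size_le
  refine (foldl_of_add (f := fun _ r x => x :: r) (i := fun _ => []) (by fun_prop) (by fun_prop) hl
    (q + 1) fun c b x hx => ?_).of_eq fun a => by simp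
  have := sz_le_of_mem hx
  have := hq c
  simp [sz_cons]; omega

@[fun_prop]
theorem append {l l' : α → List β} (hl : PolyTime l) (hl' : PolyTime l') :
    PolyTime fun a => l a ++ l' a := by
  obtain ⟨q, hq⟩ := hl.size_le
  refine (foldl_of_add (f := fun _ r x => x :: r) (i := l') (by fun_prop) hl' hl.reverse
    (q + 1) fun c b x hx => ?_).of_eq fun a => by simp
  have := sz_le_of_mem (List.mem_reverse.1 hx)
  have := hq c
  simp [sz_cons]; omega

@[fun_prop]
theorem flatMap {l : α → List β} {f : α → β → List γ} (hl : PolyTime l)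
    (hf : PolyTime fun p : α × β => f p.1 p.2) : PolyTime fun a => (l a).flatMap (f a) := by
  obtain ⟨q, hq⟩ := hl.size_le
  obtain ⟨r, hr⟩ := hf.size_le
  refine (foldl_of_add (f := fun a s x => s ++ f a x) (i := fun _ => []) (by fun_prop)
    (by fun_prop) hl (r.comp (q + .X + 1)) fun c b x hx => ?_).of_eq fun a => ?_
  · have h₁ := sz_le_of_mem hx
    have h₂ := hq c
    have h₃ : sz (f c x) ≤ _ := hr (c, x)
    have h₄ := polynomial_mono r (m := sz (c, x)) (n := q.eval (sz c) + sz c + 1)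
      (by rw [sz_prod]; omega)
    have := sz_append b (f c x)
    simp; omega
  · suffices ∀ l s, List.foldl (fun s x => s ++ f a x) s l = s ++ l.flatMap (f a) by simp [this]
    intro l
    induction l with
    | nil => simp
    | cons x l ih => simp [ih]

@[fun_prop]
theorem map {l : α → List β} {f : α → β → γ} (hl : PolyTime l)
    (hf : PolyTime fun p : α × β => f p.1 p.2) : PolyTime fun a => (l a).map (f a) :=
  (hl.flatMap (f := fun a b => [f a b]) (by fun_prop)).of_eq fun a => by
    induction l a <;> simp_all

@[fun_prop]
theorem toList {o : α → Option β} (ho : PolyTime o) : PolyTime fun a => (o a).toList :=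
  (ho.option_elim (f := fun _ => []) (g := fun _ b => [b]) (by fun_prop) (by fun_prop)).of_eq
    fun a => by cases o a <;> rfl

@[fun_prop]
theorem filterMap {l : α → List β} {f : α → β → Option γ} (hl : PolyTime l)
    (hf : PolyTime fun p : α × β => f p.1 p.2) : PolyTime fun a => (l a).filterMap (f a) :=
  (hl.flatMap (f := fun a b => (f a b).toList) (by fun_prop)).of_eq fun a => by
    induction l a with
    | nil => rfl
    | cons b l ih => rw [List.flatMap_cons, ih, List.filterMap_cons]; cases f a b <;> rfl

@[fun_prop]
theorem option_bind {o : α → Option β} {f : α → β → Option γ} (ho : PolyTime o)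
    (hf : PolyTime fun p : α × β => f p.1 p.2) : PolyTime fun a => (o a).bind (f a) :=
  (ho.option_elim (f := fun _ => none) (g := f) (by fun_prop) hf).of_eq
    fun a => by cases o a <;> rfl

@[fun_prop]
theorem option_map {o : α → Option β} {f : α → β → γ} (ho : PolyTime o)
    (hf : PolyTime fun p : α × β => f p.1 p.2) : PolyTime fun a => (o a).map (f a) :=
  (ho.option_elim (f := fun _ => none) (g := fun a b => some (f a b)) (by fun_prop)
    (by fun_prop)).of_eq fun a => by cases o a <;> rfl

@[fun_prop]
theorem getD {o : α → Option β} {f : α → β} (ho : PolyTime o)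
    (hf : PolyTime f) : PolyTime fun a => (o a).getD (f a) :=
  (ho.option_elim (f := f) (g := fun _ b => b) hf (by fun_prop)).of_eq
    fun a => by cases o a <;> rfl

@[fun_prop]
theorem head? {l : α → List β} (hl : PolyTime l) : PolyTime fun a => (l a).head? :=
  (hl.list_elim (f := fun _ => none) (g := fun _ b _ => some b) (by fun_prop)
    (by fun_prop)).of_eq fun a => by cases l a <;> rfl

@[fun_prop]
theorem tail {l : α → List β} (hl : PolyTime l) : PolyTime fun a => (l a).tail :=
  (hl.list_elim (f := fun _ => []) (g := fun _ _ l => l) (by fun_prop)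
    (by fun_prop)).of_eq fun a => by cases l a <;> rfl

end PolyTime

end StackProg

/-! ### Predicates decided in polynomial time -/

namespace StackProg

open Function Code

variable {α β γ δ : Type} [Code α] [Code β] [Code γ] [Code δ]

open Classical in
/-- Predicates that can be decided in polynomial time. -/
@[fun_prop]
def PolyPred (p : α → Prop) : Prop := PolyTime fun a => decide (p a)

/-- `PolyPred` is stated with classical decisions. All decisions of a proposition agree, so any
instance may take their place. -/
theorem polyPred_iff {p : α → Prop} [DecidablePred p] :
    PolyPred p ↔ PolyTime fun a => decide (p a) := by
  unfold PolyPred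
  rw [iff_iff_eq]
  congr!

/-- Bounded universal quantification. -/
def ForallMem {β : Type} (l : List β) (p : β → Prop) : Prop := ∀ x ∈ l, p x

/-- Bounded existential quantification. -/
def ExistsMem {β : Type} (l : List β) (p : β → Prop) : Prop := ∃ x ∈ l, p x

namespace PolyPred

@[fun_prop]
theorem comp {p : β → Prop} {g : α → β} (hp : PolyPred p) (hg : PolyTime g) :
    PolyPred fun a => p (g a) := PolyTime.comp hp hg

@[fun_prop]
theorem const (p : Prop) : PolyPred fun _ : α => p := by
  classical exact PolyTime.const _

theorem of_iff {p q : α → Prop} (hp : PolyPred p) (h : ∀ a, p a ↔ q a) : PolyPred q :=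
  (funext fun a => propext (h a) : p = q) ▸ hp

theorem of_bool {b : α → Bool} (hb : PolyTime b) : PolyPred fun a => b a = true :=
  polyPred_iff.2 (hb.of_eq fun a => by simp)

@[fun_prop]
theorem not {p : α → Prop} (hp : PolyPred p) : PolyPred fun a => ¬ p a := by
  classical
  exact polyPred_iff.2 ((PolyTime.cond (polyPred_iff.1 hp) (.const false) (.const true)).of_eq
    fun a => by by_cases h : p a <;> simp [h])

@[fun_prop]
theorem and {p q : α → Prop} (hp : PolyPred p) (hq : PolyPred q) :
    PolyPred fun a => p a ∧ q a := by
  classical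
  exact polyPred_iff.2 ((PolyTime.cond (polyPred_iff.1 hp) (polyPred_iff.1 hq) (.const false)).of_eq
    fun a => by by_cases h : p a <;> simp [h])

@[fun_prop]
theorem or {p q : α → Prop} (hp : PolyPred p) (hq : PolyPred q) :
    PolyPred fun a => p a ∨ q a := by
  classical
  exact polyPred_iff.2 ((PolyTime.cond (polyPred_iff.1 hp) (.const true) (polyPred_iff.1 hq)).of_eq
    fun a => by by_cases h : p a <;> simp [h])

@[fun_prop]
theorem eq {f g : α → β} (hf : PolyTime f) (hg : PolyTime g) : PolyPred fun a => f a = g a := by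
  classical
  refine polyPred_iff.2 (PT.encBool (PT.eq hf hg) fun t => ?_)
  simp [enc_injective.eq_iff]

end PolyPred

@[fun_prop]
theorem PolyTime.ite {p : α → Prop} [DecidablePred p] {f g : α → β} (hp : PolyPred p)
    (hf : PolyTime f) (hg : PolyTime g) : PolyTime fun a => if p a then f a else g a :=
  ((polyPred_iff.1 hp).cond hf hg).of_eq fun a => by by_cases h : p a <;> simp [h]

@[fun_prop]
theorem PolyTime.of_pred {p : α → Prop} [DecidablePred p] (hp : PolyPred p) :
    PolyTime fun a => decide (p a) := polyPred_iff.1 hp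

@[fun_prop]
theorem PolyPred.existsMem {l : α → List β} {p : α → β → Prop} (hl : PolyTime l)
    (hp : PolyPred fun x : α × β => p x.1 x.2) : PolyPred fun a => ExistsMem (l a) (p a) := by
  classical
  refine polyPred_iff.2 ((PolyTime.foldl_of_add (f := fun a r x => bif r then true else
    decide (p a x)) (i := fun _ => false) (l := l) (by fun_prop) (.const _) hl 5
    fun c b x _ => ?_).of_eq fun a => ?_)
  -- Both truth values have codes of size five, so the accumulator cannot grow.
  · rw [sz_bool, sz_bool]; omega
  · suffices ∀ l b, List.foldl (fun r x => bif r then true else decide (p a x)) b l =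
        (b || decide (ExistsMem l (p a))) by simpa using this (l a) false
    intro l
    induction l with
    | nil => simp [ExistsMem]
    | cons x l ih =>
      intro b
      rw [List.foldl_cons, ih, Bool.eq_iff_iff]
      simp only [Bool.or_eq_true, decide_eq_true_iff]
      cases b <;> simp [ExistsMem]

@[fun_prop]
theorem PolyPred.forallMem {l : α → List β} {p : α → β → Prop} (hl : PolyTime l)
    (hp : PolyPred fun x : α × β => p x.1 x.2) : PolyPred fun a => ForallMem (l a) (p a) :=
  (PolyPred.not (existsMem (p := fun a x => ¬ p a x) hl (by fun_prop))).of_iff fun a => by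
    simp [ForallMem, ExistsMem]

@[fun_prop]
theorem PolyPred.mem {f : α → β} {l : α → List β} (hf : PolyTime f) (hl : PolyTime l) :
    PolyPred fun a => f a ∈ l a :=
  (existsMem (p := fun a x => f a = x) hl (by fun_prop)).of_iff fun a => by simp [ExistsMem]

namespace PolyTime

/-- Case distinction over a finite type. -/
theorem of_finite [Finite α] {f : γ → α} (hf : PolyTime f) {g : α → γ → β}
    (hg : ∀ a, PolyTime (g a)) : PolyTime fun c => g (f c) c := by
  classical
  -- A chain of comparisons along a list of values. The result for values off the list is arbitrary,
  -- and irrelevant once all values are listed.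
  have key (l : List α) : PolyTime fun c => if f c ∈ l then g (f c) c else dec .leaf := by
    induction l with
    | nil => exact (const (dec .leaf)).of_eq fun c => by simp
    | cons a l ih =>
      refine (ite (p := fun c => f c = a) (by fun_prop) (hg a) ih).of_eq fun c => ?_
      by_cases h : f c = a
      · simp [h]
      · simp [h]
  have := Fintype.ofFinite α
  exact (key Finset.univ.toList).of_eq fun c => by simp

theorem of_finite' [Finite α] (f : α → β) : PolyTime f :=
  of_finite (f := fun a => a) id' (g := fun a _ => f a) fun _ => const _

end PolyTime

theorem PolyPred.of_finite [Finite α] {f : γ → α} (hf : PolyTime f) {p : α → γ → Prop}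
    (hp : ∀ a, PolyPred (p a)) : PolyPred fun c => p (f c) c := by
  classical exact PolyTime.of_finite hf hp

/-- A code of a finite type. -/
@[reducible]
noncomputable def Code.ofFinite (α : Type) [Finite α] [Inhabited α] : Code α :=
  letI := Fintype.ofFinite α
  letI e : α → BinTree := fun a => .ofList (List.replicate (Fintype.equivFin α a) .leaf)
  haveI he : Injective e := fun a b h => by
    have := congrArg (fun t => t.spine.length) h
    simpa [e, Fin.val_inj] using this
  { enc := e
    dec := fun t => (partialInv e t).getD default
    dec_enc := fun a => by simp [partialInv_left he]
    pt := by
      classical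
      -- Normalizing a tree amounts to a search in a finite table; trees that are no codes become
      -- the code of `default`.
      have key (l : List α) : PT fun t => if t ∈ l.map e then t else e default := by
        induction l with
        | nil => exact (PT.const (e default)).of_eq fun t => by simp
        | cons a l ih =>
          refine ((PT.id'.eq (PT.const (e a))).cond (PT.const (e a)) ih).of_eq fun t => ?_
          by_cases h : t = e a <;> simp [h]
      refine (key Finset.univ.toList).of_eq fun t => ?_
      by_cases h : ∃ a, e a = t
      · obtain ⟨a, rfl⟩ := h
        simp [partialInv_left he]
      · have : partialInv e t = none := by simp [partialInv, h]
        rw [this, if_neg (by simpa using h)]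
        rfl }

namespace PolyTime

@[fun_prop]
theorem not {b : α → Bool} (hb : PolyTime b) : PolyTime fun a => !b a :=
  (hb.cond (const false) (const true)).of_eq fun a => by cases b a <;> rfl

@[fun_prop]
theorem and {b c : α → Bool} (hb : PolyTime b) (hc : PolyTime c) : PolyTime fun a => b a && c a :=
  (hb.cond hc (const false)).of_eq fun a => by cases b a <;> rfl

@[fun_prop]
theorem xor {b c : α → Bool} (hb : PolyTime b) (hc : PolyTime c) : PolyTime fun a => b a ^^ c a :=
  (hb.cond hc.not hc).of_eq fun a => by cases b a <;> simp

/-- The elements of a list without repetitions. -/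
def _root_.List.distinct {α : Type} [DecidableEq α] (l : List α) : List α :=
  l.foldl (fun r x => if x ∈ r then r else x :: r) []

theorem _root_.List.nodup_distinct_and {α : Type} [DecidableEq α] (l : List α) :
    l.distinct.Nodup ∧ ∀ x, x ∈ l.distinct ↔ x ∈ l := by
  suffices ∀ r : List α, r.Nodup → (l.foldl (fun r x => if x ∈ r then r else x :: r) r).Nodup ∧
      ∀ x, x ∈ l.foldl (fun r x => if x ∈ r then r else x :: r) r ↔ x ∈ l ∨ x ∈ r by
    simpa [List.distinct] using this [] (by simp)
  induction l with
  | nil => simp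
  | cons y l ih =>
    intro r hr
    by_cases hy : y ∈ r
    · simp only [List.foldl_cons, if_pos hy]
      refine ⟨(ih r hr).1, fun x => ?_⟩
      rw [(ih r hr).2]
      simp only [List.mem_cons]
      constructor
      · tauto
      · rintro ((rfl | h) | h) <;> tauto
    · simp only [List.foldl_cons, if_neg hy]
      have := ih (y :: r) (by simp [hr, hy])
      refine ⟨this.1, fun x => ?_⟩
      rw [this.2]
      simp only [List.mem_cons]
      tauto

@[fun_prop]
theorem distinct [DecidableEq β] {l : α → List β} (hl : PolyTime l) :
    PolyTime fun a => (l a).distinct := by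
  obtain ⟨q, hq⟩ := hl.size_le
  refine foldl_of_add (f := fun _ r x => if x ∈ r then r else x :: r) (i := fun _ => [])
    (by fun_prop) (by fun_prop) hl (q + 1) fun c b x hx => ?_
  have := sz_le_of_mem hx
  have := hq c
  split_ifs
  · simp
  · simp [sz_cons]; omega

/-- Looks up a key in an association list. -/
def _root_.List.find {α β : Type} [DecidableEq α] (l : List (α × β)) (a : α) : Option β :=
  (l.filterMap fun p => if p.1 = a then some p.2 else none).head?

@[fun_prop]
theorem find [DecidableEq β] {l : α → List (β × γ)} {f : α → β} (hl : PolyTime l)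
    (hf : PolyTime f) : PolyTime fun a => (l a).find (f a) := by
  unfold List.find
  fun_prop

-- The result is defined iff it is so for all entries, and then it is what `filterMap` collects.
@[fun_prop]
theorem mapM {l : α → List β} {f : α → β → Option γ} (hl : PolyTime l)
    (hf : PolyTime fun p : α × β => f p.1 p.2) : PolyTime fun a => (l a).mapM (f a) := by
  classical
  refine (ite (p := fun a => ForallMem (l a) fun x => (f a x).isSome = true)
    (f := fun a => some ((l a).filterMap (f a))) (g := fun _ => none) (by fun_prop)
    (by fun_prop) (by fun_prop)).of_eq fun a => ?_
  induction l a with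
  | nil => simp [ForallMem]
  | cons x l ih =>
    rw [List.mapM_cons, ← ih]
    cases h : f a x with
    | none => simp [ForallMem, h]
    | some y =>
      by_cases h' : ForallMem l fun x => (f a x).isSome = true
      · rw [if_pos h', if_pos (by simpa [ForallMem, h] using h')]
        simp [h]
      · rw [if_neg h', if_neg (by simpa [ForallMem, h] using h')]
        simp

end PolyTime

end StackProg

/-! ### Arithmetic in polynomial time -/

namespace StackProg

open Function Code

variable {α β γ δ : Type} [Code α] [Code β] [Code γ] [Code δ]

/-- The number with given binary digits, the lowest first. -/
def ofBits (l : List Bool) : ℕ := l.foldr Nat.bit 0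

theorem ofBits_cons (b : Bool) (l : List Bool) : ofBits (b :: l) = Nat.bit b (ofBits l) := rfl

/-- Prepends a digit, without producing a leading zero. -/
def consBit (b : Bool) (l : List Bool) : List Bool := if b = false ∧ l = [] then [] else b :: l

theorem bits_bit (b : Bool) (n : ℕ) : (Nat.bit b n).bits = consBit b n.bits := by
  by_cases h : n = 0 ∧ b = false
  · obtain ⟨rfl, rfl⟩ := h
    simp [consBit]
  · rw [Nat.bits_append_bit]
    · have : ¬ (b = false ∧ n.bits = []) := by
        rintro ⟨rfl, h'⟩
        have := congrArg List.length h'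
        rw [Nat.size_eq_bits_len] at this
        exact h ⟨Nat.size_eq_zero.1 this, rfl⟩
      rw [consBit, if_neg this]
    · rintro rfl
      simpa using h

@[simp]
theorem ofBits_bits (n : ℕ) : ofBits n.bits = n := by
  induction n using Nat.binaryRec' with
  | zero => simp [ofBits]
  | bit b n h ih => rw [Nat.bits_append_bit _ _ h, ofBits_cons, ih]

theorem PolyTime.consBit {f : α → Bool} {g : α → List Bool} (hf : PolyTime f) (hg : PolyTime g) :
    PolyTime fun a => StackProg.consBit (f a) (g a) := by
  unfold StackProg.consBit
  fun_prop

/-- The digits are read from the highest one down, and `consBit` discards zeros until the first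
nonzero digit has appeared. -/
theorem PolyTime.normBits : PolyTime fun l : List Bool => (ofBits l).bits := by
  refine (PolyTime.foldl_of_add (f := fun _ r x => StackProg.consBit x r) (i := fun _ => [])
    (l := fun l => l.reverse) (.consBit (by fun_prop) (by fun_prop)) (by fun_prop) (by fun_prop) 6
    fun c b x _ => ?_).of_eq fun l => ?_
  · have := sz_bool x
    unfold StackProg.consBit
    split_ifs with h
    · simp [h.2]
    · simp [sz_cons]; omega
  · rw [List.foldl_reverse]
    induction l with
    | nil => rfl
    | cons b l ih => rw [List.foldr_cons, ih, ofBits_cons, bits_bit]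

instance : Code ℕ := .ofRetract Nat.bits ofBits ofBits_bits PolyTime.normBits

/-- Each binary digit contributes five for its truth value and one for the list node. -/
theorem sz_nat (n : ℕ) : sz n = 6 * n.size + 1 := by
  change sz n.bits = _
  rw [← Nat.size_eq_bits_len]
  induction n.bits with
  | nil => rfl
  | cons b l ih => rw [sz_cons, ih, sz_bool, List.length_cons]; omega

theorem sz_nat_add_le (m n : ℕ) : sz (m + n) ≤ sz m + sz n + 6 := by
  have : (m + n).size ≤ m.size + n.size + 1 := by
    rw [Nat.size_le]
    have h₁ := Nat.lt_size_self m
    have h₂ := Nat.lt_size_self n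
    have h₃ : 2 ^ m.size ≤ 2 ^ (m.size + n.size) := Nat.pow_le_pow_right (by simp) (by simp)
    have h₄ : 2 ^ n.size ≤ 2 ^ (m.size + n.size) := Nat.pow_le_pow_right (by simp) (by simp)
    rw [pow_succ]; omega
  simp only [sz_nat]; omega

theorem sz_nat_mono {m n : ℕ} (h : m ≤ n) : sz m ≤ sz n := by
  have := Nat.size_le_size h
  simp only [sz_nat]; omega

theorem sz_nat_mul_le (m n : ℕ) : sz (m * n) ≤ sz m + sz n := by
  have : (m * n).size ≤ m.size + n.size := by
    rw [Nat.size_le, pow_add]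
    exact Nat.mul_lt_mul'' (Nat.lt_size_self m) (Nat.lt_size_self n)
  simp only [sz_nat]; omega

theorem sz_bit_le (b : Bool) (n : ℕ) : sz (Nat.bit b n) ≤ sz n + 6 := by
  have : (Nat.bit b n).size ≤ n.size + 1 := by
    rw [Nat.size_le, pow_succ]
    have := Nat.lt_size_self n
    cases b <;> simp [Nat.bit_val] <;> omega
  simp only [sz_nat]; omega

namespace PolyTime

@[fun_prop]
theorem bits {f : α → ℕ} (hf : PolyTime f) : PolyTime fun a => (f a).bits :=
  (Code.polyTime_to Nat.bits ofBits ofBits_bits normBits).comp hf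

@[fun_prop]
theorem ofBits {f : α → List Bool} (hf : PolyTime f) : PolyTime fun a => StackProg.ofBits (f a) :=
  (Code.polyTime_of Nat.bits StackProg.ofBits ofBits_bits normBits).comp hf

@[fun_prop]
theorem natBit {f : α → Bool} {g : α → ℕ} (hf : PolyTime f) (hg : PolyTime g) :
    PolyTime fun a => Nat.bit (f a) (g a) :=
  (ofBits (hf.cons hg.bits)).of_eq fun a => by rw [ofBits_cons, ofBits_bits]

/-- The number whose digits, the highest first, follow those of `n`. -/
def _root_.StackProg.pushBits (n : ℕ) (l : List Bool) : ℕ := l.foldl (fun n b => Nat.bit b n) n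

@[fun_prop]
theorem pushBits {f : α → ℕ} {g : α → List Bool} (hf : PolyTime f) (hg : PolyTime g) :
    PolyTime fun a => StackProg.pushBits (f a) (g a) :=
  foldl_of_add (f := fun _ n b => Nat.bit b n) (by fun_prop) hf hg 6 fun c n b _ => by
    simpa using sz_bit_le b n

/-- One step of the addition of two numbers: the carry, the remaining digits and the result. -/
def _root_.StackProg.addStep (s : Bool × List Bool × List Bool × List Bool) :
    Bool × List Bool × List Bool × List Bool :=
  let x := s.2.1.head?.getD false
  let y := s.2.2.1.head?.getD false
  (bif x then y || s.1 else y && s.1, s.2.1.tail, s.2.2.1.tail, ((x ^^ y) ^^ s.1) :: s.2.2.2)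

/-- One step of the subtraction of two numbers: the borrow, the remaining digits and the result. -/
def _root_.StackProg.subStep (s : Bool × List Bool × List Bool × List Bool) :
    Bool × List Bool × List Bool × List Bool :=
  let x := s.2.1.head?.getD false
  let y := s.2.2.1.head?.getD false
  (bif x then y && s.1 else y || s.1, s.2.1.tail, s.2.2.1.tail, ((x ^^ y) ^^ s.1) :: s.2.2.2)

end PolyTime

theorem ofBits_eq_head (l : List Bool) :
    ofBits l = 2 * ofBits l.tail + (l.head?.getD false).toNat := by
  cases l with
  | nil => rfl
  | cons b l => simp [ofBits_cons, Nat.bit_val]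

theorem pushBits_cons (n : ℕ) (b : Bool) (l : List Bool) :
    pushBits n (b :: l) = pushBits (Nat.bit b n) l := rfl

/-- The value represented by a state of the addition. -/
def addValue (s : Bool × List Bool × List Bool × List Bool) : ℕ :=
  pushBits (s.1.toNat + ofBits s.2.1 + ofBits s.2.2.1) s.2.2.2

/-- The carry plus the remaining numbers, followed by the digits already produced, always denote the
same number; a step of the full adder only moves the lowest digit of the sum across. -/
theorem addValue_addStep (s) : addValue (addStep s) = addValue s := by
  obtain ⟨c, l, l', r⟩ := s
  simp only [addValue, addStep, pushBits_cons]
  rw [ofBits_eq_head l, ofBits_eq_head l']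
  congr 1
  rw [Nat.bit_val]
  cases c <;> cases l.head?.getD false <;> cases l'.head?.getD false <;> simp <;> ring

/-- The value represented by a state of the subtraction. -/
def subValue (s : Bool × List Bool × List Bool × List Bool) : ℤ :=
  s.2.2.2.foldl (fun z b => 2 * z + b.toNat) (ofBits s.2.1 - ofBits s.2.2.1 - s.1.toNat)

/-- The invariant is an integer, since the remaining difference less the borrow may be negative. -/
theorem subValue_subStep (s) : subValue (subStep s) = subValue s := by
  obtain ⟨c, l, l', r⟩ := s
  simp only [subValue, subStep, List.foldl_cons]
  rw [ofBits_eq_head l, ofBits_eq_head l']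
  congr 1
  cases c <;> cases l.head?.getD false <;> cases l'.head?.getD false <;> simp <;> ring

theorem foldl_tail (f : Bool × List Bool × List Bool × List Bool →
    Bool × List Bool × List Bool × List Bool) (h₁ : ∀ s, (f s).2.1 = s.2.1.tail)
    (h₂ : ∀ s, (f s).2.2.1 = s.2.2.1.tail) (k : List Bool) (s) :
    (k.foldl (fun s _ => f s) s).2.1 = s.2.1.drop k.length ∧
      (k.foldl (fun s _ => f s) s).2.2.1 = s.2.2.1.drop k.length := by
  induction k generalizing s with
  | nil => simp
  | cons x k ih => simp [ih, h₁, h₂]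

/-- The state after the addition of two numbers. -/
def addRun (m n : ℕ) : Bool × List Bool × List Bool × List Bool :=
  (m.bits ++ n.bits).foldl (fun s _ => addStep s) (false, m.bits, n.bits, [])

/-- The state after the subtraction of two numbers. -/
def subRun (m n : ℕ) : Bool × List Bool × List Bool × List Bool :=
  (m.bits ++ n.bits).foldl (fun s _ => subStep s) (false, m.bits, n.bits, [])

theorem foldl_invariant {σ τ : Type} (f : σ → σ) (v : σ → τ) (h : ∀ s, v (f s) = v s)
    (l : List Bool) (s : σ) : v (l.foldl (fun s _ => f s) s) = v s := by
  induction l generalizing s with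
  | nil => rfl
  | cons x l ih => rw [List.foldl_cons, ih, h]

/-- The list `m.bits ++ n.bits` is merely a clock, long enough for both numbers to be used up. What
is left is the carry in front of the digits, stored with the highest one first as `pushBits` reads
them. -/
theorem addRun_eq (m n : ℕ) : pushBits (addRun m n).1.toNat (addRun m n).2.2.2 = m + n := by
  have h₁ : addValue (addRun m n) = m + n := by
    rw [addRun, foldl_invariant _ _ addValue_addStep]
    simp [addValue, pushBits]
  obtain ⟨h₂, h₃⟩ := foldl_tail addStep (fun _ => rfl) (fun _ => rfl) (m.bits ++ n.bits)
    (false, m.bits, n.bits, [])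
  rw [← addRun] at h₂ h₃
  rw [List.drop_eq_nil_of_le (by simp)] at h₂ h₃
  rw [← h₁, addValue, h₂, h₃]
  simp [ofBits]

theorem foldl_eq_pushBits (n : ℕ) (l : List Bool) :
    l.foldl (fun z b => 2 * z + (b.toNat : ℤ)) n = pushBits n l := by
  induction l generalizing n with
  | nil => rfl
  | cons b l ih =>
    rw [List.foldl_cons, pushBits_cons, ← ih, Nat.bit_val]
    push_cast
    rfl

theorem foldl_neg (l : List Bool) (z : ℤ) (hz : z < 0) :
    l.foldl (fun z b => 2 * z + (b.toNat : ℤ)) z < 0 := by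
  induction l generalizing z with
  | nil => exact hz
  | cons b l ih => exact ih _ (by cases b <;> simp <;> omega)

/-- In the end only the borrow is left. Without a borrow the digits are those of the difference.
With a borrow the value starts at `-1`, and appending digits keeps it negative by `foldl_neg`. -/
theorem subRun_eq (m n : ℕ) : ((subRun m n).1 = true ↔ m < n) ∧
    ((subRun m n).1 = false → pushBits 0 (subRun m n).2.2.2 = m - n) := by
  have h₁ : subValue (subRun m n) = m - n := by
    rw [subRun, foldl_invariant _ _ subValue_subStep]
    simp [subValue]
  obtain ⟨h₂, h₃⟩ := foldl_tail subStep (fun _ => rfl) (fun _ => rfl) (m.bits ++ n.bits)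
    (false, m.bits, n.bits, [])
  rw [← subRun] at h₂ h₃
  rw [List.drop_eq_nil_of_le (by simp)] at h₂ h₃
  rw [subValue, h₂, h₃] at h₁
  cases h : (subRun m n).1
  · have h₄ := foldl_eq_pushBits 0 (subRun m n).2.2.2
    simp [h, ofBits] at h₁ h₄ ⊢
    omega
  · have h₄ := foldl_neg (subRun m n).2.2.2 (-1) (by simp)
    simp [h, ofBits] at h₁ h₄ ⊢
    omega

namespace PolyTime

@[fun_prop]
theorem or {b c : α → Bool} (hb : PolyTime b) (hc : PolyTime c) : PolyTime fun a => b a || c a :=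
  (hb.cond (const true) hc).of_eq fun a => by cases b a <;> rfl

theorem addStep : PolyTime StackProg.addStep := by
  unfold StackProg.addStep
  fun_prop

theorem subStep : PolyTime StackProg.subStep := by
  unfold StackProg.subStep
  fun_prop

theorem sz_tail_le (l : List β) : sz l.tail ≤ sz l := by
  cases l with
  | nil => simp
  | cons b l => rw [List.tail_cons, sz_cons]; omega

theorem addRun {f g : α → ℕ} (hf : PolyTime f) (hg : PolyTime g) :
    PolyTime fun a => StackProg.addRun (f a) (g a) := by
  refine foldl_of_add (f := fun _ s _ => StackProg.addStep s) (addStep.comp (by fun_prop))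
    (by fun_prop) (by fun_prop) 6 fun c s x _ => ?_
  obtain ⟨b, l, l', r⟩ := s
  have := sz_tail_le l
  have := sz_tail_le l'
  simp [StackProg.addStep, sz_prod, sz_bool, sz_cons]; omega

theorem subRun {f g : α → ℕ} (hf : PolyTime f) (hg : PolyTime g) :
    PolyTime fun a => StackProg.subRun (f a) (g a) := by
  refine foldl_of_add (f := fun _ s _ => StackProg.subStep s) (subStep.comp (by fun_prop))
    (by fun_prop) (by fun_prop) 6 fun c s x _ => ?_
  obtain ⟨b, l, l', r⟩ := s
  have := sz_tail_le l
  have := sz_tail_le l'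
  simp [StackProg.subStep, sz_prod, sz_bool, sz_cons]; omega

@[fun_prop]
theorem natAdd {f g : α → ℕ} (hf : PolyTime f) (hg : PolyTime g) :
    PolyTime fun a => f a + g a :=
  (pushBits
    ((of_finite' Bool.toNat).comp (fst.comp (addRun hf hg)))
    (snd.comp (snd.comp (snd.comp (addRun hf hg))))).of_eq fun _ => addRun_eq _ _

end PolyTime

@[fun_prop]
theorem PolyPred.natLt {f g : α → ℕ} (hf : PolyTime f) (hg : PolyTime g) :
    PolyPred fun a => f a < g a :=
  (PolyPred.of_bool (PolyTime.fst.comp (PolyTime.subRun hf hg))).of_iff fun _ =>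
    (subRun_eq _ _).1

@[fun_prop]
theorem PolyPred.natLe {f g : α → ℕ} (hf : PolyTime f) (hg : PolyTime g) :
    PolyPred fun a => f a ≤ g a :=
  (PolyPred.not (natLt hg hf)).of_iff fun _ => not_lt

namespace PolyTime

@[fun_prop]
theorem natSub {f g : α → ℕ} (hf : PolyTime f) (hg : PolyTime g) :
    PolyTime fun a => f a - g a :=
  (ite (p := fun a => f a < g a) (by fun_prop) (const 0) (pushBits (const 0)
    (snd.comp (snd.comp (snd.comp (subRun hf hg)))))).of_eq fun a => by
    obtain ⟨h₁, h₂⟩ := subRun_eq (f a) (g a)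
    split_ifs with h
    · omega
    · have := h₂ (by rw [← Bool.not_eq_true, h₁]; exact h)
      omega

-- Horner's scheme on the digits of `f a`. In the growth bound, `13` stands for the doubling, the
-- possible carry of the addition and the size of zero.
@[fun_prop]
theorem natMul {f g : α → ℕ} (hf : PolyTime f) (hg : PolyTime g) :
    PolyTime fun a => f a * g a := by
  obtain ⟨q, hq⟩ := hg.size_le
  refine (foldl_of_add (f := fun a r b => Nat.bit false r + bif b then g a else 0)
    (i := fun _ => 0) (l := fun a => (f a).bits.reverse) (by fun_prop) (by fun_prop) (by fun_prop)
    (q + 13) fun c r b _ => ?_).of_eq fun a => ?_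
  · have h₁ := sz_nat_add_le (Nat.bit false r) (bif b then g c else 0)
    have h₂ := sz_bit_le false r
    have h₃ := hq c
    have h₄ : sz 0 = 1 := rfl
    simp only [Polynomial.eval_add, Polynomial.eval_ofNat]
    cases b <;> simp only [cond_true, cond_false] at h₁ ⊢ <;> omega
  · rw [List.foldl_reverse]
    conv_rhs => rw [← ofBits_bits (f a)]
    induction (f a).bits with
    | nil => simp [StackProg.ofBits]
    | cons b l ih =>
      rw [List.foldr_cons, ih, ofBits_cons, Nat.bit_val, Nat.bit_val]
      cases b <;> simp <;> ring

/-- One step of long division by `d`: quotient and remainder. -/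
def _root_.StackProg.divStep (d : ℕ) (s : ℕ × ℕ) (b : Bool) : ℕ × ℕ :=
  if Nat.bit b s.2 < d then (Nat.bit false s.1, Nat.bit b s.2)
  else (Nat.bit true s.1, Nat.bit b s.2 - d)

-- Long division: the number formed by the digits read so far is quotient times divisor plus
-- remainder, with the remainder below the divisor. For divisor zero this invariant fails at the
-- start, so that case is treated apart.
@[fun_prop]
theorem natDiv {f g : α → ℕ} (hf : PolyTime f) (hg : PolyTime g) :
    PolyTime fun a => f a / g a := by
  have H : PolyTime fun a => ((f a).bits.reverse).foldl (divStep (g a)) (0, 0) := by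
    refine foldl_of_add (f := fun a => divStep (g a)) (i := fun _ => (0, 0))
      (l := fun a => (f a).bits.reverse) ?_ (by fun_prop) (by fun_prop) 12 fun c r b _ => ?_
    · unfold divStep
      fun_prop
    · have h₁ := sz_bit_le false r.1
      have h₂ := sz_bit_le true r.1
      have h₃ := sz_bit_le b r.2
      have h₄ : sz r = sz r.1 + sz r.2 + 1 := rfl
      have h₅ := sz_nat_mono (Nat.sub_le (Nat.bit b r.2) (g c))
      unfold divStep
      split_ifs <;> simp only [sz_prod, Polynomial.eval_ofNat] <;> omega
  refine (ite (p := fun a => g a = 0) (by fun_prop) (const 0) (fst.comp H)).of_eq fun a => ?_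
  split_ifs with h
  · simp [h]
  · rw [List.foldl_reverse]
    suffices ∀ l : List Bool, let s := l.foldr (fun b s => divStep (g a) s b) (0, 0)
        StackProg.ofBits l = s.1 * g a + s.2 ∧ s.2 < g a by
      obtain ⟨h₁, h₂⟩ := this (f a).bits
      rw [ofBits_bits] at h₁
      generalize (f a).bits.foldr (fun b s => divStep (g a) s b) (0, 0) = s at h₁ h₂ ⊢
      rw [h₁, mul_comm, Nat.mul_add_div (by omega), Nat.div_eq_of_lt h₂, add_zero]
    intro l
    induction l with
    | nil => simp [StackProg.ofBits]; omega
    | cons b l ih =>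
      obtain ⟨h₁, h₂⟩ := ih
      rw [List.foldr_cons]
      generalize l.foldr (fun b s => divStep (g a) s b) (0, 0) = s at *
      obtain ⟨x, y⟩ := s
      simp only at h₁ h₂
      simp only [divStep, ofBits_cons, h₁, Nat.bit_val]
      split_ifs with h₃
      · refine ⟨?_, h₃⟩
        simp; ring
      · refine ⟨?_, ?_⟩
        · simp; ring_nf at h₃ ⊢; omega
        · have : b.toNat ≤ 1 := Bool.toNat_le b
          simp; omega

end PolyTime

end StackProg

/-! ### Integers, sums and lexicographic comparison in polynomial time -/

namespace StackProg

open Function Code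

variable {α β γ δ : Type} [Code α] [Code β] [Code γ] [Code δ]

/-- The integer with given sign and absolute value. -/
def ofSign (p : Bool × ℕ) : ℤ := bif p.1 then -p.2 else p.2

/-- The sign and the absolute value of an integer. -/
def toSign (z : ℤ) : Bool × ℕ := (decide (z < 0), z.natAbs)

theorem decide_natCast_neg (n : ℕ) : decide ((n : ℤ) < 0) = false := decide_eq_false (by omega)

theorem decide_negSucc_neg (n : ℕ) : decide (Int.negSucc n < 0) = true :=
  decide_eq_true (Int.negSucc_lt_zero n)

theorem ofSign_toSign (z : ℤ) : ofSign (toSign z) = z := by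
  rcases z with n | n
  · simp [ofSign, toSign, decide_natCast_neg]
  · simp only [ofSign, toSign, decide_negSucc_neg, cond_true, Int.natAbs_negSucc]; omega

/-- Sign and absolute value are ambiguous only at zero, where a negative sign is dropped. -/
theorem PolyTime.normSign : PolyTime fun p : Bool × ℕ => toSign (ofSign p) :=
  (PolyTime.prodMk (f := fun p : Bool × ℕ => p.1 && !decide (p.2 = 0)) (g := fun p => p.2)
    (by fun_prop) (by fun_prop)).of_eq fun p => by
    obtain ⟨s, n⟩ := p
    cases s
    · exact Prod.ext (decide_natCast_neg n).symm rfl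
    · simp [ofSign, toSign, Nat.pos_iff_ne_zero]

instance : Code ℤ := .ofRetract toSign ofSign ofSign_toSign PolyTime.normSign

theorem sz_int (z : ℤ) : sz z = sz z.natAbs + 6 := by
  change sz (toSign z) = _
  rw [toSign, sz_prod, sz_bool]; omega

/-- No extra term is needed: there are two signs on the right and one on the left, and the surplus
pays for a carry. -/
theorem sz_int_add_le (x y : ℤ) : sz (x + y) ≤ sz x + sz y := by
  simp only [sz_int]
  have h₁ := sz_nat_mono (Int.natAbs_add_le x y)
  have h₂ := sz_nat_add_le x.natAbs y.natAbs
  omega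

theorem sz_int_mul_le (x y : ℤ) : sz (x * y) ≤ sz x + sz y := by
  simp only [sz_int, Int.natAbs_mul]
  have h₂ := sz_nat_mul_le x.natAbs y.natAbs
  omega

theorem sz_int_tdiv_le (x y : ℤ) : sz (x.tdiv y) ≤ sz x := by
  simp only [sz_int, Int.natAbs_tdiv]
  exact Nat.add_le_add_right (sz_nat_mono (Nat.div_le_self x.natAbs y.natAbs)) 6

@[simp] theorem sz_int_neg (x : ℤ) : sz (-x) = sz x := by simp [sz_int]

@[simp] theorem sz_int_abs (x : ℤ) : sz |x| = sz x := by simp only [sz_int, Int.natAbs_abs]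

namespace PolyTime

@[fun_prop]
theorem toSign : PolyTime StackProg.toSign := Code.polyTime_to _ _ ofSign_toSign normSign

@[fun_prop]
theorem ofSign : PolyTime StackProg.ofSign := Code.polyTime_of _ _ ofSign_toSign normSign

@[fun_prop]
theorem natAbs {f : α → ℤ} (hf : PolyTime f) : PolyTime fun a => (f a).natAbs :=
  (snd.comp (toSign.comp hf)).of_eq fun _ => rfl

end PolyTime

@[fun_prop]
theorem PolyPred.intNeg {f : α → ℤ} (hf : PolyTime f) : PolyPred fun a => f a < 0 :=
  (PolyPred.of_bool (PolyTime.fst.comp (PolyTime.toSign.comp hf))).of_iff fun _ => by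
    simp [toSign]

namespace PolyTime

@[fun_prop]
theorem natCast {f : α → ℕ} (hf : PolyTime f) : PolyTime fun a => (f a : ℤ) :=
  (ofSign.comp ((const false).prodMk hf)).of_eq fun _ => rfl

@[fun_prop]
theorem intNeg {f : α → ℤ} (hf : PolyTime f) : PolyTime fun a => -f a :=
  (ofSign.comp (prodMk (f := fun a => !decide (f a < 0)) (by fun_prop) hf.natAbs)).of_eq fun a => by
    by_cases h : f a < 0 <;> simp [h, StackProg.ofSign] <;> omega

-- For equal signs the absolute values are added; otherwise the smaller is subtracted from the
-- larger, whose sign is kept.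
@[fun_prop]
theorem intAdd {f g : α → ℤ} (hf : PolyTime f) (hg : PolyTime g) :
    PolyTime fun a => f a + g a := by
  refine (ite (p := fun a => decide (f a < 0) = decide (g a < 0))
    (f := fun a => StackProg.ofSign (decide (f a < 0), (f a).natAbs + (g a).natAbs))
    (g := fun a => if (f a).natAbs < (g a).natAbs then
      StackProg.ofSign (decide (g a < 0), (g a).natAbs - (f a).natAbs) else
      StackProg.ofSign (decide (f a < 0), (f a).natAbs - (g a).natAbs))
    (by fun_prop) (by fun_prop) (by fun_prop)).of_eq fun a => ?_
  by_cases h₁ : f a < 0 <;> by_cases h₂ : g a < 0 <;> simp only [h₁, h₂, StackProg.ofSign,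
    decide_true, decide_false, if_true, if_false, reduceCtorEq, cond_true, cond_false] <;>
    (try split_ifs) <;> omega

@[fun_prop]
theorem intSub {f g : α → ℤ} (hf : PolyTime f) (hg : PolyTime g) :
    PolyTime fun a => f a - g a :=
  (intAdd hf hg.intNeg).of_eq fun _ => (sub_eq_add_neg _ _).symm

@[fun_prop]
theorem intMul {f g : α → ℤ} (hf : PolyTime f) (hg : PolyTime g) :
    PolyTime fun a => f a * g a := by
  refine (ofSign.comp (prodMk (f := fun a => decide (f a < 0) ^^ decide (g a < 0))
    (g := fun a => (f a).natAbs * (g a).natAbs) (by fun_prop) (by fun_prop))).of_eq fun a => ?_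
  generalize f a = x, g a = y
  rcases x with m | m <;> rcases y with n | n <;>
    simp only [StackProg.ofSign, Int.ofNat_eq_natCast, decide_negSucc_neg, decide_natCast_neg,
      Int.natAbs_negSucc, Int.natAbs_natCast, Bool.xor_false, Bool.xor_true, Bool.not_false, Bool.not_true,
      cond_true, cond_false] <;> (try simp only [Int.negSucc_eq]) <;> push_cast <;> ring

-- Truncation makes the absolute value of the quotient the quotient of the absolute values, so the
-- sign can be computed separately.
@[fun_prop]
theorem intTdiv {f g : α → ℤ} (hf : PolyTime f) (hg : PolyTime g) :
    PolyTime fun a => (f a).tdiv (g a) := by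
  refine (ofSign.comp (prodMk (f := fun a => decide (f a < 0) ^^ decide (g a < 0))
    (g := fun a => (f a).natAbs / (g a).natAbs) (by fun_prop) (by fun_prop))).of_eq fun a => ?_
  generalize f a = x, g a = y
  rcases x with m | m <;> rcases y with n | n <;>
    simp only [StackProg.ofSign, Int.ofNat_eq_natCast, decide_negSucc_neg, decide_natCast_neg,
      Int.natAbs_negSucc, Int.natAbs_natCast, Bool.xor_false, Bool.xor_true, Bool.not_false, Bool.not_true,
      cond_true, cond_false] <;>
    (try simp only [Int.negSucc_eq, Int.neg_tdiv, Int.tdiv_neg, neg_neg]) <;> rfl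

@[fun_prop]
theorem intAbs {f : α → ℤ} (hf : PolyTime f) : PolyTime fun a => |f a| :=
  (natCast (natAbs hf)).of_eq fun a => by simp

end PolyTime

@[fun_prop]
theorem PolyPred.intLt {f g : α → ℤ} (hf : PolyTime f) (hg : PolyTime g) :
    PolyPred fun a => f a < g a :=
  (PolyPred.intNeg (hf.intSub hg)).of_iff fun _ => sub_neg

/-! ### Lengths, sums and lexicographic comparison -/

namespace PolyTime

@[fun_prop]
theorem length {l : α → List β} (hl : PolyTime l) : PolyTime fun a => (l a).length := by
  refine (foldl_of_add (f := fun _ n _ => n + 1) (i := fun _ => 0) (by fun_prop) (by fun_prop) hl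
    13 fun c n x _ => ?_).of_eq fun a => ?_
  · have h : sz 1 = 7 := rfl
    have := sz_nat_add_le n 1
    simp; omega
  · have (l : List β) (n : ℕ) : l.foldl (fun n _ => n + 1) n = n + l.length := by
      induction l generalizing n with
      | nil => rfl
      | cons x l ih => rw [List.foldl_cons, ih, List.length_cons]; omega
    simp [this]

@[fun_prop]
theorem intSum {l : α → List ℤ} (hl : PolyTime l) : PolyTime fun a => (l a).sum := by
  obtain ⟨q, hq⟩ := hl.size_le
  refine (foldl_of_add (f := fun _ n x => n + x) (i := fun _ => 0) (by fun_prop) (by fun_prop) hl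
    q fun c n x hx => ?_).of_eq fun a => List.sum_eq_foldl.symm
  have := sz_int_add_le n x
  have := sz_le_of_mem hx
  have := hq c
  omega

/-- One step of the lexicographic comparison of two words: what remains of the second one, and
the result. -/
def _root_.StackProg.lexStep (s : List Bool × Option Bool) (x : Bool) : List Bool × Option Bool :=
  s.2.elim (s.1.elim' ([], some false) fun y l => if x = y then (l, none) else (l, some (!x && y)))
    fun b => (s.1, some b)

end PolyTime

theorem foldl_lexStep_some (l l' : List Bool) (b : Bool) :
    l.foldl lexStep (l', some b) = (l', some b) := by
  induction l with
  | nil => rfl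
  | cons x l ih => exact ih

/-- If the first word ends undecided, it is a prefix of the second one, and it is smaller iff
something of the second one is left. -/
theorem foldl_lexStep (l l' : List Bool) :
    ((l.foldl lexStep (l', none)).2.getD (decide ((l.foldl lexStep (l', none)).1 ≠ [])) = true) ↔
      l < l' := by
  induction l generalizing l' with
  | nil => cases l' <;> simp
  | cons x l ih =>
    rw [List.foldl_cons]
    cases l' with
    | nil =>
      have : lexStep ([], none) x = ([], some false) := rfl
      simp [this, foldl_lexStep_some]
    | cons y l' =>
      by_cases h : x = y
      · have : lexStep (y :: l', none) x = (l', none) := by simp [lexStep, List.elim', h]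
        rw [this, ih, h, List.cons_lt_cons_iff]
        simp
      · have : lexStep (y :: l', none) x = (l', some (!x && y)) := by simp [lexStep, List.elim', h]
        rw [this, foldl_lexStep_some, List.cons_lt_cons_iff]
        cases x <;> cases y <;> simp_all

@[fun_prop]
theorem PolyPred.lexLt {f g : α → List Bool} (hf : PolyTime f) (hg : PolyTime g) :
    PolyPred fun a => f a < g a := by
  have H : PolyTime fun a => (f a).foldl lexStep (g a, none) := by
    refine PolyTime.foldl_of_add (f := fun _ => lexStep) (i := fun a => (g a, none)) ?_
      (by fun_prop) hf 10 fun c s x _ => ?_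
    · unfold lexStep
      fun_prop
    · obtain ⟨l, o⟩ := s
      rcases o with _ | b
      · rcases l with _ | ⟨y, l⟩
        · simp [lexStep, List.elim', sz_prod, sz_some, sz_none, sz_bool, sz_nil]
        · simp only [lexStep, List.elim', Option.elim]
          split_ifs <;> simp [sz_prod, sz_some, sz_none, sz_bool, sz_cons] <;> omega
      · simp [lexStep]
  exact (PolyPred.of_bool (PolyTime.getD (PolyTime.snd.comp H)
    (PolyTime.of_pred (PolyPred.not (PolyPred.eq (PolyTime.fst.comp H) (PolyTime.const [])))))).of_iff
    fun a => foldl_lexStep _ _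

end StackProg

/-! ### Codes of the syntax -/

namespace StackProg

open Function Code

variable {α β γ δ : Type} [Code α] [Code β] [Code γ] [Code δ]

/-- The code of an equivalent type. -/
@[reducible]
def Code.ofEquiv {α : Type} (e : α ≃ β) : Code α :=
  .ofRetract e e.symm e.symm_apply_apply (PolyTime.id'.of_eq fun b => by simp)

theorem PolyTime.equiv {α : Type} (e : α ≃ β) : @PolyTime _ _ (ofEquiv e) _ e :=
  Code.polyTime_to _ _ _ _

theorem PolyTime.equiv_symm {α : Type} (e : α ≃ β) : @PolyTime _ _ _ (ofEquiv e) e.symm :=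
  Code.polyTime_of _ _ _ _

@[fun_prop]
theorem PolyPred.sum_elim {o : α → β ⊕ γ} {p : α → β → Prop} {q : α → γ → Prop} (ho : PolyTime o)
    (hp : PolyPred fun x : α × β => p x.1 x.2) (hq : PolyPred fun x : α × γ => q x.1 x.2) :
    PolyPred fun a => (o a).elim (p a) (q a) := by
  classical
  exact polyPred_iff.2 ((PolyTime.sum_elim (f := fun a x => decide (p a x))
    (g := fun a x => decide (q a x)) ho (polyPred_iff.1 hp) (polyPred_iff.1 hq)).of_eq
    fun a => by cases o a <;> simp only [Sum.elim_inl, Sum.elim_inr] <;> congr)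

@[fun_prop]
theorem PolyPred.option_elim {o : α → Option β} {p : α → Prop} {q : α → β → Prop} (ho : PolyTime o)
    (hp : PolyPred p) (hq : PolyPred fun x : α × β => q x.1 x.2) :
    PolyPred fun a => (o a).elim (p a) (q a) := by
  classical
  exact polyPred_iff.2 ((PolyTime.option_elim (g := fun a x => decide (q a x)) ho
    (polyPred_iff.1 hp) (polyPred_iff.1 hq)).of_eq
    fun a => by cases o a <;> simp only [Option.elim] <;> congr)

/-- Some value of `o` satisfies `p`. -/
def ExistsSome {β : Type} (o : Option β) (p : β → Prop) : Prop := ∃ x, o = some x ∧ p x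

@[fun_prop]
theorem PolyPred.existsSome {o : α → Option β} {p : α → β → Prop} (ho : PolyTime o)
    (hp : PolyPred fun x : α × β => p x.1 x.2) : PolyPred fun a => ExistsSome (o a) (p a) :=
  (PolyPred.option_elim (p := fun _ => False) ho (.const _) hp).of_iff fun a => by
    cases o a <;> simp [ExistsSome]

/-- Every value of `o` satisfies `p`. -/
def ForallSome {β : Type} (o : Option β) (p : β → Prop) : Prop := ∀ x, o = some x → p x

@[fun_prop]
theorem PolyPred.forallSome {o : α → Option β} {p : α → β → Prop} (ho : PolyTime o)
    (hp : PolyPred fun x : α × β => p x.1 x.2) : PolyPred fun a => ForallSome (o a) (p a) :=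
  (PolyPred.option_elim (p := fun _ => True) ho (.const _) hp).of_iff fun a => by
    cases o a <;> simp [ForallSome]

end StackProg

/-! ### Codes for constants, terms, rules and instances -/

namespace SkASP

open StackProg Code

variable {α β γ δ : Type} [Code α] [Code β] [Code γ] [Code δ]

instance : Finite ArithOp := Set.finite_univ_iff.1
  ((Set.toFinite {.add, .sub, .mul, .div, .dist}).subset (by rintro (_ | _) _ <;> simp))

instance : Finite CmpOp := Set.finite_univ_iff.1
  ((Set.toFinite {.eq, .ne, .lt, .gt, .ge, .le, .top}).subset (by rintro (_ | _) _ <;> simp))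

instance : Finite AggOp := Set.finite_univ_iff.1
  ((Set.toFinite {.max, .min, .count, .sum}).subset (by rintro (_ | _) _ <;> simp))

instance : Inhabited ArithOp := ⟨.add⟩
instance : Inhabited CmpOp := ⟨.eq⟩
instance : Inhabited AggOp := ⟨.max⟩
instance : Inhabited Pred := ⟨⟨[], 0⟩⟩

noncomputable instance : Code ArithOp := .ofFinite _
noncomputable instance : Code CmpOp := .ofFinite _
noncomputable instance : Code AggOp := .ofFinite _
noncomputable instance : Code Computability.Γ' := .ofFinite _

/-- Constants as a sum type. -/
def Const.equiv : Const ≃ ℤ ⊕ Name where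
  toFun
    | .int z => .inl z
    | .sym c => .inr c
  invFun := Sum.elim .int .sym
  left_inv c := by cases c <;> rfl
  right_inv c := by cases c <;> rfl

instance : Code Const := .ofEquiv Const.equiv

/-- Predicates as pairs. -/
def Pred.equiv : Pred ≃ Name × ℕ where
  toFun p := (p.name, p.arity)
  invFun p := ⟨p.1, p.2⟩

instance : Code Pred := .ofEquiv Pred.equiv

/-- Positions that may be sketched as a sum type. -/
def Sk.equiv {α : Type} : Sk α ≃ α ⊕ Name where
  toFun
    | .known a => .inl a
    | .sketched s => .inr s
  invFun := Sum.elim .known .sketched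
  left_inv c := by cases c <;> rfl
  right_inv c := by cases c <;> rfl

instance : Code (Sk α) := .ofEquiv Sk.equiv

/-- Declarations as pairs. -/
def Decl.equiv {α : Type} : Decl α ≃ Name × List (α × ℤ) where
  toFun p := (p.name, p.dom)
  invFun p := ⟨p.1, p.2⟩

instance : Code (Decl α) := .ofEquiv Decl.equiv

/-- Ground atoms as pairs. -/
def GAtom.equiv : GAtom ≃ Pred × List Const where
  toFun p := (p.pred, p.args)
  invFun p := ⟨p.1, p.2⟩

instance : Code GAtom := .ofEquiv GAtom.equiv

/-! Terms are encoded in postfix notation. -/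

/-- The symbols of terms in postfix notation. -/
abbrev Token := Const ⊕ Sk ArithOp

/-- The postfix notation of a term. -/
def Term.tokens : Term → List Token
  | .const c => [.inl c]
  | .op o l r => l.tokens ++ r.tokens ++ [.inr o]

/-- Structural recursion. -/
def Term.fold {β : Type} (f : Const → β) (g : Sk ArithOp → β → β → β) : Term → β
  | .const c => f c
  | .op o l r => g o (l.fold f g) (r.fold f g)

/-- One step of the evaluation of a postfix notation on a stack. -/
def foldStep {β : Type} (f : Const → β) (g : Sk ArithOp → β → β → β) (s : List β) (x : Token) :
    List β :=
  x.elim (fun c => f c :: s) fun o => s.elim' [] fun y s' => s'.elim' [] fun x s => g o x y :: s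

/-- Postfix notation turns recursion over a term into a single fold over a list with a stack as
accumulator, to which the closure of `PolyTime` under folds applies. -/
theorem Term.foldl_tokens {β : Type} (f : Const → β) (g : Sk ArithOp → β → β → β) (t : Term)
    (s : List β) : t.tokens.foldl (foldStep f g) s = t.fold f g :: s := by
  induction t generalizing s with
  | const c => rfl
  | op o l r ihl ihr =>
    rw [tokens, List.foldl_append, List.foldl_append, ihl, ihr]
    rfl

theorem Term.fold_id (t : Term) : t.fold .const .op = t := by
  induction t with
  | const c => rfl
  | op o l r ihl ihr => rw [fold, ihl, ihr]

/-- No well-formedness of `l` is needed: an operator that lacks arguments empties the stack on both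
sides. -/
theorem map_foldl_foldStep {β β' : Type} (h : β → β') (f : Const → β) (g : Sk ArithOp → β → β → β)
    (f' : Const → β') (g' : Sk ArithOp → β' → β' → β') (hf : ∀ c, h (f c) = f' c)
    (hg : ∀ o x y, h (g o x y) = g' o (h x) (h y)) (l : List Token) (s : List β) :
    (l.foldl (foldStep f g) s).map h = l.foldl (foldStep f' g') (s.map h) := by
  induction l generalizing s with
  | nil => rfl
  | cons x l ih =>
    rw [List.foldl_cons, ih, List.foldl_cons]
    congr 1
    rcases x with c | o
    · simp [foldStep, hf]
    · rcases s with _ | ⟨y, _ | ⟨x, s⟩⟩ <;> simp [foldStep, List.elim', hg]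

/-- The measure is the size of the whole stack. By `hq`, an operation replaces two entries by one
that exceeds their sum only by a polynomial in context and operator, so each token adds a bounded
amount. -/
theorem polyTime_foldl_foldStep {f : γ → Const → β} {g : γ → Sk ArithOp → β → β → β}
    {l : γ → List Token} (hf : PolyTime fun p : γ × Const => f p.1 p.2)
    (hg : PolyTime fun p : γ × Sk ArithOp × β × β => g p.1 p.2.1 p.2.2.1 p.2.2.2) (hl : PolyTime l)
    (q : Polynomial ℕ) (hq : ∀ c o x y, sz (g c o x y) ≤ sz x + sz y + q.eval (sz (c, o))) :
    PolyTime fun c => (l c).foldl (foldStep (f c) (g c)) [] := by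
  obtain ⟨u, hu⟩ := hf.size_le
  obtain ⟨v, hv⟩ := hl.size_le
  have hg' : PolyTime fun p : (((γ × List β) × Token) × Sk ArithOp) × β × List β =>
      (p.2.2.elim' ([] : List β) fun x s => g p.1.1.1.1 p.1.2 x p.2.1 :: s) := by
    refine PolyTime.list_elim (o := fun p : (((γ × List β) × Token) × Sk ArithOp) × β × List β => p.2.2)
      (g := fun p x s => g p.1.1.1.1 p.1.2 x p.2.1 :: s) (by fun_prop) (by fun_prop) ?_
    exact PolyTime.cons (hg.comp (g := fun q : ((((γ × List β) × Token) × Sk ArithOp) × β × List β) ×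
      β × List β => (q.1.1.1.1.1, q.1.1.2, q.2.1, q.1.2.1)) (by fun_prop)) (by fun_prop)
  have hs : PolyTime fun p : (γ × List β) × Token => foldStep (f p.1.1) (g p.1.1) p.1.2 p.2 := by
    unfold foldStep
    refine PolyTime.sum_elim (o := fun p : (γ × List β) × Token => p.2)
      (f := fun p c => f p.1.1 c :: p.1.2) (g := fun p o => p.1.2.elim' [] fun y s' =>
        s'.elim' [] fun x s => g p.1.1 o x y :: s) (by fun_prop) ?_ ?_
    · exact PolyTime.cons (hf.comp (g := fun q : ((γ × List β) × Token) × Const => (q.1.1.1, q.2))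
        (by fun_prop)) (by fun_prop)
    · refine PolyTime.list_elim (o := fun p : ((γ × List β) × Token) × Sk ArithOp => p.1.1.2)
        (g := fun p y s' => s'.elim' [] fun x s => g p.1.1.1 p.2 x y :: s) (by fun_prop)
        (by fun_prop) hg'
  refine PolyTime.foldl_of_add (f := fun c => foldStep (f c) (g c)) (i := fun _ => []) hs
    (by fun_prop) hl (u.comp (v + .X + 1) + q.comp (v + .X + 1) + 2) fun c s x hx => ?_
  have h₁ := sz_le_of_mem hx
  have h₂ := hv c
  simp only [Polynomial.eval_add, Polynomial.eval_comp, Polynomial.eval_X, Polynomial.eval_one,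
    Polynomial.eval_ofNat]
  rcases x with k | o
  · have h₃ := hu (c, k)
    rw [sz_inl] at h₁
    have h₄ := polynomial_mono u (m := sz (c, k)) (n := v.eval (sz c) + sz c + 1)
      (by rw [sz_prod]; omega)
    simp only [foldStep, Sum.elim_inl, sz_cons] at h₃ ⊢
    omega
  · rw [sz_inr] at h₁
    have h₄ := polynomial_mono q (m := sz (c, o)) (n := v.eval (sz c) + sz c + 1)
      (by rw [sz_prod]; omega)
    rcases s with _ | ⟨y, _ | ⟨x, s⟩⟩
    · simp [foldStep, List.elim', sz_nil]
    · simp [foldStep, List.elim', sz_nil, sz_cons]; omega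
    · have := hq c o x y
      simp only [foldStep, Sum.elim_inr, List.elim', sz_cons]
      omega

/-- Reads a term in postfix notation. -/
def Term.ofTokens (l : List Token) : Term :=
  ((l.foldl (foldStep .const .op) []).head?).getD (.const (.int 0))

theorem Term.ofTokens_tokens (t : Term) : ofTokens t.tokens = t := by
  rw [ofTokens, foldl_tokens, fold_id]; rfl

/-- Terms have no code yet, so the stack holds postfix notations in place of terms;
`map_foldl_foldStep` identifies the two computations. -/
theorem Term.polyTime_tokens_ofTokens : PolyTime fun l => (ofTokens l).tokens := by
  have : PolyTime fun l : List Token => l.foldl (foldStep (fun c => [(.inl c : Token)])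
      fun o l r => l ++ r ++ [.inr o]) [] := by
    refine polyTime_foldl_foldStep (γ := List Token) (f := fun _ c => [(.inl c : Token)])
      (g := fun _ o l r => l ++ r ++ [.inr o]) (l := fun l => l) (by fun_prop) (by fun_prop) (by fun_prop)
      (.X + 10) fun c o x y => ?_
    have h₁ := sz_append (x ++ y) [(.inr o : Token)]
    have h₂ := sz_append x y
    simp only [sz_cons, sz_nil, sz_inr, sz_prod, Polynomial.eval_add, Polynomial.eval_X,
      Polynomial.eval_ofNat] at *
    omega
  refine (PolyTime.getD this.head? (.const [.inl (.int 0)])).of_eq fun l => ?_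
  have h := map_foldl_foldStep tokens .const .op (fun c => [(.inl c : Token)])
    (fun o l r => l ++ r ++ [.inr o]) (fun _ => rfl) (fun _ _ _ => rfl) l []
  rw [List.map_nil] at h
  rw [← h, ofTokens]
  cases l.foldl (foldStep Term.const Term.op) [] <;> rfl

noncomputable instance : Code Term :=
  .ofRetract Term.tokens Term.ofTokens Term.ofTokens_tokens Term.polyTime_tokens_ofTokens

theorem polyTime_tokens : PolyTime Term.tokens :=
  Code.polyTime_to _ _ Term.ofTokens_tokens Term.polyTime_tokens_ofTokens

theorem polyTime_fold {f : γ → Const → β} {g : γ → Sk ArithOp → β → β → β}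
    {t : γ → Term} (ht : PolyTime t) (hf : PolyTime fun p : γ × Const => f p.1 p.2)
    (hg : PolyTime fun p : γ × Sk ArithOp × β × β => g p.1 p.2.1 p.2.2.1 p.2.2.2)
    (q : Polynomial ℕ) (hq : ∀ c o x y, sz (g c o x y) ≤ sz x + sz y + q.eval (sz (c, o))) :
    PolyTime fun c => (t c).fold (f c) (g c) :=
  (PolyTime.getD (polyTime_foldl_foldStep hf hg (polyTime_tokens.comp ht) q hq).head?
    (.const (dec .leaf))).of_eq fun c => by rw [Term.foldl_tokens]; rfl

/-- Atoms as pairs. -/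
def Atom.equiv : Atom ≃ Sk Pred × List Term where
  toFun p := (p.pred, p.args)
  invFun p := ⟨p.1, p.2⟩

noncomputable instance : Code Atom := .ofEquiv Atom.equiv

/-- Literals as a sum type. -/
def Lit.equiv : Lit ≃ (Sk Bool × Atom) ⊕ (Sk CmpOp × Term × Term) where
  toFun
    | .atom s a => .inl (s, a)
    | .cmp o l r => .inr (o, l, r)
  invFun := Sum.elim (fun p => .atom p.1 p.2) fun p => .cmp p.1 p.2.1 p.2.2
  left_inv c := by cases c <;> rfl
  right_inv c := by cases c <;> rfl

noncomputable instance : Code Lit := .ofEquiv Lit.equiv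

/-- Elements of aggregates as pairs. -/
def AggElem.equiv : AggElem ≃ List Term × List Lit where
  toFun p := (p.tuple, p.cond)
  invFun p := ⟨p.1, p.2⟩

noncomputable instance : Code AggElem := .ofEquiv AggElem.equiv

/-- Members of bodies as a sum type. -/
def BodyElem.equiv : BodyElem ≃ Lit ⊕ (Term × Sk AggOp × List AggElem) where
  toFun
    | .lit l => .inl l
    | .agg t o es => .inr (t, o, es)
  invFun := Sum.elim .lit fun p => .agg p.1 p.2.1 p.2.2
  left_inv c := by cases c <;> rfl
  right_inv c := by cases c <;> rfl

noncomputable instance : Code BodyElem := .ofEquiv BodyElem.equiv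

/-- Rules as pairs. -/
def Rule.equiv : Rule ≃ Option Atom × List BodyElem where
  toFun p := (p.head, p.body)
  invFun p := ⟨p.1, p.2⟩

noncomputable instance : Code Rule := .ofEquiv Rule.equiv

/-- Instances as tuples. -/
def Instance.equiv : Instance ≃ List Rule × List (Decl Pred) × List (Decl Bool) ×
    List (Decl CmpOp) × List (Decl ArithOp) × List (Decl AggOp) × List (List GAtom) ×
    List (List GAtom) where
  toFun I := (I.rules, I.preds, I.signs, I.cmps, I.ariths, I.aggs, I.pos, I.neg)
  invFun p := ⟨p.1, p.2.1, p.2.2.1, p.2.2.2.1, p.2.2.2.2.1, p.2.2.2.2.2.1, p.2.2.2.2.2.2.1,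
    p.2.2.2.2.2.2.2⟩

noncomputable instance : Code Instance := .ofEquiv Instance.equiv

/-! ### Components in polynomial time -/

section

@[fun_prop]
theorem polyTime_constEquiv {f : α → Const} (hf : PolyTime f) :
    PolyTime fun a => Const.equiv (f a) := (PolyTime.equiv _).comp hf

@[fun_prop]
theorem polyTime_int {f : α → ℤ} (hf : PolyTime f) : PolyTime fun a => Const.int (f a) :=
  (PolyTime.equiv_symm Const.equiv).comp hf.inl

@[fun_prop]
theorem polyTime_pred_name {f : α → Pred} (hf : PolyTime f) : PolyTime fun a => (f a).name :=
  PolyTime.fst.comp ((PolyTime.equiv Pred.equiv).comp hf)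

@[fun_prop]
theorem polyTime_pred_arity {f : α → Pred} (hf : PolyTime f) : PolyTime fun a => (f a).arity :=
  PolyTime.snd.comp ((PolyTime.equiv Pred.equiv).comp hf)

@[fun_prop]
theorem polyTime_skEquiv {f : α → Sk β} (hf : PolyTime f) :
    PolyTime fun a => Sk.equiv (f a) := (PolyTime.equiv _).comp hf

@[fun_prop]
theorem polyTime_known {f : α → β} (hf : PolyTime f) : PolyTime fun a => Sk.known (f a) :=
  (PolyTime.equiv_symm Sk.equiv).comp hf.inl

@[fun_prop]
theorem polyTime_sketched {f : α → Name} (hf : PolyTime f) :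
    PolyTime fun a => (Sk.sketched (f a) : Sk β) :=
  (PolyTime.equiv_symm Sk.equiv).comp hf.inr

@[fun_prop]
theorem polyTime_decl_name {f : α → Decl β} (hf : PolyTime f) : PolyTime fun a => (f a).name :=
  PolyTime.fst.comp ((PolyTime.equiv Decl.equiv).comp hf)

@[fun_prop]
theorem polyTime_decl_dom {f : α → Decl β} (hf : PolyTime f) : PolyTime fun a => (f a).dom :=
  PolyTime.snd.comp ((PolyTime.equiv Decl.equiv).comp hf)

@[fun_prop]
theorem polyTime_gAtom_pred {f : α → GAtom} (hf : PolyTime f) : PolyTime fun a => (f a).pred :=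
  PolyTime.fst.comp ((PolyTime.equiv GAtom.equiv).comp hf)

@[fun_prop]
theorem polyTime_gAtom_args {f : α → GAtom} (hf : PolyTime f) : PolyTime fun a => (f a).args :=
  PolyTime.snd.comp ((PolyTime.equiv GAtom.equiv).comp hf)

@[fun_prop]
theorem polyTime_gAtom_mk {f : α → Pred} {g : α → List Const} (hf : PolyTime f) (hg : PolyTime g) :
    PolyTime fun a => GAtom.mk (f a) (g a) :=
  (PolyTime.equiv_symm GAtom.equiv).comp (hf.prodMk hg)

@[fun_prop]
theorem polyTime_atom_pred {f : α → Atom} (hf : PolyTime f) : PolyTime fun a => (f a).pred :=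
  PolyTime.fst.comp ((PolyTime.equiv Atom.equiv).comp hf)

@[fun_prop]
theorem polyTime_atom_args {f : α → Atom} (hf : PolyTime f) : PolyTime fun a => (f a).args :=
  PolyTime.snd.comp ((PolyTime.equiv Atom.equiv).comp hf)

@[fun_prop]
theorem polyTime_litEquiv {f : α → Lit} (hf : PolyTime f) :
    PolyTime fun a => Lit.equiv (f a) := (PolyTime.equiv _).comp hf

@[fun_prop]
theorem polyTime_aggElem_tuple {f : α → AggElem} (hf : PolyTime f) :
    PolyTime fun a => (f a).tuple :=
  PolyTime.fst.comp ((PolyTime.equiv AggElem.equiv).comp hf)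

@[fun_prop]
theorem polyTime_aggElem_cond {f : α → AggElem} (hf : PolyTime f) : PolyTime fun a => (f a).cond :=
  PolyTime.snd.comp ((PolyTime.equiv AggElem.equiv).comp hf)

@[fun_prop]
theorem polyTime_bodyElemEquiv {f : α → BodyElem} (hf : PolyTime f) :
    PolyTime fun a => BodyElem.equiv (f a) := (PolyTime.equiv _).comp hf

@[fun_prop]
theorem polyTime_rule_head {f : α → Rule} (hf : PolyTime f) : PolyTime fun a => (f a).head :=
  PolyTime.fst.comp ((PolyTime.equiv Rule.equiv).comp hf)

@[fun_prop]
theorem polyTime_rule_body {f : α → Rule} (hf : PolyTime f) : PolyTime fun a => (f a).body :=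
  PolyTime.snd.comp ((PolyTime.equiv Rule.equiv).comp hf)

theorem polyTime_instanceEquiv : PolyTime Instance.equiv := PolyTime.equiv _

@[fun_prop]
theorem polyTime_rules {f : α → Instance} (hf : PolyTime f) : PolyTime fun a => (f a).rules :=
  PolyTime.fst.comp (polyTime_instanceEquiv.comp hf)

@[fun_prop]
theorem polyTime_preds {f : α → Instance} (hf : PolyTime f) : PolyTime fun a => (f a).preds :=
  PolyTime.fst.comp (PolyTime.snd.comp (polyTime_instanceEquiv.comp hf))

@[fun_prop]
theorem polyTime_signs {f : α → Instance} (hf : PolyTime f) : PolyTime fun a => (f a).signs :=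
  PolyTime.fst.comp (PolyTime.snd.comp (PolyTime.snd.comp (polyTime_instanceEquiv.comp hf)))

@[fun_prop]
theorem polyTime_cmps {f : α → Instance} (hf : PolyTime f) : PolyTime fun a => (f a).cmps :=
  PolyTime.fst.comp (PolyTime.snd.comp (PolyTime.snd.comp (PolyTime.snd.comp
    (polyTime_instanceEquiv.comp hf))))

@[fun_prop]
theorem polyTime_ariths {f : α → Instance} (hf : PolyTime f) : PolyTime fun a => (f a).ariths :=
  PolyTime.fst.comp (PolyTime.snd.comp (PolyTime.snd.comp (PolyTime.snd.comp
    (PolyTime.snd.comp (polyTime_instanceEquiv.comp hf)))))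

@[fun_prop]
theorem polyTime_aggs {f : α → Instance} (hf : PolyTime f) : PolyTime fun a => (f a).aggs :=
  PolyTime.fst.comp (PolyTime.snd.comp (PolyTime.snd.comp (PolyTime.snd.comp
    (PolyTime.snd.comp (PolyTime.snd.comp (polyTime_instanceEquiv.comp hf))))))

@[fun_prop]
theorem polyTime_pos {f : α → Instance} (hf : PolyTime f) : PolyTime fun a => (f a).pos :=
  PolyTime.fst.comp (PolyTime.snd.comp (PolyTime.snd.comp (PolyTime.snd.comp
    (PolyTime.snd.comp (PolyTime.snd.comp (PolyTime.snd.comp (polyTime_instanceEquiv.comp hf)))))))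

@[fun_prop]
theorem polyTime_neg {f : α → Instance} (hf : PolyTime f) : PolyTime fun a => (f a).neg :=
  PolyTime.snd.comp (PolyTime.snd.comp (PolyTime.snd.comp (PolyTime.snd.comp
    (PolyTime.snd.comp (PolyTime.snd.comp (PolyTime.snd.comp (polyTime_instanceEquiv.comp hf)))))))

end

end SkASP

/-! ### The representation of instances by words -/

namespace SkASP

open StackProg Code Computability

variable {α β γ δ : Type} [Code α] [Code β] [Code γ] [Code δ]

theorem encodePosNum_eq (m : PosNum) : encodePosNum m = (m : ℕ).bits := by
  induction m with
  | one => simp [encodePosNum]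
  | bit0 m ih =>
    have : (m : ℕ) ≠ 0 := (PosNum.cast_pos (α := ℕ) m).ne'
    rw [encodePosNum, ih, PosNum.cast_bit0, ← two_mul, Nat.bit0_bits _ this]
  | bit1 m ih => rw [encodePosNum, ih, PosNum.cast_bit1, ← two_mul, Nat.bit1_bits]

/-- `encodeNat` goes through `Num`, whereas the code of natural numbers is built on `Nat.bits`; both
list the digits from the lowest one. -/
theorem encodeNat_eq (n : ℕ) : encodeNat n = n.bits := by
  have h : ((n : Num) : ℕ) = n := by simp
  conv_rhs => rw [← h]
  unfold encodeNat encodeNum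
  cases (n : Num) with
  | zero => simp
  | pos m => exact encodePosNum_eq m

@[fun_prop]
theorem polyTime_bit {f : α → Bool} (hf : PolyTime f) : PolyTime fun a => Γ'.bit (f a) :=
  (PolyTime.of_finite' Γ'.bit).comp hf

@[fun_prop]
theorem polyTime_encWord {f : α → List Bool} (hf : PolyTime f) : PolyTime fun a => encWord (f a) := by
  unfold encWord
  exact PolyTime.append (hf.map (f := fun _ b => Γ'.bit b) (by fun_prop)) (by fun_prop)

@[fun_prop]
theorem polyTime_encNat {f : α → ℕ} (hf : PolyTime f) : PolyTime fun a => encNat (f a) := by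
  simp only [encNat, encodeNat_eq]
  fun_prop

@[fun_prop]
theorem polyTime_encInt {f : α → ℤ} (hf : PolyTime f) : PolyTime fun a => encInt (f a) := by
  simp only [encInt, encodeNat_eq]
  fun_prop

theorem polyTime_encList {e : β → List Γ'} (he : PolyTime e) : PolyTime (encList e) := by
  unfold encList
  exact PolyTime.append (PolyTime.flatMap (l := fun l : List β => l) (f := fun _ x => Γ'.bra :: e x)
    (by fun_prop) (by fun_prop)) (by fun_prop)

theorem polyTime_encSk {e : β → List Γ'} (he : PolyTime e) : PolyTime (encSk e) :=
  (PolyTime.sum_elim (o := fun x => Sk.equiv x) (f := fun _ a => Γ'.bit false :: e a)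
    (g := fun _ s => Γ'.bit true :: encWord s) (by fun_prop) (by fun_prop) (by fun_prop)).of_eq
    fun x => by cases x <;> rfl

theorem polyTime_encConst : PolyTime encConst :=
  (PolyTime.sum_elim (o := fun x => Const.equiv x) (f := fun _ a => Γ'.bit false :: encInt a)
    (g := fun _ s => Γ'.bit true :: encWord s) (by fun_prop) (by fun_prop) (by fun_prop)).of_eq
    fun x => by cases x <;> rfl

theorem polyTime_encPred : PolyTime encPred := by
  unfold encPred
  fun_prop

theorem encTerm_eq_fold (t : Term) : encTerm t = t.fold (fun c => Γ'.bit false :: encConst c)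
    fun o l r => Γ'.bit true :: (encSk encArith o ++ (l ++ r)) := by
  induction t with
  | const c => rfl
  | op o l r ihl ihr => rw [encTerm, Term.fold, ihl, ihr]

theorem polyTime_encTerm : PolyTime encTerm := by
  have h₁ := polyTime_encConst
  have h₂ := polyTime_encSk (PolyTime.of_finite' encArith)
  obtain ⟨q, hq⟩ := h₂.size_le
  refine (polyTime_fold (t := fun t => t) (f := fun _ c => Γ'.bit false :: encConst c)
    (g := fun _ o l r => Γ'.bit true :: (encSk encArith o ++ (l ++ r))) (by fun_prop) (by fun_prop)
    (by fun_prop) (q + .C (sz (Γ'.bit true)) + 1) fun c o x y => ?_).of_eq fun t => (encTerm_eq_fold t).symm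
  have h₃ := (hq o).trans (polynomial_mono q (n := sz (c, o)) (by rw [sz_prod]; omega))
  have h₄ := sz_append (encSk encArith o) (x ++ y)
  have h₅ := sz_append x y
  simp only [sz_cons, Polynomial.eval_add, Polynomial.eval_one, Polynomial.eval_C] at *
  omega

theorem polyTime_encAtom : PolyTime encAtom := by
  have h₁ := polyTime_encSk polyTime_encPred
  have h₂ := polyTime_encList polyTime_encTerm
  unfold encAtom
  fun_prop

theorem polyTime_encLit : PolyTime encLit := by
  have h₁ := polyTime_encSk (PolyTime.of_finite' encBool)
  have h₂ := polyTime_encSk (PolyTime.of_finite' encCmp)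
  have h₃ := polyTime_encTerm
  have h₄ := polyTime_encAtom
  exact (PolyTime.sum_elim (o := fun x => Lit.equiv x)
    (f := fun _ p => Γ'.bit false :: (encSk encBool p.1 ++ encAtom p.2))
    (g := fun _ p => Γ'.bit true :: (encSk encCmp p.1 ++ (encTerm p.2.1 ++ encTerm p.2.2)))
    (by fun_prop) (by fun_prop) (by fun_prop)).of_eq fun x => by cases x <;> rfl

theorem polyTime_encAggElem : PolyTime encAggElem := by
  have h₁ := polyTime_encList polyTime_encTerm
  have h₂ := polyTime_encList polyTime_encLit
  unfold encAggElem
  fun_prop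

theorem polyTime_encBodyElem : PolyTime encBodyElem := by
  have h₁ := polyTime_encSk (PolyTime.of_finite' encAgg)
  have h₂ := polyTime_encList polyTime_encAggElem
  have h₃ := polyTime_encTerm
  have h₄ := polyTime_encLit
  exact (PolyTime.sum_elim (o := fun x => BodyElem.equiv x)
    (f := fun _ p => Γ'.bit false :: encLit p)
    (g := fun _ p => Γ'.bit true :: (encTerm p.1 ++ (encSk encAgg p.2.1 ++ encList encAggElem p.2.2)))
    (by fun_prop) (by fun_prop) (by fun_prop)).of_eq fun x => by cases x <;> rfl

theorem polyTime_encHead : PolyTime encHead := by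
  have h₁ := polyTime_encAtom
  exact (PolyTime.option_elim (o := fun x => x) (f := fun _ => [Γ'.bit false])
    (g := fun _ p => Γ'.bit true :: encAtom p)
    (by fun_prop) (by fun_prop) (by fun_prop)).of_eq fun x => by cases x <;> rfl

theorem polyTime_encRule : PolyTime encRule := by
  have h₁ := polyTime_encHead
  have h₂ := polyTime_encList polyTime_encBodyElem
  unfold encRule
  fun_prop

theorem polyTime_encGAtom : PolyTime encGAtom := by
  have h₁ := polyTime_encPred
  have h₂ := polyTime_encList polyTime_encConst
  unfold encGAtom
  fun_prop

theorem polyTime_encDecl {e : β → List Γ'} (he : PolyTime e) : PolyTime (encDecl e) := by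
  have h₁ : PolyTime (encEntry e) := by
    unfold encEntry
    fun_prop
  have h₂ := polyTime_encList h₁
  unfold encDecl
  fun_prop

theorem polyTime_encode : PolyTime encode := by
  have h₁ := polyTime_encList polyTime_encRule
  have h₂ := polyTime_encList (polyTime_encDecl polyTime_encPred)
  have h₃ := polyTime_encList (polyTime_encDecl (PolyTime.of_finite' encBool))
  have h₄ := polyTime_encList (polyTime_encDecl (PolyTime.of_finite' encCmp))
  have h₅ := polyTime_encList (polyTime_encDecl (PolyTime.of_finite' encArith))
  have h₆ := polyTime_encList (polyTime_encDecl (PolyTime.of_finite' encAgg))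
  have h₇ := polyTime_encList (polyTime_encList polyTime_encGAtom)
  unfold encode
  fun_prop

/-! ### Instances are no larger than the words that represent them -/

/-- The code of an object is at most a constant factor larger than the word that represents it. -/
def Small {α : Type} [Code α] (f : α → List Γ') : Prop :=
  ∃ C, ∀ a, sz a + 1 ≤ C * (f a).length

/-- The `+ 1` in `Small` pays for the node of a pair. It also forces the words to be nonempty, so
that `c` can be absorbed into the factor. -/
theorem Small.prod {f : γ → List Γ'} {g : α → List Γ'} {h : β → List Γ'} (hg : Small g)
    (hh : Small h) (p : γ → α × β) (c : ℕ) (hp : ∀ x, sz x ≤ sz (p x) + c)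
    (hl : ∀ x, (g (p x).1).length + (h (p x).2).length ≤ (f x).length) : Small f := by
  obtain ⟨C, hC⟩ := hg
  obtain ⟨D, hD⟩ := hh
  refine ⟨C + D + c, fun a => ?_⟩
  have h₁ := hC (p a).1
  have h₂ := hD (p a).2
  have h₃ := hp a
  have h₄ := hl a
  have h₅ : 1 ≤ (g (p a).1).length := by
    by_contra! h
    rw [Nat.lt_one_iff.1 h] at h₁
    omega
  rw [show p a = ((p a).1, (p a).2) from rfl, sz_prod] at h₃
  have h₆ := Nat.mul_le_mul_left (C + D + c) h₄
  have h₇ : c ≤ c * (f a).length := Nat.le_mul_of_pos_right _ (by omega)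
  have h₈ : C * (g (p a).1).length ≤ C * (f a).length := Nat.mul_le_mul_left _ (by omega)
  have h₉ : D * (h (p a).2).length ≤ D * (f a).length := Nat.mul_le_mul_left _ (by omega)
  simp only [Nat.add_mul]
  omega

/-- The tag of a sum costs at most four, which a nonempty word absorbs. -/
theorem Small.sum {f : γ → List Γ'} {g : α → List Γ'} {h : β → List Γ'} (hg : Small g)
    (hh : Small h) (p : γ → α ⊕ β) (hp : ∀ x, sz x ≤ sz (p x))
    (hl : ∀ x, (p x).elim (fun y => (g y).length) (fun y => (h y).length) ≤ (f x).length) : Small f := by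
  obtain ⟨C, hC⟩ := hg
  obtain ⟨D, hD⟩ := hh
  refine ⟨C + D + 4, fun a => ?_⟩
  have h₃ := hp a
  have h₄ := hl a
  simp only [Nat.add_mul]
  rcases hx : p a with x | x <;> rw [hx] at h₃ h₄ <;>
    simp only [sz_inl, sz_inr, Sum.elim_inl, Sum.elim_inr] at h₃ h₄
  · have h₁ := hC x
    have h₅ : 1 ≤ (g x).length := by
      by_contra! h
      rw [Nat.lt_one_iff.1 h] at h₁
      omega
    have h₆ := Nat.mul_le_mul_left C h₄
    omega
  · have h₁ := hD x
    have h₅ : 1 ≤ (h x).length := by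
      by_contra! h
      rw [Nat.lt_one_iff.1 h] at h₁
      omega
    have h₆ := Nat.mul_le_mul_left D h₄
    omega

/-- The symbol `bra` in front of an entry pays for its list node, and `ket` for the empty list. -/
theorem Small.list {f : α → List Γ'} (hf : Small f) : Small (encList f) := by
  obtain ⟨C, hC⟩ := hf
  refine ⟨C + 2, fun l => ?_⟩
  induction l with
  | nil => simp [sz_nil, encList]
  | cons x l ih =>
    have := hC x
    have h : (encList f (x :: l)).length = (f x).length + 1 + (encList f l).length := by
      simp [encList]; omega
    rw [sz_cons, h]
    simp only [Nat.add_mul, Nat.mul_add] at *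
    omega

theorem small_finite [Finite α] {f : α → List Γ'} (hf : ∀ a, f a ≠ []) : Small f := by
  obtain ⟨C, hC⟩ := (Set.finite_range (sz : α → ℕ)).bddAbove
  refine ⟨C + 1, fun a => ?_⟩
  have h₁ : sz a ≤ C := hC ⟨a, rfl⟩
  have h₂ := List.length_pos_of_ne_nil (hf a)
  calc sz a + 1 ≤ (C + 1) * 1 := by omega
    _ ≤ _ := Nat.mul_le_mul_left _ h₂

theorem sz_word (w : List Bool) : sz w = 6 * w.length + 1 := by
  induction w with
  | nil => rfl
  | cons b w ih => rw [sz_cons, ih, sz_bool, List.length_cons]; omega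

theorem small_word : Small encWord :=
  ⟨6, fun w => by rw [sz_word]; simp [encWord]; omega⟩

theorem small_nat : Small encNat :=
  ⟨6, fun n => by
    rw [sz_nat, encNat, encodeNat_eq, ← Nat.size_eq_bits_len]; simp [encWord]; omega⟩

theorem small_int : Small encInt :=
  ⟨6, fun n => by
    rw [sz_int, sz_nat, encInt, encodeNat_eq, ← Nat.size_eq_bits_len]; simp [encWord]; omega⟩

theorem small_sk {f : α → List Γ'} (hf : Small f) : Small (encSk f) :=
  .sum hf small_word Sk.equiv (fun _ => le_rfl) fun x => by cases x <;> simp [Sk.equiv, encSk]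

theorem small_const : Small encConst :=
  .sum small_int small_word Const.equiv (fun _ => le_rfl) fun x => by
    cases x <;> simp [Const.equiv, encConst]

theorem small_pred : Small encPred :=
  .prod small_word small_nat Pred.equiv 0 (fun _ => le_rfl) fun x => by
    simp [Pred.equiv, encPred]

theorem encNat_ne_nil (n : ℕ) : encNat n ≠ [] := by simp [encNat, encWord]

theorem small_bool : Small encBool := small_finite fun b => by simp [encBool]

theorem small_arith : Small encArith := small_finite fun b => by
  cases b <;> exact encNat_ne_nil _

theorem small_cmp : Small encCmp := small_finite fun b => by
  cases b <;> exact encNat_ne_nil _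

theorem small_agg : Small encAgg := small_finite fun b => by
  cases b <;> exact encNat_ne_nil _

theorem small_term : Small encTerm := by
  obtain ⟨C, hC⟩ := small_const
  obtain ⟨D, hD⟩ := small_sk small_arith
  refine ⟨C + D + 6, fun t => ?_⟩
  -- The code is a postfix and the word a prefix notation, but both run through the same constants
  -- and operators.
  change sz t.tokens + 1 ≤ _
  induction t with
  | const c =>
    have := hC c
    simp only [Term.tokens, encTerm, sz_cons, sz_nil, sz_inl, List.length_cons, Nat.mul_add,
      Nat.add_mul]
    omega
  | op o l r ihl ihr =>
    have := hD o
    have h₁ := sz_append (l.tokens ++ r.tokens) [(.inr o : Token)]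
    have h₂ := sz_append l.tokens r.tokens
    simp only [Term.tokens, encTerm, sz_cons, sz_nil, sz_inr, List.length_cons, Nat.mul_add,
      Nat.add_mul, List.length_append] at *
    omega

theorem small_atom : Small encAtom :=
  .prod (small_sk small_pred) small_term.list Atom.equiv 0 (fun _ => le_rfl) fun x => by
    simp [Atom.equiv, encAtom]

/-- The word that represents a pair. -/
def encPair {α β : Type} (f : α → List Γ') (g : β → List Γ') (p : α × β) : List Γ' := f p.1 ++ g p.2

theorem small_pair {f : α → List Γ'} {g : β → List Γ'} (hf : Small f) (hg : Small g) :
    Small (encPair f g) :=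
  .prod hf hg id 0 (fun _ => le_rfl) fun x => by simp [encPair]

theorem small_lit : Small encLit :=
  .sum (small_pair (small_sk small_bool) small_atom)
    (small_pair (small_sk small_cmp) (small_pair small_term small_term)) Lit.equiv (fun _ => le_rfl)
    fun x => by cases x <;> simp [Lit.equiv, encLit, encPair]

theorem small_aggElem : Small encAggElem :=
  .prod small_term.list small_lit.list AggElem.equiv 0 (fun _ => le_rfl) fun x => by
    simp [AggElem.equiv, encAggElem]

theorem small_bodyElem : Small encBodyElem :=
  .sum small_lit (small_pair small_term (small_pair (small_sk small_agg) small_aggElem.list))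
    BodyElem.equiv (fun _ => le_rfl)
    fun x => by cases x <;> simp [BodyElem.equiv, encBodyElem, encPair]

theorem small_head : Small encHead := by
  obtain ⟨C, hC⟩ := small_atom
  refine ⟨C + 3, fun o => ?_⟩
  cases o with
  | none => simp [sz_none, encHead]
  | some a =>
    have := hC a
    simp only [sz_some, encHead, List.length_cons, Nat.mul_add, Nat.add_mul]
    omega

theorem small_rule : Small encRule :=
  .prod small_head small_bodyElem.list Rule.equiv 0 (fun _ => le_rfl) fun x => by
    simp [Rule.equiv, encRule]

theorem small_gAtom : Small encGAtom :=
  .prod small_pred small_const.list GAtom.equiv 0 (fun _ => le_rfl) fun x => by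
    simp [GAtom.equiv, encGAtom]

theorem small_decl {f : α → List Γ'} (hf : Small f) : Small (encDecl f) :=
  .prod small_word (small_pair hf small_int).list Decl.equiv 0 (fun _ => le_rfl) fun x => by
    simp [Decl.equiv, encDecl]; exact le_rfl

theorem small_encode : Small encode :=
  .prod small_rule.list (small_pair (small_decl small_pred).list (small_pair
    (small_decl small_bool).list (small_pair (small_decl small_cmp).list (small_pair
    (small_decl small_arith).list (small_pair (small_decl small_agg).list (small_pair
    small_gAtom.list.list small_gAtom.list.list)))))) Instance.equiv 0 (fun _ => le_rfl) fun x => by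
    simp [Instance.equiv, encode, encPair]

end SkASP

/-! ### Evaluation in polynomial time -/

namespace SkASP

open StackProg Code Computability

variable {α β γ δ : Type} [Code α] [Code β] [Code γ] [Code δ]

/-- Values of the sketched variables, as association lists. -/
abbrev SubstData := List (Name × Pred) × List (Name × Bool) × List (Name × CmpOp) ×
  List (Name × ArithOp) × List (Name × AggOp)

/-- The function that an association list represents. -/
def lookup {α : Type} [Inhabited α] (l : List (Name × α)) (s : Name) : α := (l.find s).getD default

/-- The substitution that association lists represent. -/
def substOf (D : SubstData) : Subst :=
  ⟨lookup D.1, lookup D.2.1, lookup D.2.2.1, lookup D.2.2.2.1, lookup D.2.2.2.2⟩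

@[fun_prop]
theorem polyTime_lookup [Inhabited β] {l : α → List (Name × β)} {s : α → Name} (hl : PolyTime l)
    (hs : PolyTime s) : PolyTime fun a => lookup (l a) (s a) := by
  unfold lookup
  fun_prop

@[fun_prop]
theorem polyTime_subst [Inhabited β] {l : α → List (Name × β)} {s : α → Sk β} (hl : PolyTime l)
    (hs : PolyTime s) : PolyTime fun a => (s a).subst (lookup (l a)) :=
  (PolyTime.sum_elim (o := fun a => Sk.equiv (s a)) (f := fun _ x => x)
    (g := fun a x => lookup (l a) x) (by fun_prop) (by fun_prop) (by fun_prop)).of_eq fun a => by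
    cases s a <;> rfl

@[fun_prop]
theorem polyTime_arith {f : α → ArithOp} {g h : α → ℤ} (hf : PolyTime f) (hg : PolyTime g)
    (hh : PolyTime h) : PolyTime fun a => (f a).eval (g a) (h a) :=
  PolyTime.of_finite hf (g := fun o a => o.eval (g a) (h a)) fun o => by
    cases o <;> simp only [ArithOp.eval] <;> fun_prop

/-- The integers among the constants. -/
def Const.toInt (c : Const) : Option ℤ := (Const.equiv c).elim some fun _ => none

@[fun_prop]
theorem polyTime_toInt {f : α → Const} (hf : PolyTime f) : PolyTime fun a => (f a).toInt := by
  unfold Const.toInt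
  fun_prop

/-- The value of an operation on possibly undefined arguments. -/
def evalOp (D : SubstData) (o : Sk ArithOp) (x y : Option Const) : Option Const :=
  (x.bind Const.toInt).bind fun a => (y.bind Const.toInt).bind fun b =>
    ((o.subst (lookup D.2.2.2.1)).eval a b).map .int

theorem eval_eq_fold (D : SubstData) (t : Term) :
    t.eval (substOf D) = t.fold some (evalOp D) := by
  induction t with
  | const c => rfl
  | op o l r ihl ihr =>
    rw [Term.eval, Term.fold, ihl, ihr]
    rcases l.fold some (evalOp D) with _ | _ | _ <;>
    rcases r.fold some (evalOp D) with _ | _ | _ <;> rfl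

theorem sz_const_int (z : ℤ) : sz (Const.int z) = sz z + 2 := sz_inl z

/-- Even under multiplication sizes at most add up, which is the growth that `polyTime_fold` admits.
The `4` is for `some` and `Const.int`. -/
theorem sz_arith_le (o : ArithOp) (x y : ℤ) :
    sz ((o.eval x y).map Const.int) ≤ sz x + sz y + 4 := by
  have h₁ := sz_int_add_le x y
  have h₂ := sz_int_add_le x (-y)
  have h₃ := sz_int_mul_le x y
  have h₄ := sz_int_tdiv_le x y
  rw [sz_int_neg] at h₂
  cases o
  · simp only [ArithOp.eval, Option.map_some, sz_some, sz_const_int]; omega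
  · simp only [ArithOp.eval, Option.map_some, sz_some, sz_const_int, sub_eq_add_neg]; omega
  · simp only [ArithOp.eval, Option.map_some, sz_some, sz_const_int]; omega
  · simp only [ArithOp.eval]
    split_ifs
    · simp only [Option.map_none, sz_none]; omega
    · simp only [Option.map_some, sz_some, sz_const_int]; omega
  · simp only [ArithOp.eval, Option.map_some, sz_some, sz_const_int, sub_eq_add_neg, sz_int_abs]; omega

@[fun_prop]
theorem polyTime_eval {D : α → SubstData} {t : α → Term} (hD : PolyTime D) (ht : PolyTime t) :
    PolyTime fun a => (t a).eval (substOf (D a)) := by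
  simp only [eval_eq_fold]
  refine polyTime_fold (f := fun _ => some) (g := fun a => evalOp (D a)) ht (by fun_prop) ?_ 4
    fun c o x y => ?_
  · unfold evalOp
    fun_prop
  · have h₁ : sz (none : Option Const) = 1 := rfl
    unfold evalOp
    rcases x with _ | x | x
    · simp only [Option.bind, h₁]; omega
    · rcases y with _ | y | y
      · simp only [Option.bind, Const.toInt, Const.equiv, Equiv.coe_fn_mk, Sum.elim_inl, h₁]; omega
      · have := sz_arith_le (o.subst (lookup (D c).2.2.2.1)) x y
        simp only [Option.bind, Const.toInt, Const.equiv, Equiv.coe_fn_mk, Sum.elim_inl, sz_some,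
          sz_const_int, Polynomial.eval_ofNat]
        omega
      · simp only [Option.bind, Const.toInt, Const.equiv, Equiv.coe_fn_mk, Sum.elim_inl, Sum.elim_inr, h₁]
        have := sz_pos (some (Const.int x))
        omega
    · simp only [Option.bind, Const.toInt, Const.equiv, Equiv.coe_fn_mk, Sum.elim_inr, h₁]
      have := sz_pos (some (Const.sym x))
      omega

@[fun_prop]
theorem polyTime_atom_eval {D : α → SubstData} {t : α → Atom} (hD : PolyTime D) (ht : PolyTime t) :
    PolyTime fun a => (t a).eval (substOf (D a)) := by
  unfold Atom.eval
  have : PolyTime fun a => (t a).pred.subst (substOf (D a)).pred :=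
    polyTime_subst (l := fun a => (D a).1) (by fun_prop) (by fun_prop)
  fun_prop

@[fun_prop]
theorem polyPred_lt {f g : α → Const} (hf : PolyTime f) (hg : PolyTime g) :
    PolyPred fun a => (f a).Lt (g a) :=
  (PolyPred.sum_elim (o := fun a => Const.equiv (f a))
    (p := fun a x => (Const.equiv (g a)).elim (fun y => x < y) fun _ => True)
    (q := fun a x => (Const.equiv (g a)).elim (fun _ => False) fun y => x < y)
    (by fun_prop) (by fun_prop) (by fun_prop)).of_iff fun a => by
    cases f a <;> cases g a <;> rfl

@[fun_prop]
theorem polyPred_cmp {o : α → CmpOp} {f g : α → Const} (ho : PolyTime o) (hf : PolyTime f)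
    (hg : PolyTime g) : PolyPred fun a => (o a).Holds (f a) (g a) :=
  PolyPred.of_finite (p := fun o a => o.Holds (f a) (g a)) ho fun o => by
    cases o <;> simp only [CmpOp.Holds] <;> fun_prop

/-- The interpretation given by a list of atoms. -/
def interp (l : List GAtom) : Set GAtom := {g | g ∈ l}

theorem mem_interp {l : List GAtom} {g : GAtom} : g ∈ interp l ↔ g ∈ l := Iff.rfl

@[fun_prop]
theorem polyPred_lit {D : α → SubstData} {X Y : α → List GAtom} {l : α → Lit} (hD : PolyTime D)
    (hX : PolyTime X) (hY : PolyTime Y) (hl : PolyTime l) :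
    PolyPred fun a => (l a).Holds (substOf (D a)) (interp (X a)) (interp (Y a)) := by
  have h₁ : PolyTime fun p : α × Sk Bool × Atom => p.2.1.subst (substOf (D p.1)).sign :=
    polyTime_subst (l := fun p : α × Sk Bool × Atom => (D p.1).2.1) (by fun_prop) (by fun_prop)
  have h₂ : PolyTime fun p : α × Sk CmpOp × Term × Term => p.2.1.subst (substOf (D p.1)).cmp :=
    polyTime_subst (l := fun p : α × Sk CmpOp × Term × Term => (D p.1).2.2.1) (by fun_prop)
      (by fun_prop)
  refine (PolyPred.sum_elim (o := fun a => Lit.equiv (l a))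
    (p := fun a p => ExistsSome (p.2.eval (substOf (D a))) fun g =>
      (p.1.subst (substOf (D a)).sign = true ∧ g ∈ Y a) ∨
      (¬ p.1.subst (substOf (D a)).sign = true ∧ ¬ g ∈ X a))
    (q := fun a p => ExistsSome (p.2.1.eval (substOf (D a))) fun x =>
      ExistsSome (p.2.2.eval (substOf (D a))) fun y => (p.1.subst (substOf (D a)).cmp).Holds x y)
    (by fun_prop) ?_ ?_).of_iff fun a => ?_
  · have h₃ := PolyPred.eq h₁ (PolyTime.const true)
    have h₄ := h₃.comp (g := fun q : (α × Sk Bool × Atom) × GAtom => q.1) (by fun_prop)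
    refine PolyPred.existsSome (p := fun (q : α × Sk Bool × Atom) g =>
      (q.2.1.subst (substOf (D q.1)).sign = true ∧ g ∈ Y q.1) ∨
      (¬ q.2.1.subst (substOf (D q.1)).sign = true ∧ ¬ g ∈ X q.1)) (by fun_prop) ?_
    exact (h₄.and (by fun_prop)).or ((PolyPred.not h₄).and (by fun_prop))
  · have h₃ := h₂.comp (g := fun q : ((α × Sk CmpOp × Term × Term) × Const) × Const => q.1.1)
      (by fun_prop)
    refine PolyPred.existsSome (p := fun (q : α × Sk CmpOp × Term × Term) x =>
      ExistsSome (q.2.2.2.eval (substOf (D q.1))) fun y => (q.2.1.subst (substOf (D q.1)).cmp).Holds x y)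
      (by fun_prop) ?_
    refine PolyPred.existsSome (p := fun (q : (α × Sk CmpOp × Term × Term) × Const) y =>
      (q.1.2.1.subst (substOf (D q.1.1)).cmp).Holds q.2 y) (by fun_prop) ?_
    exact polyPred_cmp h₃ (by fun_prop) (by fun_prop)
  · rcases l a with ⟨s, b⟩ | ⟨o, x, y⟩
    · simp only [Lit.equiv, Equiv.coe_fn_mk, Sum.elim_inl, ExistsSome, Lit.Holds, mem_interp]
      refine exists_congr fun g => and_congr Iff.rfl ?_
      split_ifs with h <;> simp [h]
    · simp only [Lit.equiv, Equiv.coe_fn_mk, Sum.elim_inr, ExistsSome, Lit.Holds]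
      simp

instance : DecidableEq Const := Const.equiv.decidableEq

open Classical in
/-- The tuples that an aggregate ranges over, without repetitions. -/
noncomputable def tupleList (D : SubstData) (X : List GAtom) (es : List AggElem) :
    List (List Const) :=
  (es.filterMap fun e => if ForallMem e.cond fun l => l.Holds (substOf D) (interp X) (interp X) then
    e.tuple.mapM (Term.eval (substOf D)) else none).distinct

/-- Aggregates range over sets, so a tuple contributed by several elements must count once. -/
theorem nodup_tupleList (D : SubstData) (X : List GAtom) (es : List AggElem) :
    (tupleList D X es).Nodup := (List.nodup_distinct_and _).1

theorem mem_tupleList {D : SubstData} {X : List GAtom} {es : List AggElem} {t : List Const} :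
    t ∈ tupleList D X es ↔ t ∈ aggTuples (substOf D) (interp X) es := by
  rw [tupleList, (List.nodup_distinct_and _).2]
  rw [List.mem_filterMap]
  refine exists_congr fun e => and_congr Iff.rfl ?_
  by_cases h : ForallMem e.cond fun l => l.Holds (substOf D) (interp X) (interp X)
  · rw [if_pos h]
    exact ⟨fun h' => ⟨h', h⟩, fun h' => h'.1⟩
  · rw [if_neg h]
    exact ⟨fun h' => by simp at h', fun h' => (h h'.2).elim⟩

theorem polyTime_tupleList {D : α → SubstData} {X : α → List GAtom} {es : α → List AggElem}
    (hD : PolyTime D) (hX : PolyTime X) (hes : PolyTime es) :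
    PolyTime fun a => tupleList (D a) (X a) (es a) := by
  classical
  unfold tupleList
  fun_prop

theorem weight_eq (t : List Const) : weight t = (t.head?.bind Const.toInt).getD 0 := by
  rcases t with _ | ⟨_ | _, t⟩ <;> rfl

@[fun_prop]
theorem polyTime_weight {t : α → List Const} (ht : PolyTime t) : PolyTime fun a => weight (t a) := by
  simp only [weight_eq]
  fun_prop

/-- The value of an aggregate function on a list of tuples. -/
def AggOp.HoldsList (L : List (List Const)) (c : Const) : AggOp → Prop
  | .count => c = .int L.length
  | .sum => c = .int (L.map weight).sum
  | .max => (ExistsMem L fun t => t.head? = some c) ∧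
      ForallMem L fun t => ForallSome t.head? fun b => ¬ c.Lt b
  | .min => (ExistsMem L fun t => t.head? = some c) ∧
      ForallMem L fun t => ForallSome t.head? fun b => ¬ b.Lt c

/-- Without repetitions, length and sum of the list are the cardinality of the set and the sum over
it. Maxima and minima depend on membership only. -/
theorem AggOp.holdsList_iff {L : List (List Const)} (hL : L.Nodup) {T : Set (List Const)}
    (h : ∀ t, t ∈ L ↔ t ∈ T) (c : Const) (o : AggOp) : o.HoldsList L c ↔ o.Holds T c := by
  classical
  have hT : T = (L.toFinset : Set (List Const)) := by ext t; simp [h]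
  have h₁ (P : Const → Prop) : (ForallMem L fun t => ForallSome t.head? P) ↔
      ∀ b t, b :: t ∈ T → P b := by
    simp only [ForallMem, ForallSome, h]
    constructor
    · exact fun h' b t ht => h' _ ht b rfl
    · rintro h' (_ | ⟨b, t⟩) ht x hx
      · simp at hx
      · obtain rfl : b = x := by simpa using hx
        exact h' _ _ ht
  have h₂ : (ExistsMem L fun t => t.head? = some c) ↔ ∃ t, c :: t ∈ T := by
    simp only [ExistsMem, h]
    constructor
    · rintro ⟨_ | ⟨b, t⟩, ht, hx⟩
      · simp at hx
      · obtain rfl : b = c := by simpa using hx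
        exact ⟨t, ht⟩
    · exact fun ⟨t, ht⟩ => ⟨_, ht, rfl⟩
  cases o with
  | max => simp only [HoldsList, Holds, h₁, h₂]
  | min => simp only [HoldsList, Holds, h₁, h₂]
  | count =>
    simp only [HoldsList, Holds]
    rw [hT, Set.ncard_coe_finset, List.toFinset_card_of_nodup hL]
  | sum =>
    simp only [HoldsList, Holds]
    rw [hT, finsum_mem_coe_finset, List.sum_toFinset _ hL]

theorem polyPred_holdsList {o : α → AggOp} {L : α → List (List Const)} {c : α → Const}
    (ho : PolyTime o) (hL : PolyTime L) (hc : PolyTime c) :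
    PolyPred fun a => (o a).HoldsList (L a) (c a) :=
  PolyPred.of_finite (p := fun o a => o.HoldsList (L a) (c a)) ho fun o => by
    cases o <;> simp only [AggOp.HoldsList] <;> fun_prop

@[fun_prop]
theorem polyPred_bodyElem {D : α → SubstData} {X Y : α → List GAtom} {l : α → BodyElem}
    (hD : PolyTime D) (hX : PolyTime X) (hY : PolyTime Y) (hl : PolyTime l) :
    PolyPred fun a => (l a).Holds (substOf (D a)) (interp (X a)) (interp (Y a)) := by
  have h₁ : PolyTime fun p : (α × Term × Sk AggOp × List AggElem) × Const =>
      p.1.2.2.1.subst (substOf (D p.1.1)).agg :=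
    polyTime_subst (l := fun p : (α × Term × Sk AggOp × List AggElem) × Const =>
      (D p.1.1).2.2.2.2) (by fun_prop) (by fun_prop)
  refine (PolyPred.sum_elim (o := fun a => BodyElem.equiv (l a))
    (p := fun a l => l.Holds (substOf (D a)) (interp (X a)) (interp (Y a)))
    (q := fun a p => ExistsSome (p.1.eval (substOf (D a))) fun c =>
      (p.2.1.subst (substOf (D a)).agg).HoldsList (tupleList (D a) (X a) p.2.2) c)
    (by fun_prop) (by fun_prop) ?_).of_iff fun a => ?_
  · refine PolyPred.existsSome (p := fun (q : α × Term × Sk AggOp × List AggElem) c =>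
      (q.2.2.1.subst (substOf (D q.1)).agg).HoldsList (tupleList (D q.1) (X q.1) q.2.2.2) c)
      (by fun_prop) ?_
    exact polyPred_holdsList h₁ (polyTime_tupleList (by fun_prop) (by fun_prop) (by fun_prop))
      (by fun_prop)
  · rcases l a with l | ⟨t, o, es⟩
    · rfl
    · simp only [BodyElem.equiv, Equiv.coe_fn_mk, Sum.elim_inr, ExistsSome, BodyElem.Holds,
        AggOp.holdsList_iff (nodup_tupleList _ _ _) fun t => mem_tupleList]

end SkASP

/-! ### Well-formedness, stratification and validity in polynomial time -/

namespace StackProg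

open Code

variable {α β : Type} [Code α] [Code β]

/-- Implication, as a function for which decidability in polynomial time can be derived. -/
def Implies (p q : Prop) : Prop := p → q

@[fun_prop]
theorem PolyPred.implies {p q : α → Prop} (hp : PolyPred p) (hq : PolyPred q) :
    PolyPred fun a => Implies (p a) (q a) :=
  (PolyPred.or (PolyPred.not hp) hq).of_iff fun a => by simp [Implies, imp_iff_not_or]

theorem _root_.List.length_distinct_eq_iff {α : Type} [DecidableEq α] (l : List α) :
    l.distinct.length = l.length ↔ l.Nodup := by
  obtain ⟨h₁, h₂⟩ := l.nodup_distinct_and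
  have h : l.distinct.toFinset = l.toFinset := by ext x; simp [h₂]
  rw [← List.toFinset_card_of_nodup h₁, h]
  exact Multiset.toFinset_card_eq_card_iff_nodup (m := (l : Multiset α))

@[fun_prop]
theorem PolyPred.nodup {l : α → List β} (hl : PolyTime l) : PolyPred fun a => (l a).Nodup := by
  classical
  exact (PolyPred.eq (f := fun a => (l a).distinct.length) (g := fun a => (l a).length)
    (by fun_prop) (by fun_prop)).of_iff fun a => List.length_distinct_eq_iff _

end StackProg

namespace SkASP

open StackProg Code Computability

variable {α β γ δ : Type} [Code α] [Code β] [Code γ] [Code δ]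

theorem Decl.mem_iff {α : Type} (d : Decl α) (v : α) : d.Mem v ↔ v ∈ d.dom.map Prod.fst := by
  simp [Decl.Mem]

@[fun_prop]
theorem polyPred_decl_mem {d : α → Decl β} {v : α → β} (hd : PolyTime d) (hv : PolyTime v) :
    PolyPred fun a => (d a).Mem (v a) := by
  simp only [Decl.mem_iff]
  fun_prop

@[fun_prop]
theorem polyPred_declared {ds : α → List (Decl β)} {s : α → Sk β} (hds : PolyTime ds)
    (hs : PolyTime s) : PolyPred fun a => (s a).Declared (ds a) :=
  (PolyPred.sum_elim (o := fun a => Sk.equiv (s a)) (p := fun _ _ => True)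
    (q := fun a s => ExistsMem (ds a) fun d => d.name = s) (by fun_prop) (by fun_prop)
    (by fun_prop)).of_iff fun a => by cases s a <;> rfl

@[fun_prop]
theorem polyPred_canBe {ds : α → List (Decl β)} {s : α → Sk β} {v : α → β} (hds : PolyTime ds)
    (hs : PolyTime s) (hv : PolyTime v) : PolyPred fun a => (s a).CanBe (ds a) (v a) :=
  (PolyPred.sum_elim (o := fun a => Sk.equiv (s a)) (p := fun a x => v a = x)
    (q := fun a s => ExistsMem (ds a) fun d => d.name = s ∧ d.Mem (v a)) (by fun_prop) (by fun_prop)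
    (by fun_prop)).of_iff fun a => by cases s a <;> rfl

@[fun_prop]
theorem polyPred_declsWF {ds : α → List (Decl β)} (hds : PolyTime ds) :
    PolyPred fun a => DeclsWF (ds a) := by
  have : PolyPred fun a => ForallMem (ds a) fun d => (d.dom.map Prod.fst).Nodup := by fun_prop
  exact PolyPred.and (by fun_prop) this

open Classical in
@[fun_prop]
theorem polyPred_term_wf {I : α → Instance} {t : α → Term} (hI : PolyTime I) (ht : PolyTime t) :
    PolyPred fun a => (t a).WF (I a) := by
  refine (PolyPred.of_bool (polyTime_fold (f := fun _ _ => true) (g := fun a o l r =>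
    decide (o.Declared (I a).ariths) && (l && r)) ht (by fun_prop) (by fun_prop) 5
    fun c o x y => ?_)).of_iff fun a => ?_
  · simp only [sz_bool]; omega
  · induction t a with
    | const c => simp [Term.fold, Term.WF]
    | op o l r ihl ihr => simp [Term.fold, Term.WF, ihl, ihr]

/-- The quantifier over all predicates becomes one over the entries of the declared domains, which
is bounded and can be decided by a fold. -/
theorem Atom.wf_iff (I : Instance) (a : Atom) : a.WF I ↔ a.pred.Declared I.preds ∧
    (Sk.equiv a.pred).elim (fun p => p.arity = a.args.length) (fun s => ForallMem I.preds fun d =>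
      Implies (d.name = s) (ForallMem d.dom fun x => x.1.arity = a.args.length)) ∧
    ForallMem a.args fun t => t.WF I := by
  rw [Atom.WF]
  refine and_congr Iff.rfl (and_congr ?_ Iff.rfl)
  rcases a.pred with p | s
  · simp [Sk.CanBe, Sk.equiv]
  · simp only [Sk.CanBe, Sk.equiv, Equiv.coe_fn_mk, Sum.elim_inr, ForallMem, Implies, Decl.Mem]
    constructor
    · exact fun h d hd hs x hx => h x.1 ⟨d, hd, hs, x.2, hx⟩
    · rintro h p ⟨d, hd, hs, z, hz⟩
      exact h d hd hs _ hz

@[fun_prop]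
theorem polyPred_atom_wf {I : α → Instance} {t : α → Atom} (hI : PolyTime I) (ht : PolyTime t) :
    PolyPred fun a => (t a).WF (I a) := by
  simp only [Atom.wf_iff]
  fun_prop

@[fun_prop]
theorem polyPred_lit_wf {I : α → Instance} {t : α → Lit} (hI : PolyTime I) (ht : PolyTime t) :
    PolyPred fun a => (t a).WF (I a) :=
  (PolyPred.sum_elim (o := fun a => Lit.equiv (t a))
    (p := fun a p => p.1.Declared (I a).signs ∧ p.2.WF (I a))
    (q := fun a p => p.1.Declared (I a).cmps ∧ p.2.1.WF (I a) ∧ p.2.2.WF (I a))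
    (by fun_prop) (by fun_prop) (by fun_prop)).of_iff fun a => by cases t a <;> rfl

@[fun_prop]
theorem polyPred_aggElem_wf {I : α → Instance} {t : α → AggElem} (hI : PolyTime I)
    (ht : PolyTime t) : PolyPred fun a => (t a).WF (I a) :=
  PolyPred.and (PolyPred.forallMem (l := fun a => (t a).tuple) (p := fun a t => t.WF (I a))
    (by fun_prop) (by fun_prop)) (PolyPred.forallMem (l := fun a => (t a).cond)
    (p := fun a t => t.WF (I a)) (by fun_prop) (by fun_prop))

@[fun_prop]
theorem polyPred_bodyElem_wf {I : α → Instance} {t : α → BodyElem} (hI : PolyTime I)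
    (ht : PolyTime t) : PolyPred fun a => (t a).WF (I a) :=
  (PolyPred.sum_elim (o := fun a => BodyElem.equiv (t a))
    (p := fun a p => p.WF (I a))
    (q := fun a p => p.1.WF (I a) ∧ p.2.1.Declared (I a).aggs ∧ ForallMem p.2.2 fun e => e.WF (I a))
    (by fun_prop) (by fun_prop) (by fun_prop)).of_iff fun a => by cases t a <;> rfl

@[fun_prop]
theorem polyPred_rule_wf {I : α → Instance} {t : α → Rule} (hI : PolyTime I)
    (ht : PolyTime t) : PolyPred fun a => (t a).WF (I a) :=
  PolyPred.and (PolyPred.forallSome (o := fun a => (t a).head) (p := fun a t => t.WF (I a))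
    (by fun_prop) (by fun_prop)) (PolyPred.forallMem (l := fun a => (t a).body)
    (p := fun a t => t.WF (I a)) (by fun_prop) (by fun_prop))

theorem Instance.wf_iff (I : Instance) : I.WF ↔ (ForallMem I.rules fun r => r.WF I) ∧
    DeclsWF I.preds ∧ (ForallMem I.preds fun d => ForallMem d.dom fun x => ForallMem d.dom fun y =>
      x.1.arity = y.1.arity) ∧ DeclsWF I.signs ∧ DeclsWF I.cmps ∧ DeclsWF I.ariths ∧
    DeclsWF I.aggs ∧ ForallMem (I.pos ++ I.neg) fun e => ForallMem e fun a =>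
      a.pred.arity = a.args.length :=
  ⟨fun h => ⟨h.1, h.2, fun d hd _ hx _ hy => h.3 d hd _ _ ⟨_, hx⟩ ⟨_, hy⟩, h.4, h.5, h.6, h.7, h.8⟩,
    fun h => ⟨h.1, h.2.1, fun d hd _ _ ⟨_, hx⟩ ⟨_, hy⟩ => h.2.2.1 d hd _ hx _ hy, h.2.2.2.1,
      h.2.2.2.2.1, h.2.2.2.2.2.1, h.2.2.2.2.2.2.1, h.2.2.2.2.2.2.2⟩⟩

@[fun_prop]
theorem polyPred_instance_wf {I : α → Instance} (hI : PolyTime I) : PolyPred fun a => (I a).WF := by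
  simp only [Instance.wf_iff]
  fun_prop

theorem polyPred_inDom [Inhabited β] {ds : α → List (Decl β)} {l : α → List (Name × β)}
    (hds : PolyTime ds) (hl : PolyTime l) : PolyPred fun a => InDom (ds a) (lookup (l a)) :=
  PolyPred.forallMem (l := ds) (p := fun a d => d.Mem (lookup (l a) d.name)) hds (by fun_prop)

@[fun_prop]
theorem polyPred_valid {I : α → Instance} {D : α → SubstData} (hI : PolyTime I) (hD : PolyTime D) :
    PolyPred fun a => (substOf (D a)).Valid (I a) :=
  (PolyPred.and (polyPred_inDom (ds := fun a => (I a).preds) (l := fun a => (D a).1)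
    (by fun_prop) (by fun_prop)) <| PolyPred.and (polyPred_inDom (ds := fun a => (I a).signs)
    (l := fun a => (D a).2.1) (by fun_prop) (by fun_prop)) <| PolyPred.and (polyPred_inDom
    (ds := fun a => (I a).cmps) (l := fun a => (D a).2.2.1) (by fun_prop) (by fun_prop)) <|
    PolyPred.and (polyPred_inDom (ds := fun a => (I a).ariths) (l := fun a => (D a).2.2.2.1)
    (by fun_prop) (by fun_prop)) (polyPred_inDom (ds := fun a => (I a).aggs)
    (l := fun a => (D a).2.2.2.2) (by fun_prop) (by fun_prop))).of_iff fun a =>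
    ⟨fun h => ⟨h.1, h.2.1, h.2.2.1, h.2.2.2.1, h.2.2.2.2⟩, fun h => ⟨h.1, h.2, h.3, h.4, h.5⟩⟩

/-! ### Stratification by ranks -/

instance : DecidableEq Pred := Pred.equiv.decidableEq

instance {α : Type} [DecidableEq α] : DecidableEq (Sk α) := Sk.equiv.decidableEq

/-- The predicates of a literal. -/
def Lit.preds (l : Lit) : List (Sk Pred) := (Lit.equiv l).elim (fun p => [p.2.pred]) fun _ => []

/-- The predicates of a member of a body. -/
def BodyElem.preds (b : BodyElem) : List (Sk Pred) :=
  (BodyElem.equiv b).elim Lit.preds fun p => p.2.2.flatMap fun e => e.cond.flatMap Lit.preds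

theorem Lit.mentions_iff (l : Lit) (p : Sk Pred) : l.Mentions p ↔ p ∈ l.preds := by
  cases l <;> simp [Lit.Mentions, Lit.preds, Lit.equiv]

theorem BodyElem.mentions_iff (b : BodyElem) (p : Sk Pred) : b.Mentions p ↔ p ∈ b.preds := by
  cases b <;> simp [BodyElem.Mentions, BodyElem.preds, BodyElem.equiv, Lit.mentions_iff]

@[fun_prop]
theorem polyTime_lit_preds {l : α → Lit} (hl : PolyTime l) : PolyTime fun a => (l a).preds := by
  unfold Lit.preds
  fun_prop

@[fun_prop]
theorem polyTime_bodyElem_preds {l : α → BodyElem} (hl : PolyTime l) :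
    PolyTime fun a => (l a).preds := by
  unfold BodyElem.preds
  fun_prop

@[fun_prop]
theorem polyPred_inHead {I : α → Instance} {r : α → Rule} {p : α → Sk Pred} (hI : PolyTime I)
    (hr : PolyTime r) (hp : PolyTime p) : PolyPred fun a => (r a).InHead (I a) (p a) :=
  (PolyPred.existsSome (o := fun a => (r a).head) (p := fun a b => p a = b.pred ∨
    (Sk.equiv (p a)).elim (fun p' => b.pred.CanBe (I a).preds p') fun _ => False) (by fun_prop)
    (by fun_prop)).of_iff fun a => by
      refine exists_congr fun b => and_congr Iff.rfl (or_congr Iff.rfl ?_)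
      cases p a <;> simp [Sk.equiv]

@[fun_prop]
theorem polyPred_mentionsNeg {I : α → Instance} {b : α → BodyElem} {p : α → Sk Pred}
    (hI : PolyTime I) (hb : PolyTime b) (hp : PolyTime p) :
    PolyPred fun a => (b a).MentionsNeg (I a) (p a) :=
  (PolyPred.sum_elim (o := fun a => BodyElem.equiv (b a))
    (p := fun a l => (Lit.equiv l).elim (fun x => p a = x.2.pred ∧ x.1.CanBe (I a).signs false)
      fun _ => False)
    (q := fun a x => p a ∈ x.2.2.flatMap fun e => e.cond.flatMap Lit.preds)
    (by fun_prop) (by fun_prop) (by fun_prop)).of_iff fun a => by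
      rcases b a with (_ | _) | _
      · rfl
      · rfl
      · simp [BodyElem.equiv, BodyElem.MentionsNeg, Lit.mentions_iff]

@[fun_prop]
theorem polyPred_dep {I : α → Instance} {p q : α → Sk Pred} (hI : PolyTime I)
    (hp : PolyTime p) (hq : PolyTime q) : PolyPred fun a => (I a).Dep (p a) (q a) :=
  (PolyPred.or (p := fun a => ExistsMem (I a).rules fun r => r.InHead (I a) (p a) ∧
      ExistsMem r.body fun b => q a ∈ b.preds)
    (q := fun a => (Sk.equiv (p a)).elim (fun _ => False) fun s => (Sk.equiv (q a)).elim
      (fun q' => (p a).CanBe (I a).preds q') fun _ => False) (by fun_prop) (by fun_prop)).of_iff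
    fun a => by
      simp only [Instance.Dep, ExistsMem, BodyElem.mentions_iff]
      refine or_congr Iff.rfl ?_
      rcases p a with _ | _ <;> rcases q a with _ | _ <;> simp [Sk.equiv]

@[fun_prop]
theorem polyPred_negDep {I : α → Instance} {p q : α → Sk Pred} (hI : PolyTime I)
    (hp : PolyTime p) (hq : PolyTime q) : PolyPred fun a => (I a).NegDep (p a) (q a) :=
  PolyPred.existsMem (l := fun a => (I a).rules) (p := fun a r => r.InHead (I a) (p a) ∧
    ExistsMem r.body fun b => b.MentionsNeg (I a) (q a)) (by fun_prop) (by fun_prop)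

/-- All nodes of the graph of dependencies that have a neighbour. -/
def Instance.nodes (I : Instance) : List (Sk Pred) :=
  (I.rules.flatMap fun r => (r.head.map Atom.pred).toList ++ r.body.flatMap BodyElem.preds) ++
    I.preds.flatMap fun d => .sketched d.name :: d.dom.map fun x => .known x.1

@[fun_prop]
theorem polyTime_nodes {I : α → Instance} (hI : PolyTime I) : PolyTime fun a => (I a).nodes := by
  unfold Instance.nodes
  fun_prop

theorem Instance.mem_nodes_of_canBe {I : Instance} {s : Sk Pred} {p : Pred}
    (h : s.CanBe I.preds p) (hs : s ∈ I.nodes) : .known p ∈ I.nodes := by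
  rcases s with q | s
  · obtain rfl : p = q := h
    exact hs
  · obtain ⟨d, hd, -, z, hz⟩ := h
    exact List.mem_append_right _ (List.mem_flatMap.2
      ⟨d, hd, List.mem_cons_of_mem _ (List.mem_map.2 ⟨_, hz, rfl⟩)⟩)

/-- Ranks therefore need to be listed and checked only on a finite list, although there are
infinitely many predicates. -/
theorem Instance.Dep.mem_nodes {I : Instance} {p q : Sk Pred} (h : I.Dep p q) :
    p ∈ I.nodes ∧ q ∈ I.nodes := by
  rcases h with ⟨r, hr, ⟨a, ha, hp⟩, b, hb, hq⟩ | ⟨s, q', rfl, rfl, h⟩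
  · rw [BodyElem.mentions_iff] at hq
    have h₁ : a.pred ∈ I.nodes := List.mem_append_left _ (List.mem_flatMap.2
      ⟨r, hr, List.mem_append_left _ (by simp [ha])⟩)
    refine ⟨?_, List.mem_append_left _ (List.mem_flatMap.2
      ⟨r, hr, List.mem_append_right _ (List.mem_flatMap.2 ⟨b, hb, hq⟩)⟩)⟩
    rcases hp with rfl | ⟨p', rfl, hp⟩
    · exact h₁
    · exact mem_nodes_of_canBe hp h₁
  · have h₁ : Sk.sketched s ∈ I.nodes := by
      obtain ⟨d, hd, rfl, h⟩ := h
      exact List.mem_append_right _ (List.mem_flatMap.2 ⟨d, hd, by simp⟩)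
    exact ⟨h₁, mem_nodes_of_canBe h h₁⟩

theorem BodyElem.MentionsNeg.mentions {I : Instance} {b : BodyElem} {p : Sk Pred}
    (h : b.MentionsNeg I p) : b.Mentions p := by
  rcases b with (_ | _) | _
  · exact h.1
  · exact h.elim
  · exact h

theorem Instance.NegDep.dep {I : Instance} {p q : Sk Pred} (h : I.NegDep p q) : I.Dep p q :=
  let ⟨r, hr, hp, b, hb, hq⟩ := h
  .inl ⟨r, hr, hp, b, hb, hq.mentions⟩

/-- A ranking witnesses that the dependencies are stratified. -/
def Instance.Ranked (I : Instance) (ρ : Sk Pred → ℕ) : Prop :=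
  ∀ p q, (I.Dep p q → ρ q ≤ ρ p) ∧ (I.NegDep p q → ρ q < ρ p)

/-- Ranks never increase along a path, so a path cannot return after a strict decrease. -/
theorem Instance.Ranked.stratified {I : Instance} {ρ : Sk Pred → ℕ} (h : I.Ranked ρ) :
    I.Stratified := by
  intro p q hn hq
  have : ρ p ≤ ρ q := by
    clear hn
    induction hq with
    | refl => exact le_rfl
    | tail _ hd ih => exact ((h _ _).1 hd).trans ih
  have := (h _ _).2 hn
  omega

/-- The rank counts the nodes reachable from `p`. It does not increase along dependencies. Along a
negative one from `p` to `q` it drops, as `p` is reachable from itself but, by stratification, not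
from `q`. -/
theorem Instance.Stratified.ranked {I : Instance} (h : I.Stratified) :
    ∃ ρ, I.Ranked ρ ∧ ∀ p, ρ p ≤ I.nodes.length := by
  classical
  let R (p : Sk Pred) : Finset (Sk Pred) :=
    I.nodes.toFinset.filter fun q => Relation.ReflTransGen I.Dep p q
  have hR {p q} (hd : I.Dep p q) : R q ⊆ R p := fun x hx => by
    simp only [R, Finset.mem_filter] at hx ⊢
    exact ⟨hx.1, .head hd hx.2⟩
  refine ⟨fun p => (R p).card, fun p q => ⟨fun hd => Finset.card_le_card (hR hd), fun hn =>
    Finset.card_lt_card ⟨hR hn.dep, fun hs => h p q hn ?_⟩⟩, fun p => ?_⟩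
  · have : p ∈ R p := Finset.mem_filter.2 ⟨List.mem_toFinset.2 hn.dep.mem_nodes.1, .refl⟩
    exact (Finset.mem_filter.1 (hs this)).2
  · exact (Finset.card_filter_le _ _).trans (List.toFinset_card_le _)

/-- The rank of a predicate, as given by an association list. -/
def rankOf (l : List (Sk Pred × ℕ)) (p : Sk Pred) : ℕ := (l.find p).getD 0

@[fun_prop]
theorem polyTime_rankOf {l : α → List (Sk Pred × ℕ)} {p : α → Sk Pred} (hl : PolyTime l)
    (hp : PolyTime p) : PolyTime fun a => rankOf (l a) (p a) := by
  unfold rankOf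
  fun_prop

@[fun_prop]
theorem polyPred_ranked {I : α → Instance} {l : α → List (Sk Pred × ℕ)} (hI : PolyTime I)
    (hl : PolyTime l) : PolyPred fun a => (I a).Ranked (rankOf (l a)) :=
  (PolyPred.forallMem (l := fun a => (I a).nodes) (p := fun a p => ForallMem (I a).nodes fun q =>
    Implies ((I a).Dep p q) (rankOf (l a) q ≤ rankOf (l a) p) ∧
    Implies ((I a).NegDep p q) (rankOf (l a) q < rankOf (l a) p)) (by fun_prop)
    (by fun_prop)).of_iff fun a =>
    ⟨fun h p q => ⟨fun hd => (h p hd.mem_nodes.1 q hd.mem_nodes.2).1 hd, fun hd =>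
      (h p hd.dep.mem_nodes.1 q hd.dep.mem_nodes.2).2 hd⟩, fun h p _ q _ => h p q⟩

theorem find_map_self {α β : Type} [DecidableEq α] (l : List α) (f : α → β) {a : α} (h : a ∈ l) :
    (l.map fun x => (x, f x)).find a = some (f a) := by
  rw [List.find]
  induction l with
  | nil => simp at h
  | cons x l ih =>
    by_cases hx : x = a
    · simp [hx]
    · have := ih (by simpa [Ne.symm hx] using h)
      simpa [hx] using this

theorem Instance.Ranked.congr {I : Instance} {ρ σ : Sk Pred → ℕ} (h : I.Ranked ρ)
    (hs : ∀ p ∈ I.nodes, σ p = ρ p) : I.Ranked σ := fun p q =>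
  ⟨fun hd => by
    rw [hs p hd.mem_nodes.1, hs q hd.mem_nodes.2]
    exact (h p q).1 hd, fun hd => by
    rw [hs p hd.dep.mem_nodes.1, hs q hd.dep.mem_nodes.2]
    exact (h p q).2 hd⟩

end SkASP

/-! ### Stratified operators -/

namespace StackProg

variable {G : Type*}

/-- `Y` is closed under the operator `T X`. -/
def Closed (T : Set G → Set G → G → Prop) (X Y : Set G) : Prop := ∀ g, T X Y g → g ∈ Y

/-- The least set that is closed under the operator `T X`. -/
def leastClosed (T : Set G → Set G → G → Prop) (X : Set G) : Set G :=
  {g | ∀ Y, Closed T X Y → g ∈ Y}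

/-- The operator `T` respects the ranks: `T X Y g` depends positively on the elements of `Y` whose
rank does not exceed that of `g`, and on the elements of `X` of smaller rank. -/
def Local (ρ : G → ℕ) (T : Set G → Set G → G → Prop) : Prop :=
  ∀ g X X' Y Y', (∀ h, ρ h < ρ g → (h ∈ X ↔ h ∈ X')) → (∀ h, ρ h ≤ ρ g → h ∈ Y → h ∈ Y') →
    T X Y g → T X' Y' g

variable {ρ : G → ℕ} {T : Set G → Set G → G → Prop}

/-- Locality with equal first arguments says that `T X` is monotone, so an intersection of closed
sets is closed. -/
theorem Local.closed (h : Local ρ T) (X : Set G) : Closed T X (leastClosed T X) :=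
  fun g hg Y hY => hY g (h g X X (leastClosed T X) Y (fun _ _ => Iff.rfl) (fun _ _ hh => hh Y hY) hg)

/-- The set of all `g` with `ρ g ≤ n → g ∈ leastClosed T X'` is closed under `T X`: above rank `n`
the condition is void, and up to rank `n` locality allows `X` to be replaced by `X'`. -/
theorem Local.leastClosed_subset (h : Local ρ T) {n : ℕ} {X X' : Set G}
    (hX : ∀ g, ρ g < n → (g ∈ X ↔ g ∈ X')) {g : G} (hg : ρ g ≤ n) (hm : g ∈ leastClosed T X) :
    g ∈ leastClosed T X' := by
  refine hm {g | ρ g ≤ n → g ∈ leastClosed T X'} (fun g' ht hn => ?_) hg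
  exact h.closed X' g' (h g' X X' {g | ρ g ≤ n → g ∈ leastClosed T X'} _ (fun k hk => hX k (by omega))
    (fun k hk hk' => hk' (by omega)) ht)

theorem Local.leastClosed_congr (h : Local ρ T) {n : ℕ} {X X' : Set G}
    (hX : ∀ g, ρ g < n → (g ∈ X ↔ g ∈ X')) {g : G} (hg : ρ g ≤ n) :
    g ∈ leastClosed T X ↔ g ∈ leastClosed T X' :=
  ⟨h.leastClosed_subset hX hg, h.leastClosed_subset (fun g hg => (hX g hg).symm) hg⟩

/-- Fixed points that agree below rank `n` also agree at rank `n`. -/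
theorem Local.unique (h : Local ρ T) {X X' : Set G} (hX : leastClosed T X = X)
    (hX' : leastClosed T X' = X') : X = X' := by
  have key (n : ℕ) : ∀ g, ρ g < n → (g ∈ X ↔ g ∈ X') := by
    induction n with
    | zero => simp
    | succ n ih =>
      intro g hg
      have := h.leastClosed_congr ih (Nat.lt_succ_iff.1 hg)
      rwa [hX, hX'] at this
  ext g
  exact key _ g (Nat.lt_succ_self _)

/-- Iteration starts from the empty set. The `n`-th iterate is final on ranks below `n`, so the
fixed point consults the iterate `ρ g + 1` about `g`. -/
theorem Local.exists (h : Local ρ T) : ∃ X, leastClosed T X = X := by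
  let M (n : ℕ) : Set G := (leastClosed T)^[n] ∅
  have hM (n : ℕ) : M (n + 1) = leastClosed T (M n) := Function.iterate_succ_apply' _ _ _
  have h₁ (n : ℕ) : ∀ g, ρ g < n → (g ∈ M n ↔ g ∈ M (n + 1)) := by
    induction n with
    | zero => simp
    | succ n ih =>
      intro g hg
      rw [hM, hM (n + 1)]
      exact h.leastClosed_congr ih (Nat.lt_succ_iff.1 hg)
  have h₂ (n k : ℕ) : ∀ g, ρ g < n → (g ∈ M n ↔ g ∈ M (n + k)) := by
    induction k with
    | zero => simp
    | succ k ih =>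
      intro g hg
      rw [ih g hg]
      exact h₁ (n + k) g (by omega)
  refine ⟨{g | g ∈ M (ρ g + 1)}, Set.ext fun g => ?_⟩
  have h₃ : ∀ g', ρ g' < ρ g → (g' ∈ {g | g ∈ M (ρ g + 1)} ↔ g' ∈ M (ρ g)) := by
    intro g' hg'
    have := h₂ (ρ g' + 1) (ρ g - ρ g' - 1) g' (Nat.lt_succ_self _)
    rwa [show ρ g' + 1 + (ρ g - ρ g' - 1) = ρ g by omega] at this
  rw [h.leastClosed_congr h₃ le_rfl, ← hM]
  rfl

theorem leastClosed_eq_iff {X : Set G} (h : Local ρ T) :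
    leastClosed T X = X ↔ Closed T X X ∧ ∀ Y, Closed T X Y → X ⊆ Y := by
  constructor
  · intro hX
    refine ⟨?_, fun Y hY g hg => ?_⟩
    · have := h.closed X
      rwa [hX] at this
    · rw [← hX] at hg
      exact hg Y hY
  · exact fun ⟨h₁, h₂⟩ => Set.Subset.antisymm (fun g hg => hg X h₁) fun g hg Y hY => h₂ Y hY hg

/-! ### Finite derivations as lists -/

/-- Every element of the list is derived from the later ones. -/
def Founded (D : List G → G → Prop) : List G → Prop
  | [] => True
  | g :: l => D l g ∧ Founded D l

theorem Founded.mem {D : List G → G → Prop} {l : List G} (hl : Founded D l) {Y : Set G}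
    (hY : ∀ l g, (∀ h ∈ l, h ∈ Y) → D l g → g ∈ Y) : ∀ g ∈ l, g ∈ Y := by
  induction l with
  | nil => simp
  | cons g l ih =>
    have := ih hl.2
    intro h hh
    rcases List.mem_cons.1 hh with rfl | hh
    · exact hY l _ this hl.1
    · exact this h hh

/-- A longest founded list without repetitions contains all that it derives, since otherwise it
could be extended. Lengths are bounded because the entries are among those of `H`. -/
theorem exists_founded {D : List G → G → Prop} {H : List G} (hH : ∀ l g, D l g → g ∈ H) :
    ∃ l : List G, l.Nodup ∧ (∀ g ∈ l, g ∈ H) ∧ Founded D l ∧ ∀ g, D l g → g ∈ l := by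
  classical
  let P (n : ℕ) : Prop := ∃ l : List G, l.Nodup ∧ (∀ g ∈ l, g ∈ H) ∧ Founded D l ∧ l.length = n
  have hP : ∀ n, P n → n ≤ H.length := by
    rintro n ⟨l, h₁, h₂, -, rfl⟩
    exact (List.subperm_of_subset h₁ h₂).length_le
  have h0 : P 0 := ⟨[], by simp, by simp, trivial, rfl⟩
  obtain ⟨l, h₁, h₂, h₃, h₄⟩ := Nat.findGreatest_spec (P := P) (Nat.zero_le H.length) h0
  refine ⟨l, h₁, h₂, h₃, fun g hg => ?_⟩
  by_contra hgl
  have h₅ : P (l.length + 1) := ⟨g :: l, by simp [h₁, hgl], by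
    simpa using ⟨hH l g hg, h₂⟩, ⟨hg, h₃⟩, rfl⟩
  have := Nat.le_findGreatest (hP _ h₅) h₅
  omega

end StackProg

/-! ### Answer sets of stratified programs -/

namespace SkASP

open StackProg

/-- `g` is a fact or follows by a rule of the reduct. -/
def Instance.Derives (I : Instance) (θ : Subst) (e : List GAtom) (X Y : Set GAtom) (g : GAtom) :
    Prop :=
  g ∈ e ∨ ∃ r ∈ I.rules, ∃ a, r.head = some a ∧ a.eval θ = some g ∧ ∀ b ∈ r.body, b.Holds θ X Y

theorem Instance.reductModel_iff {I : Instance} {θ : Subst} {e : List GAtom} {X Y : Set GAtom} :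
    I.ReductModel θ e X Y ↔ Closed (I.Derives θ e) X Y := by
  constructor
  · rintro ⟨h₁, h₂⟩ g (hg | ⟨r, hr, a, ha, hg, hb⟩)
    exacts [h₁ g hg, h₂ r hr a g ha hg hb]
  · exact fun h => ⟨fun g hg => h g (.inl hg), fun r hr a g ha hg hb =>
      h g (.inr ⟨r, hr, a, ha, hg, hb⟩)⟩

theorem Atom.eval_pred {θ : Subst} {a : Atom} {g : GAtom} (h : a.eval θ = some g) :
    g.pred = a.pred.subst θ.pred := by
  rw [Atom.eval, Option.map_eq_some_iff] at h
  obtain ⟨l, -, rfl⟩ := h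
  rfl

theorem Sk.canBe_subst {α : Type} {ds : List (Decl α)} {f : Name → α} (hf : InDom ds f)
    {s : Sk α} (hs : s.Declared ds) : s.CanBe ds (s.subst f) := by
  cases s with
  | known a => rfl
  | sketched s =>
    obtain ⟨d, hd, rfl⟩ := hs
    exact ⟨d, hd, rfl, hf d hd⟩

theorem Lit.Holds.imp {θ : Subst} {X X' Y Y' : Set GAtom} {l : Lit}
    (hX : ∀ s a g, l = .atom s a → a.eval θ = some g → s.subst θ.sign = false → g ∈ X' → g ∈ X)
    (hY : ∀ s a g, l = .atom s a → a.eval θ = some g → g ∈ Y → g ∈ Y')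
    (h : l.Holds θ X Y) : l.Holds θ X' Y' := by
  cases l with
  | cmp o l r => exact h
  | atom s a =>
    obtain ⟨g, hg, h⟩ := h
    refine ⟨g, hg, ?_⟩
    split_ifs at h ⊢ with hs
    · exact hY s a g rfl hg h
    · exact fun h' => h (hX s a g rfl hg (by simpa using hs) h')

theorem aggTuples_subset {θ : Subst} {X X' : Set GAtom} {es : List AggElem}
    (h : ∀ e ∈ es, ∀ l ∈ e.cond, ∀ s a g, l = .atom s a → a.eval θ = some g → (g ∈ X ↔ g ∈ X')) :
    aggTuples θ X es ⊆ aggTuples θ X' es := fun _ ⟨e, he, ht, hc⟩ =>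
  ⟨e, he, ht, fun l hl => (hc l hl).imp (fun s a g h₁ h₂ _ => (h e he l hl s a g h₁ h₂).2)
    fun s a g h₁ h₂ => (h e he l hl s a g h₁ h₂).1⟩

theorem aggTuples_congr {θ : Subst} {X X' : Set GAtom} {es : List AggElem}
    (h : ∀ e ∈ es, ∀ l ∈ e.cond, ∀ s a g, l = .atom s a → a.eval θ = some g → (g ∈ X ↔ g ∈ X')) :
    aggTuples θ X es = aggTuples θ X' es :=
  (aggTuples_subset h).antisymm (aggTuples_subset fun e he l hl s a g h₁ h₂ =>
    (h e he l hl s a g h₁ h₂).symm)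

theorem BodyElem.Holds.mono {θ : Subst} {X Y Y' : Set GAtom} (hY : Y ⊆ Y') {b : BodyElem}
    (h : b.Holds θ X Y) : b.Holds θ X Y' := by
  cases b with
  | lit l => exact Lit.Holds.imp (fun _ _ _ _ _ _ h => h) (fun _ _ _ _ _ h => hY h) h
  | agg t o es => exact h

theorem Instance.Derives.mono {I : Instance} {θ : Subst} {e : List GAtom} {X Y Y' : Set GAtom}
    (hY : Y ⊆ Y') {g : GAtom} (h : I.Derives θ e X Y g) : I.Derives θ e X Y' g :=
  h.imp_right fun ⟨r, hr, a, ha, hg, hb⟩ => ⟨r, hr, a, ha, hg, fun b hb' => (hb b hb').mono hY⟩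

/-- A ground atom has the rank of its predicate. Atoms below `not` or inside aggregates are looked
up in `X` and rank strictly below the head; those looked up in `Y` rank at most as high. A sketched
atom is covered because its sketched predicate depends on every value that it can take. -/
theorem Instance.Ranked.local {I : Instance} {ρ : Sk Pred → ℕ} (hρ : I.Ranked ρ) (hI : I.WF)
    {θ : Subst} (hθ : θ.Valid I) (e : List GAtom) :
    Local (fun g => ρ (.known g.pred)) (I.Derives θ e) := by
  intro g X X' Y Y' hX hY h
  refine h.imp_right fun ⟨r, hr, a, ha, hg, hb⟩ => ⟨r, hr, a, ha, hg, fun b hbr => ?_⟩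
  have hrw := hI.rules r hr
  -- The predicate chosen for a sketched head counts as a head of the rule itself, so the
  -- dependencies on the body start directly from it.
  have hhead : r.InHead I (.known g.pred) := by
    refine ⟨a, ha, .inr ⟨_, rfl, ?_⟩⟩
    rw [Atom.eval_pred hg]
    exact Sk.canBe_subst hθ.pred (hrw.1 a ha).1
  have hval {c : Atom} {k : GAtom} (hc : c.WF I) (hk : c.eval θ = some k) :
      ρ (.known k.pred) ≤ ρ c.pred := by
    rw [Atom.eval_pred hk]
    have h₁ := Sk.canBe_subst hθ.pred hc.1
    generalize c.pred = s at h₁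
    cases s with
    | known p => exact le_rfl
    | sketched s => exact (hρ _ _).1 (.inr ⟨s, _, rfl, rfl, h₁⟩)
  have hpos {p : Sk Pred} (hp : b.Mentions p) : ρ p ≤ ρ (.known g.pred) :=
    (hρ _ _).1 (.inl ⟨r, hr, hhead, b, hbr, hp⟩)
  have hneg {p : Sk Pred} (hp : b.MentionsNeg I p) : ρ p < ρ (.known g.pred) :=
    (hρ _ _).2 ⟨r, hr, hhead, b, hbr, hp⟩
  have hb' := hb b hbr
  have hbw := hrw.2 b hbr
  rcases b with l | ⟨t, o, es⟩
  · refine Lit.Holds.imp ?_ ?_ hb'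
    · rintro s c k rfl hk hs
      refine (hX k ((hval hbw.2 hk).trans_lt (hneg ⟨rfl, ?_⟩))).2
      have := Sk.canBe_subst hθ.sign hbw.1
      rwa [hs] at this
    · rintro s c k rfl hk
      exact hY k ((hval hbw.2 hk).trans (hpos rfl))
  · have : aggTuples θ X es = aggTuples θ X' es := by
      refine aggTuples_congr ?_
      rintro e he l hl s c k rfl hk
      have hw := (hbw.2.2 e he).2 _ hl
      exact hX k ((hval hw.2 hk).trans_lt (hneg ⟨e, he, _, hl, rfl⟩))
    simpa only [BodyElem.Holds, this] using hb'

/-- `X` is the least model of its reduct; integrity constraints are ignored. -/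
def Instance.Stable (I : Instance) (θ : Subst) (e : List GAtom) (X : Set GAtom) : Prop :=
  I.ReductModel θ e X X ∧ ∀ Y, I.ReductModel θ e X Y → X ⊆ Y

/-- `X` satisfies the integrity constraints. -/
def Instance.Constraints (I : Instance) (θ : Subst) (X : Set GAtom) : Prop :=
  ∀ r ∈ I.rules, r.head = none → ¬ ∀ b ∈ r.body, b.Holds θ X X

theorem Instance.answerSet_iff {I : Instance} {θ : Subst} {e : List GAtom} {X : Set GAtom} :
    I.AnswerSet θ e X ↔ I.Stable θ e X ∧ I.Constraints θ X := (and_assoc).symm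

theorem Instance.Ranked.stable_iff {I : Instance} {ρ : Sk Pred → ℕ} (hρ : I.Ranked ρ) (hI : I.WF)
    {θ : Subst} (hθ : θ.Valid I) {e : List GAtom} {X : Set GAtom} :
    I.Stable θ e X ↔ leastClosed (I.Derives θ e) X = X := by
  rw [leastClosed_eq_iff (hρ.local hI hθ e), Stable]
  simp only [reductModel_iff]

/-- Uniqueness makes negative examples checkable: a constraint violated in the one stable model
excludes all answer sets. -/
theorem Instance.Ranked.existsUnique_stable {I : Instance} {ρ : Sk Pred → ℕ} (hρ : I.Ranked ρ)
    (hI : I.WF) {θ : Subst} (hθ : θ.Valid I) (e : List GAtom) : ∃! X, I.Stable θ e X := by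
  simp only [hρ.stable_iff hI hθ]
  obtain ⟨X, hX⟩ := (hρ.local hI hθ e).exists
  exact ⟨X, hX, fun Y hY => (hρ.local hI hθ e).unique hY hX⟩

/-- The facts and the heads of rules. -/
def Instance.heads (I : Instance) (θ : Subst) (e : List GAtom) : List GAtom :=
  e ++ I.rules.filterMap fun r => r.head.bind fun a => a.eval θ

theorem Instance.Derives.mem_heads {I : Instance} {θ : Subst} {e : List GAtom} {X Y : Set GAtom}
    {g : GAtom} (h : I.Derives θ e X Y g) : g ∈ I.heads θ e := by
  rcases h with h | ⟨r, hr, a, ha, hg, -⟩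
  · exact List.mem_append_left _ h
  · exact List.mem_append_right _ (List.mem_filterMap.2 ⟨r, hr, by simp [ha, hg]⟩)

/-- The list `l` is a model of its reduct in which every atom is derived from later ones. -/
def Instance.StableList (I : Instance) (θ : Subst) (e : List GAtom) (l : List GAtom) : Prop :=
  I.ReductModel θ e (interp l) (interp l) ∧
    Founded (fun k g => I.Derives θ e (interp l) (interp k) g) l

/-- Along the derivations, every model of the reduct contains the whole list. Leastness is thus
certified without a quantifier over models. -/
theorem Instance.StableList.stable {I : Instance} {θ : Subst} {e : List GAtom} {l : List GAtom}
    (h : I.StableList θ e l) : I.Stable θ e (interp l) := by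
  refine ⟨h.1, fun Y hY => h.2.mem fun k g hk hg => ?_⟩
  rw [reductModel_iff] at hY
  exact hY g (hg.mono hk)

/-- A founded list that contains all it derives is a model of the reduct, so it contains `X`; being
derived within the model `X`, it is also contained in it. -/
theorem Instance.Stable.exists_list {I : Instance} {θ : Subst} {e : List GAtom} {X : Set GAtom}
    (h : I.Stable θ e X) : ∃ l, l.Nodup ∧ (∀ g ∈ l, g ∈ I.heads θ e) ∧ interp l = X ∧
      I.StableList θ e l := by
  obtain ⟨l, h₁, h₂, h₃, h₄⟩ := exists_founded (D := fun k g => I.Derives θ e X (interp k) g)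
    (H := I.heads θ e) fun k g => Derives.mem_heads
  have h₅ : interp l = X := by
    refine Set.Subset.antisymm ?_ (h.2 _ (reductModel_iff.2 h₄))
    exact h₃.mem fun k g hk hg => reductModel_iff.1 h.1 g (hg.mono hk)
  refine ⟨l, h₁, h₂, h₅, ?_⟩
  rw [StableList, h₅]
  exact ⟨h.1, h₃⟩

/-! ### Only the values of the declared variables matter -/

/-- Two substitutions agree on all declared variables. -/
structure Instance.Agree (I : Instance) (θ η : Subst) : Prop where
  pred : ∀ d ∈ I.preds, θ.pred d.name = η.pred d.name
  sign : ∀ d ∈ I.signs, θ.sign d.name = η.sign d.name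
  cmp : ∀ d ∈ I.cmps, θ.cmp d.name = η.cmp d.name
  arith : ∀ d ∈ I.ariths, θ.arith d.name = η.arith d.name
  agg : ∀ d ∈ I.aggs, θ.agg d.name = η.agg d.name

theorem Sk.subst_congr {α : Type} {ds : List (Decl α)} {f g : Name → α}
    (h : ∀ d ∈ ds, f d.name = g d.name) {s : Sk α} (hs : s.Declared ds) : s.subst f = s.subst g := by
  cases s with
  | known a => rfl
  | sketched s =>
    obtain ⟨d, hd, rfl⟩ := hs
    exact h d hd

variable {I : Instance} {θ η : Subst}

namespace Instance.Agree

theorem term (h : I.Agree θ η) {t : Term} (ht : t.WF I) : t.eval θ = t.eval η := by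
  induction t with
  | const c => rfl
  | op o l r ihl ihr =>
    rw [Term.eval, Term.eval, ihl ht.2.1, ihr ht.2.2, Sk.subst_congr h.arith ht.1]

theorem mapM {ts : List Term} (h : I.Agree θ η) (ht : ∀ t ∈ ts, t.WF I) :
    ts.mapM (Term.eval θ) = ts.mapM (Term.eval η) := by
  induction ts with
  | nil => rfl
  | cons t ts ih =>
    rw [List.mapM_cons, List.mapM_cons, h.term (ht t (by simp)),
      ih fun t' ht' => ht t' (by simp [ht'])]

theorem atom (h : I.Agree θ η) {a : Atom} (ha : a.WF I) : a.eval θ = a.eval η := by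
  rw [Atom.eval, Atom.eval, h.mapM ha.2.2, Sk.subst_congr h.pred ha.1]

theorem lit (h : I.Agree θ η) {l : Lit} (hl : l.WF I) {X Y : Set GAtom} :
    l.Holds θ X Y ↔ l.Holds η X Y := by
  cases l with
  | atom s a => rw [Lit.Holds, Lit.Holds, h.atom hl.2, Sk.subst_congr h.sign hl.1]
  | cmp o l r =>
    rw [Lit.Holds, Lit.Holds, h.term hl.2.1, h.term hl.2.2, Sk.subst_congr h.cmp hl.1]

theorem tuples (h : I.Agree θ η) {es : List AggElem} (hes : ∀ e ∈ es, e.WF I) {X : Set GAtom} :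
    aggTuples θ X es = aggTuples η X es := by
  ext t
  refine exists_congr fun e => and_congr_right fun he => ?_
  rw [h.mapM (hes e he).1]
  exact and_congr_right fun _ => forall₂_congr fun l hl => h.lit ((hes e he).2 l hl)

theorem bodyElem (h : I.Agree θ η) {b : BodyElem} (hb : b.WF I) {X Y : Set GAtom} :
    b.Holds θ X Y ↔ b.Holds η X Y := by
  cases b with
  | lit l => exact h.lit hb
  | agg t o es =>
    rw [BodyElem.Holds, BodyElem.Holds, h.term hb.1, h.tuples hb.2.2, Sk.subst_congr h.agg hb.2.1]

theorem body (h : I.Agree θ η) {r : Rule} (hr : r.WF I) {X Y : Set GAtom} :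
    (∀ b ∈ r.body, b.Holds θ X Y) ↔ ∀ b ∈ r.body, b.Holds η X Y :=
  forall₂_congr fun b hb => h.bodyElem (hr.2 b hb)

theorem reductModel (h : I.Agree θ η) (hI : I.WF) {e : List GAtom} {X Y : Set GAtom} :
    I.ReductModel θ e X Y ↔ I.ReductModel η e X Y := by
  refine and_congr Iff.rfl (forall₂_congr fun r hr => forall₂_congr fun a g =>
    forall_congr' fun ha => ?_)
  rw [h.atom ((hI.rules r hr).1 a ha), h.body (hI.rules r hr)]

theorem answerSet (h : I.Agree θ η) (hI : I.WF) {e : List GAtom} {X : Set GAtom} :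
    I.AnswerSet θ e X ↔ I.AnswerSet η e X := by
  refine and_congr (h.reductModel hI) (and_congr (forall_congr' fun Y => ?_)
    (forall₂_congr fun r hr => forall_congr' fun _ => ?_))
  · rw [h.reductModel hI]
  · rw [h.body (hI.rules r hr)]

/-- Substitutions are defined on all names; this permits replacing one by finite data that fit into
a certificate. -/
theorem satisfying (h : I.Agree θ η) (hI : I.WF) (hs : I.Satisfying θ) : I.Satisfying η := by
  obtain ⟨hv, h₁, h₂⟩ := hs
  simp only [h.answerSet hI] at h₁ h₂
  refine ⟨⟨fun d hd => ?_, fun d hd => ?_, fun d hd => ?_, fun d hd => ?_, fun d hd => ?_⟩, h₁, h₂⟩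
  · rw [← h.pred d hd]; exact hv.pred d hd
  · rw [← h.sign d hd]; exact hv.sign d hd
  · rw [← h.cmp d hd]; exact hv.cmp d hd
  · rw [← h.arith d hd]; exact hv.arith d hd
  · rw [← h.agg d hd]; exact hv.agg d hd

end Instance.Agree

/-! ### Optimal solutions exist -/

open Classical in
/-- The sum of the preferences for the values of declared variables. -/
noncomputable def total {α : Type} (ds : List (Decl α)) (f : Name → α) : ℤ :=
  (ds.map fun d => (d.dom.find (f d.name)).getD 0).sum

theorem find_of_mem {α β : Type} [DecidableEq α] {l : List (α × β)} (hl : (l.map Prod.fst).Nodup)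
    {a : α} {b : β} (h : (a, b) ∈ l) : l.find a = some b := by
  rw [List.find]
  induction l with
  | nil => simp at h
  | cons x l ih =>
    rw [List.map_cons, List.nodup_cons] at hl
    rcases List.mem_cons.1 h with rfl | h
    · simp
    · have hx : x.1 ≠ a := fun hx => hl.1 (hx ▸ List.mem_map.2 ⟨_, h, rfl⟩)
      simpa [hx] using ih hl.2 h

theorem mem_of_find {α β : Type} [DecidableEq α] {l : List (α × β)}
    {a : α} {b : β} (h : l.find a = some b) : (a, b) ∈ l := by
  have := List.mem_of_mem_head? h
  simpa using this

/-- Values outside a domain count as zero, so the sum of the absolute values of all preferences is a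
bound for every `f`. -/
theorem total_le {α : Type} (ds : List (Decl α)) : ∃ C, ∀ f, total ds f ≤ C := by
  classical
  induction ds with
  | nil => exact ⟨0, fun f => le_rfl⟩
  | cons d ds ih =>
    obtain ⟨C, hC⟩ := ih
    refine ⟨(d.dom.map fun x => |x.2|).sum + C, fun f => ?_⟩
    rw [total, List.map_cons, List.sum_cons]
    refine add_le_add ?_ (hC f)
    have h₀ : ∀ x ∈ d.dom.map fun x => |x.2|, (0 : ℤ) ≤ x := by
      simp only [List.mem_map]
      rintro _ ⟨x, -, rfl⟩
      exact abs_nonneg _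
    cases h : d.dom.find (f d.name) with
    | none => exact List.sum_nonneg h₀
    | some z =>
      have := List.single_le_sum h₀ |z| (List.mem_map.2 ⟨_, mem_of_find h, rfl⟩)
      exact (le_abs_self z).trans this

/-- As no value is listed twice in a domain, the preference that `find` returns is the one that
`PrefGE` and `PrefGT` compare. -/
theorem PrefGE.total_le {α : Type} {ds : List (Decl α)} (hds : ∀ d ∈ ds, (d.dom.map Prod.fst).Nodup)
    {f g : Name → α} (hf : InDom ds f) (hg : InDom ds g) (h : PrefGE ds f g) :
    total ds g ≤ total ds f ∧ (PrefGT ds f g → total ds g < total ds f) := by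
  classical
  have key : ∀ d ∈ ds, ∃ y z, (f d.name, y) ∈ d.dom ∧ (g d.name, z) ∈ d.dom ∧
      d.dom.find (f d.name) = some y ∧ d.dom.find (g d.name) = some z := by
    intro d hd
    obtain ⟨y, hy⟩ := hf d hd
    obtain ⟨z, hz⟩ := hg d hd
    exact ⟨y, z, hy, hz, find_of_mem (hds d hd) hy, find_of_mem (hds d hd) hz⟩
  have h₁ : ∀ d ∈ ds, (d.dom.find (g d.name)).getD 0 ≤ (d.dom.find (f d.name)).getD 0 := by
    intro d hd
    obtain ⟨y, z, hy, hz, h₁, h₂⟩ := key d hd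
    rw [h₁, h₂]
    exact h d hd y z hy hz
  refine ⟨List.sum_le_sum h₁, ?_⟩
  rintro ⟨d, hd, y, z, hy, hz, hlt⟩
  refine List.sum_lt_sum _ _ h₁ ⟨d, hd, ?_⟩
  rw [find_of_mem (hds d hd) hy, find_of_mem (hds d hd) hz]
  exact hlt

/-- The sum of all preferences. -/
noncomputable def Instance.total (I : Instance) (θ : Subst) : ℤ :=
  SkASP.total I.preds θ.pred + SkASP.total I.signs θ.sign + SkASP.total I.cmps θ.cmp +
    SkASP.total I.ariths θ.arith + SkASP.total I.aggs θ.agg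

theorem Instance.Preferred.total_lt (hI : I.WF) (hθ : θ.Valid I) (hη : η.Valid I)
    (h : I.Preferred η θ) : I.total θ < I.total η := by
  obtain ⟨⟨h₁, h₂, h₃, h₄, h₅⟩, h⟩ := h
  replace h₁ := h₁.total_le hI.preds.2 hη.pred hθ.pred
  replace h₂ := h₂.total_le hI.signs.2 hη.sign hθ.sign
  replace h₃ := h₃.total_le hI.cmps.2 hη.cmp hθ.cmp
  replace h₄ := h₄.total_le hI.ariths.2 hη.arith hθ.arith
  replace h₅ := h₅.total_le hI.aggs.2 hη.agg hθ.agg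
  unfold Instance.total
  rcases h with h | h | h | h | h
  · have := h₁.2 h; omega
  · have := h₂.2 h; omega
  · have := h₃.2 h; omega
  · have := h₄.2 h; omega
  · have := h₅.2 h; omega

/-- The total is an integer and bounded, hence attains a maximum over the satisfying substitutions;
a preferred one would exceed it. -/
theorem Instance.exists_solution_iff (hI : I.WF) :
    (∃ θ, I.Solution θ) ↔ ∃ θ, I.Satisfying θ := by
  refine ⟨fun ⟨θ, h⟩ => ⟨θ, h.1⟩, fun ⟨θ, h⟩ => ?_⟩
  obtain ⟨C₁, hC₁⟩ := total_le I.preds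
  obtain ⟨C₂, hC₂⟩ := total_le I.signs
  obtain ⟨C₃, hC₃⟩ := total_le I.cmps
  obtain ⟨C₄, hC₄⟩ := total_le I.ariths
  obtain ⟨C₅, hC₅⟩ := total_le I.aggs
  obtain ⟨n, ⟨η, hη, rfl⟩, hn⟩ := Int.exists_greatest_of_bdd
    (P := fun n => ∃ θ, I.Satisfying θ ∧ I.total θ = n)
    ⟨C₁ + C₂ + C₃ + C₄ + C₅, by
      rintro _ ⟨θ, -, rfl⟩
      have h₁ := hC₁ θ.pred
      have h₂ := hC₂ θ.sign
      have h₃ := hC₃ θ.cmp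
      have h₄ := hC₄ θ.arith
      have h₅ := hC₅ θ.agg
      unfold Instance.total
      omega⟩ ⟨_, θ, h, rfl⟩
  refine ⟨η, hη, fun ζ hζ hp => ?_⟩
  have h₁ := hp.total_lt hI hη.1 hζ.1
  have h₂ := hn _ ⟨ζ, hζ, rfl⟩
  omega

end SkASP

/-! ### Certificates -/

namespace StackProg

open Code

variable {α β : Type} [Code α] [Code β]

/-- The condition on an entry involves later entries only, so the list is scanned from its end while
the part already seen is kept. -/
theorem PolyPred.founded {D : α → List β → β → Prop} {l : α → List β}
    (hD : PolyPred fun p : (α × List β) × β => D p.1.1 p.1.2 p.2) (hl : PolyTime l) :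
    PolyPred fun a => Founded (D a) (l a) := by
  classical
  obtain ⟨q, hq⟩ := hl.size_le
  have hs : PolyTime fun p : (α × Bool × List β) × β => decide (D p.1.1 p.1.2.2 p.2) :=
    polyPred_iff.1 (hD.comp (g := fun p : (α × Bool × List β) × β => ((p.1.1, p.1.2.2), p.2))
      (by fun_prop))
  have : PolyTime fun a => (l a).reverse.foldl (fun s x => (decide (D a s.2 x) && s.1, x :: s.2))
      (true, []) := by
    refine PolyTime.foldl_of_add (f := fun a s x => (decide (D a s.2 x) && s.1, x :: s.2))
      (i := fun _ => (true, [])) (by fun_prop) (by fun_prop) (by fun_prop) (q + 1)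
      fun c s x hx => ?_
    have h₁ := sz_le_of_mem (List.mem_reverse.1 hx)
    have h₂ := hq c
    obtain ⟨b, s⟩ := s
    simp only [sz_prod, sz_bool, sz_cons, Polynomial.eval_add, Polynomial.eval_one]
    omega
  refine (PolyPred.of_bool (PolyTime.fst.comp this)).of_iff fun a => ?_
  suffices (l a).reverse.foldl (fun s x => (decide (D a s.2 x) && s.1, x :: s.2)) (true, []) =
      (decide (Founded (D a) (l a)), l a) by simp [this]
  induction l a with
  | nil => exact Prod.ext (decide_eq_true (p := Founded (D a) []) trivial).symm rfl
  | cons x l ih =>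
    rw [List.reverse_cons, List.foldl_append, ih]
    refine Prod.ext (Bool.eq_iff_iff.2 ?_) rfl
    simp only [List.foldl_cons, List.foldl_nil, Bool.and_eq_true, decide_eq_true_iff]
    rfl

theorem sz_list_le {l : List α} {m n : ℕ} (hm : l.length ≤ m) (hn : ∀ a ∈ l, sz a ≤ n) :
    sz l ≤ m * (n + 1) + 1 := by
  have h₁ := sz_le_of_forall hn
  have h₂ := Nat.mul_le_mul_right (n + 1) hm
  omega

end StackProg

/-! ### Checking certificates, and their size -/

namespace SkASP

open StackProg Code Computability

variable {α β γ δ : Type} [Code α] [Code β] [Code γ] [Code δ]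

@[fun_prop]
theorem polyPred_derives {I : α → Instance} {D : α → SubstData} {e X Y : α → List GAtom}
    {g : α → GAtom} (hI : PolyTime I) (hD : PolyTime D) (he : PolyTime e) (hX : PolyTime X)
    (hY : PolyTime Y) (hg : PolyTime g) : PolyPred fun a =>
      (I a).Derives (substOf (D a)) (e a) (interp (X a)) (interp (Y a)) (g a) :=
  PolyPred.or (by fun_prop) (PolyPred.existsMem (l := fun a => (I a).rules) (p := fun a r =>
    ExistsSome r.head fun b => b.eval (substOf (D a)) = some (g a) ∧ ForallMem r.body fun c =>
      c.Holds (substOf (D a)) (interp (X a)) (interp (Y a))) (by fun_prop) (by fun_prop))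

@[fun_prop]
theorem polyPred_reductModel {I : α → Instance} {D : α → SubstData} {e X Y : α → List GAtom}
    (hI : PolyTime I) (hD : PolyTime D) (he : PolyTime e) (hX : PolyTime X)
    (hY : PolyTime Y) : PolyPred fun a =>
      (I a).ReductModel (substOf (D a)) (e a) (interp (X a)) (interp (Y a)) :=
  (PolyPred.and (p := fun a => ForallMem (e a) fun g => g ∈ Y a)
    (q := fun a => ForallMem (I a).rules fun r => ForallSome r.head fun b =>
      ForallSome (b.eval (substOf (D a))) fun g => Implies (ForallMem r.body fun c =>
        c.Holds (substOf (D a)) (interp (X a)) (interp (Y a))) (g ∈ Y a)) (by fun_prop)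
    (by fun_prop)).of_iff fun a =>
    ⟨fun h => ⟨h.1, fun r hr b g hb hg hc => h.2 r hr b hb g hg hc⟩,
      fun h => ⟨h.1, fun r hr b hb g hg hc => h.2 r hr b g hb hg hc⟩⟩

@[fun_prop]
theorem polyPred_stableList {I : α → Instance} {D : α → SubstData} {e l : α → List GAtom}
    (hI : PolyTime I) (hD : PolyTime D) (he : PolyTime e) (hl : PolyTime l) :
    PolyPred fun a => (I a).StableList (substOf (D a)) (e a) (l a) :=
  PolyPred.and (by fun_prop) (PolyPred.founded (D := fun a k g =>
    (I a).Derives (substOf (D a)) (e a) (interp (l a)) (interp k) g) (by fun_prop) hl)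

@[fun_prop]
theorem polyPred_constraints {I : α → Instance} {D : α → SubstData} {X : α → List GAtom}
    (hI : PolyTime I) (hD : PolyTime D) (hX : PolyTime X) :
    PolyPred fun a => (I a).Constraints (substOf (D a)) (interp (X a)) :=
  PolyPred.forallMem (l := fun a => (I a).rules) (p := fun a r => Implies (r.head = none)
    (¬ ForallMem r.body fun c => c.Holds (substOf (D a)) (interp (X a)) (interp (X a))))
    (by fun_prop) (by fun_prop)

theorem polyTime_heads {I : α → Instance} {D : α → SubstData} {e : α → List GAtom}
    (hI : PolyTime I) (hD : PolyTime D) (he : PolyTime e) :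
    PolyTime fun a => (I a).heads (substOf (D a)) (e a) := by
  unfold Instance.heads
  fun_prop

/-- Certificates: an instance, a substitution, a ranking of the predicates and the stable models
for the examples. -/
abbrev Cert := Instance × SubstData × List (Sk Pred × ℕ) × List (List GAtom)

/-- The certificate shows that the word represents an instance with a solution. -/
def Check (x : List Γ') (c : Cert) : Prop :=
  encode c.1 = x ∧ c.1.WF ∧ c.1.Ranked (rankOf c.2.2.1) ∧ (substOf c.2.1).Valid c.1 ∧
    (ForallMem c.1.pos fun e => ExistsMem c.2.2.2 fun l =>
      c.1.StableList (substOf c.2.1) e l ∧ c.1.Constraints (substOf c.2.1) (interp l)) ∧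
    ForallMem c.1.neg fun e => ExistsMem c.2.2.2 fun l =>
      c.1.StableList (substOf c.2.1) e l ∧ ¬ c.1.Constraints (substOf c.2.1) (interp l)

theorem polyPred_check {x : α → List Γ'} {c : α → Cert} (hx : PolyTime x) (hc : PolyTime c) :
    PolyPred fun a => Check (x a) (c a) := by
  have h := polyTime_encode
  unfold Check
  fun_prop

theorem Check.mem {x : List Γ'} {c : Cert} (h : Check x c) : x ∈ decisionProblem := by
  obtain ⟨hx, hw, hr, hv, hp, hn⟩ := h
  refine ⟨c.1, hw, hr.stratified, (Instance.exists_solution_iff hw).2 ⟨substOf c.2.1, hv,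
    fun e he => ?_, fun e he => ?_⟩, hx.symm⟩
  · obtain ⟨l, -, hl, hc⟩ := hp e he
    exact ⟨interp l, Instance.answerSet_iff.2 ⟨hl.stable, hc⟩⟩
  · rintro ⟨X, hX⟩
    obtain ⟨l, -, hl, hc⟩ := hn e he
    rw [Instance.answerSet_iff] at hX
    -- By uniqueness the supposed answer set is the listed model, which violates a constraint.
    obtain rfl := (hr.existsUnique_stable hw hv e).unique hl.stable hX.1
    exact hc hX.2

/-- The values of the declared variables as an association list. -/
def restrict {α : Type} (ds : List (Decl α)) (f : Name → α) : List (Name × α) :=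
  (ds.map Decl.name).map fun s => (s, f s)

theorem lookup_restrict {α : Type} [Inhabited α] {ds : List (Decl α)} (f : Name → α) {d : Decl α}
    (hd : d ∈ ds) : lookup (restrict ds f) d.name = f d.name := by
  rw [lookup, restrict, find_map_self _ _ (List.mem_map.2 ⟨d, hd, rfl⟩)]
  rfl

/-- Each value is an entry of a domain, hence smaller than the declaration that contains it. -/
theorem sz_restrict_le {ds : List (Decl β)} {f : Name → β} (hf : InDom ds f) {n : ℕ}
    (hn : sz ds ≤ n) : sz (restrict ds f) ≤ n * (2 * n + 2) + 1 := by
  refine sz_list_le ?_ ?_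
  · have := length_lt_sz ds
    simp only [restrict, List.length_map]
    omega
  · simp only [restrict, List.map_map, List.mem_map, Function.comp]
    rintro _ ⟨d, hd, rfl⟩
    obtain ⟨z, hz⟩ := hf d hd
    have h₁ := sz_le_of_mem hd
    have h₂ := sz_le_of_mem hz
    have h₃ : sz d = sz d.name + sz d.dom + 1 := rfl
    rw [sz_prod] at h₂ ⊢
    omega

/-- The values of the declared variables as association lists. -/
def Instance.restrict (I : Instance) (θ : Subst) : SubstData :=
  (SkASP.restrict I.preds θ.pred, SkASP.restrict I.signs θ.sign, SkASP.restrict I.cmps θ.cmp,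
    SkASP.restrict I.ariths θ.arith, SkASP.restrict I.aggs θ.agg)

theorem Instance.agree_restrict (I : Instance) (θ : Subst) : I.Agree θ (substOf (I.restrict θ)) :=
  ⟨fun _ hd => (lookup_restrict _ hd).symm, fun _ hd => (lookup_restrict _ hd).symm,
    fun _ hd => (lookup_restrict _ hd).symm, fun _ hd => (lookup_restrict _ hd).symm,
    fun _ hd => (lookup_restrict _ hd).symm⟩

theorem Instance.sz_eq (I : Instance) : sz I = sz I.rules + sz I.preds + sz I.signs + sz I.cmps +
    sz I.ariths + sz I.aggs + sz I.pos + sz I.neg + 7 := by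
  change sz (I.rules, I.preds, I.signs, I.cmps, I.ariths, I.aggs, I.pos, I.neg) = _
  simp only [sz_prod]
  omega

theorem Instance.sz_restrict_le (I : Instance) {θ : Subst} (hθ : θ.Valid I) :
    sz (I.restrict θ) ≤ 5 * (sz I * (2 * sz I + 2) + 1) + 4 := by
  have h := I.sz_eq
  have h₁ := SkASP.sz_restrict_le hθ.pred (n := sz I) (by omega)
  have h₂ := SkASP.sz_restrict_le hθ.sign (n := sz I) (by omega)
  have h₃ := SkASP.sz_restrict_le hθ.cmp (n := sz I) (by omega)
  have h₄ := SkASP.sz_restrict_le hθ.arith (n := sz I) (by omega)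
  have h₅ := SkASP.sz_restrict_le hθ.agg (n := sz I) (by omega)
  simp only [Instance.restrict, sz_prod]
  omega

theorem sz_nat_le (n : ℕ) : sz n ≤ 6 * n + 1 := by
  have : n.size ≤ n := Nat.size_le.2 Nat.lt_two_pow_self
  rw [sz_nat]
  omega

/-- Ranks do not exceed the number of nodes, so a bound linear in the rank itself, rather than in
its number of digits, is good enough. -/
theorem exists_ranks : ∃ q : Polynomial ℕ, ∀ I : Instance, I.Stratified →
    ∃ l, I.Ranked (rankOf l) ∧ sz l ≤ q.eval (sz I) := by
  obtain ⟨q, hq⟩ := (polyTime_nodes (I := fun I => I) (by fun_prop)).size_le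
  refine ⟨q * (7 * q + 2 + 1) + 1, fun I hI => ?_⟩
  obtain ⟨ρ, hρ, hn⟩ := hI.ranked
  refine ⟨I.nodes.map fun p => (p, ρ p), hρ.congr fun p hp => ?_, ?_⟩
  · rw [rankOf, find_map_self _ _ hp]
    rfl
  · have h₁ := hq I
    have h₂ := length_lt_sz I.nodes
    have := sz_list_le (l := I.nodes.map fun p => (p, ρ p)) (m := q.eval (sz I))
      (n := 7 * q.eval (sz I) + 2) (by rw [List.length_map]; omega) (by
        simp only [List.mem_map]
        rintro _ ⟨p, hp, rfl⟩
        have h₃ := sz_le_of_mem hp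
        have h₄ := hn p
        have h₅ := sz_nat_le (ρ p)
        rw [sz_prod]
        omega)
    simpa using this

/-- The atoms of a model are among `heads`, which is computed in polynomial time and therefore has
polynomial size. Without repetitions, the model is no longer than that list. -/
theorem exists_models : ∃ q : Polynomial ℕ, ∀ (I : Instance) (D : SubstData),
    (∀ e ∈ I.pos ++ I.neg, ∃ X, I.Stable (substOf D) e X) →
    ∃ Xs : List (List GAtom), (∀ e ∈ I.pos ++ I.neg, ∃ l ∈ Xs, I.StableList (substOf D) e l) ∧
      sz Xs ≤ q.eval (sz I + sz D) := by
  obtain ⟨q, hq⟩ := (polyTime_heads (α := Instance × SubstData × List GAtom) (I := fun p => p.1)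
    (D := fun p => p.2.1) (e := fun p => p.2.2) (by fun_prop) (by fun_prop) (by fun_prop)).size_le
  let r : Polynomial ℕ := q.comp (2 * .X + 2)
  refine ⟨.X * (r * (r + 1) + 1 + 1) + 1, fun I D h => ?_⟩
  have key : ∀ e ∈ I.pos ++ I.neg, ∃ l, I.StableList (substOf D) e l ∧
      sz l ≤ r.eval (sz I + sz D) * (r.eval (sz I + sz D) + 1) + 1 := by
    intro e he
    obtain ⟨X, hX⟩ := h e he
    obtain ⟨l, h₁, h₂, -, h₃⟩ := hX.exists_list
    have h₄ : sz e ≤ sz I := by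
      have := I.sz_eq
      rcases List.mem_append.1 he with he | he <;> have := sz_le_of_mem he <;> omega
    have h₅ : sz (I.heads (substOf D) e) ≤ r.eval (sz I + sz D) := by
      refine (hq (I, D, e)).trans ?_
      simp only [r, Polynomial.eval_comp]
      refine polynomial_mono q ?_
      simp only [sz_prod, Polynomial.eval_add, Polynomial.eval_mul, Polynomial.eval_X,
        Polynomial.eval_ofNat]
      omega
    refine ⟨l, h₃, sz_list_le ?_ fun g hg => ?_⟩
    · have h₆ := (List.subperm_of_subset h₁ h₂).length_le
      have h₇ := length_lt_sz (I.heads (substOf D) e)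
      omega
    · have := sz_le_of_mem (h₂ g hg)
      omega
  choose f hf hs using key
  refine ⟨(I.pos ++ I.neg).attach.map fun e => f e.1 e.2, fun e he => ⟨f e he,
    List.mem_map.2 ⟨⟨e, he⟩, List.mem_attach _ _, rfl⟩, hf e he⟩, ?_⟩
  have := sz_list_le (l := (I.pos ++ I.neg).attach.map fun e => f e.1 e.2) (m := sz I + sz D)
    (n := r.eval (sz I + sz D) * (r.eval (sz I + sz D) + 1) + 1) (by
      have h₁ := length_lt_sz I.pos
      have h₂ := length_lt_sz I.neg
      have := I.sz_eq
      simp only [List.length_map, List.length_attach, List.length_append]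
      omega) (by
      simp only [List.mem_map]
      rintro _ ⟨e, -, rfl⟩
      exact hs e.1 e.2)
  simpa using this

theorem exists_cert : ∃ q : Polynomial ℕ, ∀ x ∈ decisionProblem, ∃ c : Cert, Check x c ∧
    sz c ≤ q.eval x.length := by
  obtain ⟨C, hC⟩ := small_encode
  obtain ⟨q, hq⟩ := exists_ranks
  obtain ⟨r, hr⟩ := exists_models
  let s : Polynomial ℕ := 5 * (.X * (2 * .X + 2) + 1) + 4
  refine ⟨(.X + s + q + r.comp (.X + s) + 3).comp (.C C * .X), ?_⟩
  rintro _ ⟨I, hw, hs, hsol, rfl⟩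
  obtain ⟨θ, hθ⟩ := (Instance.exists_solution_iff hw).1 hsol
  obtain ⟨R, hR, hRs⟩ := hq I hs
  set D := I.restrict θ with hD
  have hDs : sz D ≤ s.eval (sz I) := by
    simpa [s] using I.sz_restrict_le hθ.1
  -- From here on the association lists `D` take the place of `θ`.
  obtain ⟨hv, hp, hn⟩ := (I.agree_restrict θ).satisfying hw hθ
  rw [← hD] at hv hp hn
  obtain ⟨Xs, hXs, hXl⟩ := hr I D fun e _ => (hR.existsUnique_stable hw hv e).exists
  refine ⟨(I, D, R, Xs), ⟨rfl, hw, hR, hv, fun e he => ?_, fun e he => ?_⟩, ?_⟩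
  · obtain ⟨l, hl, hsl⟩ := hXs e (List.mem_append_left _ he)
    obtain ⟨X, hX⟩ := hp e he
    rw [Instance.answerSet_iff] at hX
    -- The answer set and the listed model are both stable, hence equal, and the constraints carry
    -- over.
    obtain rfl := (hR.existsUnique_stable hw hv e).unique hsl.stable hX.1
    exact ⟨l, hl, hsl, hX.2⟩
  · obtain ⟨l, hl, hsl⟩ := hXs e (List.mem_append_right _ he)
    exact ⟨l, hl, hsl, fun hc => hn e he ⟨_, Instance.answerSet_iff.2 ⟨hsl.stable, hc⟩⟩⟩
  · have h₁ : sz I ≤ C * (encode I).length := by have := hC I; omega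
    have h₂ := polynomial_mono r (Nat.add_le_add_left hDs (sz I))
    rw [Polynomial.eval_comp]
    refine le_trans ?_ (polynomial_mono _ (m := sz I) (by simpa using h₁))
    simp only [sz_prod, Polynomial.eval_add, Polynomial.eval_comp, Polynomial.eval_X,
      Polynomial.eval_ofNat]
    omega

/-! ### Certificates as words -/

/-- The preorder notation of a tree. -/
def treeBits : BinTree → List Bool
  | .leaf => [false]
  | .node l r => true :: (treeBits l ++ treeBits r)

/-- One step of the reading of a preorder notation from its end. -/
def treeStep (s : List BinTree) (b : Bool) : List BinTree :=
  bif b then s.elim' [] fun l s => s.elim' [] fun r s => .node l r :: s else .leaf :: s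

/-- Reads a preorder notation. -/
def treeOf (w : List Bool) : BinTree := ((w.reverse.foldl treeStep []).head?).getD .leaf

/-- When a preorder notation is read from its end, both subtrees are on the stack by the time their
node is met. -/
theorem treeOf_treeBits (t : BinTree) : treeOf (treeBits t) = t := by
  suffices ∀ s, (treeBits t).foldr (fun b s => treeStep s b) s = t :: s by
    rw [treeOf, List.foldl_reverse, this]
    rfl
  induction t with
  | leaf => exact fun s => rfl
  | node l r ihl ihr =>
    intro s
    rw [treeBits, List.foldr_cons, List.foldr_append, ihr, ihl]
    rfl

theorem length_treeBits (t : BinTree) : (treeBits t).length = t.size := by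
  induction t with
  | leaf => rfl
  | node l r ihl ihr => simp [treeBits, BinTree.size, ihl, ihr]

theorem polyTime_treeOf : PolyTime treeOf := by
  have : PolyTime fun w : List Bool => w.reverse.foldl treeStep [] := by
    refine PolyTime.foldl_of_add (f := fun _ => treeStep) (i := fun _ => []) ?_ (by fun_prop)
      (by fun_prop) 2 fun c s b _ => ?_
    · unfold treeStep
      fun_prop
    · have h : ∀ t : BinTree, sz t = t.size := fun _ => rfl
      cases b
      · simp [treeStep, sz_cons, h, BinTree.size]
        omega
      · rcases s with _ | ⟨l, _ | ⟨r, s⟩⟩ <;>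
          simp only [treeStep, List.elim', sz_cons, sz_nil, h, BinTree.size, cond_true,
            Polynomial.eval_ofNat] <;> omega
  unfold treeOf
  fun_prop

/-- Trees are their own codes, so this is just the normalization that `Code` demands. -/
theorem polyTime_dec : PolyTime (dec : BinTree → α) := Code.pt

open Classical in
/-- The verifier. -/
noncomputable def verify (x : List Γ') (w : List Bool) : Bool := decide (Check x (dec (treeOf w)))

theorem polyTime_verify {x : α → List Γ'} {w : α → List Bool} (hx : PolyTime x) (hw : PolyTime w) :
    PolyTime fun a => verify (x a) (w a) := by
  have h : PolyTime fun a => (dec (treeOf (w a)) : Cert) :=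
    polyTime_dec.comp (polyTime_treeOf.comp hw)
  exact polyPred_check hx h

-- Every word decodes to some certificate, so soundness needs neither a format nor a length bound
-- for `w`.
open Classical in
theorem mem_decisionProblem_iff : ∃ p : Polynomial ℕ, ∀ x, x ∈ decisionProblem ↔
    ∃ w : List Bool, w.length ≤ p.eval x.length ∧ verify x w = true := by
  obtain ⟨q, hq⟩ := exists_cert
  refine ⟨q, fun x => ⟨fun hx => ?_, fun ⟨w, _, hw⟩ => (of_decide_eq_true hw).mem⟩⟩
  obtain ⟨c, hc, hs⟩ := hq x hx
  refine ⟨treeBits (enc c), by rwa [length_treeBits], ?_⟩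
  rw [verify, treeOf_treeBits, dec_enc]
  exact decide_eq_true hc

end SkASP

/-! ### Turing machines -/

namespace StackProg

open Turing Function Code

variable {A : Type}

namespace Prog

/-- Pushes a word onto stack `a`. -/
def pushList : List Sym → Prog (Alph A)
  | [] => skip
  | x :: l => seq (push .a x) (pushList l)

theorem Runs.pushList {i : List A} {o : List Bool} {m b c : List Sym} (l : List Sym) :
    ∀ {a}, Runs (A := A) (pushList l) (st i o m a b c) (st i o m (l.reverse ++ a) b c)
      (l.length + 1) := by
  induction l with
  | nil => exact .skip
  | cons x l ih =>
    intro a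
    have := Runs.push_a.seq (ih (a := x :: a))
    rw [List.reverse_cons, List.append_assoc]
    exact this.mono (by rw [List.length_cons]; omega)

/-- Translates a truth value from a tree to the output. -/
def write : Prog (Alph A) :=
  case .m fun _ => case .m fun h : Option Sym => seq (push .out (h == some .node))
    (case .m fun _ => case .m fun _ => case .m fun _ => skip)

/-- The codes of the truth values are told apart by their second symbol. The other symbols are
popped too, because the machine has to halt with its work stacks empty. -/
theorem Runs.write_symbols (s₁ s₂ s₃ s₄ s₅ : Sym) :
    Runs (A := A) write (st [] [] [s₁, s₂, s₃, s₄, s₅] [] [] [])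
      (st [] [some s₂ == some .node] [] [] [] []) 7 :=
  .last_m rfl (.last_m rfl (.mono (.seq .push_out (.last_m rfl (.last_m rfl (.last_m rfl .skip))))
    (le_refl 5)))

theorem Runs.write (x : Bool) : Runs (A := A) write (st [] [] ((enc x).ser ++ []) [] [] [])
    (st [] [x] [] [] [] []) 7 := by
  cases x
  · exact .write_symbols .node .leaf .node .leaf .leaf
  · exact .write_symbols .node .node .leaf .leaf .leaf

variable [Code A]

/-- Translates the input to a tree, which is written backwards onto stack `a`. -/
def readLoop : Prog (Alph A) :=
  loop .inp (fun h : Option A => h.elim (push .a .leaf) fun x => pushList (.node :: (enc x).ser))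
    fun h : Option A => h.isNone

/-- In prefix notation the code of a list is a node symbol and the code of the entry for each entry,
then a leaf. The input can thus be translated symbol by symbol. -/
theorem Runs.readLoop {o : List Bool} {m b c : List Sym} (l : List A) :
    ∀ {a}, Runs (A := A) readLoop (st l o m a b c) (st [] o m ((enc l).ser.reverse ++ a) b c)
      (4 * sz l) := by
  induction l with
  | nil =>
    intro a
    refine Runs.mono (n := 1 + 1) (.last (h := none) rfl rfl ?_) (by rw [sz_nil]; omega)
    rw [st_update_inp]
    exact .push_a
  | cons x l ih =>
    intro a
    refine Runs.mono (.cont (h := some x) rfl rfl (S' := st l o m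
      ((Sym.node :: (enc x).ser).reverse ++ a) b c) (n := (enc x).size + 1 + 1)
      (n' := 4 * sz l) ?_ ?_) ?_
    · rw [st_update_inp]
      have := Runs.pushList (A := A) (i := l) (o := o) (m := m) (b := b) (c := c)
        (Sym.node :: (enc x).ser) (a := a)
      rwa [List.length_cons, BinTree.length_ser] at this
    · have := ih (a := (Sym.node :: (enc x).ser).reverse ++ a)
      simpa [enc_list, BinTree.ofList, BinTree.ser, Prog.readLoop] using this
    · rw [sz_cons]
      change _ ≤ 4 * ((enc x).size + sz l + 1)
      omega

/-- Translates the input to a tree. -/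
def read : Prog (Alph A) := seq (push .a .mark) (seq readLoop backA)

theorem Runs.read (l : List A) : Runs (A := A) read (st l [] [] [] [] [])
    (st [] [] ((enc l).ser ++ []) [] [] []) (6 * sz l + 3) := by
  have h := Runs.backA (A := A) (i := []) (o := []) (m := []) (a := []) (b := []) (c := [])
    (enc l).ser.reverse (by simpa using (enc l).mark_notMem_ser)
  rw [List.reverse_reverse, List.length_reverse, BinTree.length_ser] at h
  exact (Runs.push_a.seq ((Runs.readLoop l).seq h)).mono (by
    change 1 + (4 * sz l + (2 * sz l + 2)) ≤ _; omega)

end Prog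

instance finite_alph [Finite A] : ∀ k, Finite (Alph A k)
  | .inp => inferInstanceAs (Finite A)
  | .out => inferInstanceAs (Finite Bool)
  | .m => inferInstanceAs (Finite Sym)
  | .a => inferInstanceAs (Finite Sym)
  | .b => inferInstanceAs (Finite Sym)
  | .c => inferInstanceAs (Finite Sym)

/-- The machine that runs a program. -/
noncomputable def machine [Finite A] (p : Prog (Alph A)) : FinTM2 where
  K := Stack
  k₀ := .inp
  k₁ := .out
  Γ := Alph A
  Λ := Option (Prog.Lab p)
  main := some p.entry
  ΛFin := Fintype.ofFinite _
  σ := ∀ k, Option (Alph A k)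
  initialState := fun _ => none
  σFin := Fintype.ofFinite _
  Γk₀Fin := Fintype.ofFinite A
  m
    | some l => p.code some none l
    | none => .load (fun _ _ => none) .halt

theorem Prog.Runs.outputs [Finite A] {p : Prog (Alph A)} {l : List A} {x : Bool} {n : ℕ}
    (h : p.Runs (st l [] [] [] [] []) (st [] [x] [] [] [] []) n) :
    Nonempty (TM2OutputsInTime (machine p) l (some [x]) (n + 1)) := by
  obtain ⟨k, hk, h⟩ := h
  obtain ⟨v, hv⟩ := h.steps (machine p).m some none (fun _ => rfl) fun _ => none
  have h₁ : initList (machine p) l = ⟨some (some p.entry), fun _ => none, st l [] [] [] [] []⟩ := by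
    unfold initList
    congr 1
    funext k
    cases k <;> rfl
  have h₂ : haltList (machine p) [x] = ⟨none, fun _ => none, st [] [x] [] [] [] []⟩ := by
    unfold haltList
    congr 1
    funext k
    cases k <;> rfl
  -- The additional step halts and resets the memory to its initial state, as `haltList` requires.
  refine ⟨⟨⟨k + 1, ?_⟩, Nat.succ_le_succ hk⟩⟩
  have h₃ : Prog.Steps (machine p).m 1 ⟨some none, v, st [] [x] [] [] [] []⟩
      ⟨none, fun _ => none, st [] [x] [] [] [] []⟩ := rfl
  rw [h₁, Option.map_some, h₂]
  exact hv.trans h₃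

theorem PolyTime.tm2 [Finite A] [Code A] {f : List A → Bool} (hf : PolyTime f) {α : Type} {e : α → List A}
    {g : α → Bool} (h : ∀ a, g a = f (e a)) :
    Nonempty (TM2ComputableInPolyTime e Computability.encodeBool g) := by
  obtain ⟨q, hq⟩ := hf
  obtain ⟨p, hp⟩ := (hq).2 A
  -- Since the alphabet is finite, the code of a word is at most linear in the length of the word.
  obtain ⟨C, hC⟩ := (Set.finite_range (sz : A → ℕ)).bddAbove
  -- The `11` adds up the `3` of reading, the `7` of writing and the halting step.
  have key (l l' : List A) (hl : l' = l) :
      Nonempty (TM2OutputsInTime (machine (.seq .read (.seq p .write))) l'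
      (some [f l]) ((((6 * .X + q + 11 : Polynomial ℕ)).comp (.X * .C (C + 1) + 1)).eval l.length)) := by
    subst l'
    have h₁ := hp (enc l) [] [] [] [] [] []
    simp only [dec_enc] at h₁
    obtain ⟨h₂⟩ := Prog.Runs.outputs ((Prog.Runs.read l).seq (h₁.seq (Prog.Runs.write (f l))))
    refine ⟨⟨h₂.1, h₂.2.trans ?_⟩⟩
    have h₃ : sz l ≤ l.length * (C + 1) + 1 := sz_list_le le_rfl fun a _ => hC ⟨a, rfl⟩
    rw [Polynomial.eval_comp]
    refine le_trans ?_ (polynomial_mono _ (m := sz l) (by simpa using h₃))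
    simp only [Polynomial.eval_add, Polynomial.eval_mul, Polynomial.eval_X, Polynomial.eval_ofNat]
    change _ + (q.eval (sz l) + _) + 1 ≤ _
    omega
  exact ⟨{
    tm := machine (.seq .read (.seq p .write))
    inputAlphabet := Equiv.refl A
    outputAlphabet := Equiv.refl Bool
    time := (6 * .X + q + 11 : Polynomial ℕ).comp (.X * .C (C + 1) + 1)
    outputsFun := fun a => by
      have := (key (e a) _ (List.map_id (e a))).some
      rw [← h] at this
      exact this }⟩

end StackProg

/-! ### Membership in NP -/

namespace SkASP

open StackProg Code Computability

/-- Word and certificate are marked by the two sides of `Γ' ⊕ Bool`, so the verifier recovers each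
of them by filtering the input. -/
theorem inNP_decisionProblem : InNP decisionProblem := by
  obtain ⟨p, hp⟩ := mem_decisionProblem_iff
  refine ⟨fun x => verify x.1 x.2, p, ?_, hp⟩
  have hl : PolyTime (Sum.getLeft? : Γ' ⊕ Bool → Option Γ') :=
    (PolyTime.sum_elim (o := fun x : Γ' ⊕ Bool => x) (f := fun _ x => some x) (g := fun _ _ => none)
      (by fun_prop) (by fun_prop) (by fun_prop)).of_eq fun x => by cases x <;> rfl
  have hr : PolyTime (Sum.getRight? : Γ' ⊕ Bool → Option Bool) :=
    (PolyTime.sum_elim (o := fun x : Γ' ⊕ Bool => x) (f := fun _ _ => none) (g := fun _ x => some x)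
      (by fun_prop) (by fun_prop) (by fun_prop)).of_eq fun x => by cases x <;> rfl
  have hv : PolyTime fun l : List (Γ' ⊕ Bool) =>
      verify (l.filterMap Sum.getLeft?) (l.filterMap Sum.getRight?) :=
    polyTime_verify (by fun_prop) (by fun_prop)
  refine hv.tm2 fun x => ?_
  congr 1 <;> simp [encodingProd, encodingList, Function.comp_def]

end SkASP

/-- The decision version of propositional SkASP is in NP. -/
theorem theorem2 : InNP SkASP.decisionProblem := by
  exact SkASP.inNP_decisionProblem
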